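/- Work over $\mathbb{C}$. Let $n\ge 2$, $k\ge 3$, let $\mathbb{P}=\mathbb{P}^{2n+1}$ have homogeneous coordinates $x_0,\dots,x_n,y_0,\dots,y_n$, and let $J=\begin{pmatrix}0&I\\-I&0\end{pmatrix}$ be the standard symplectic form on $\mathbb{C}^{2n+2k}$. A $k\times(2n+2k)$ matrix $A$ of linear forms on $\mathbb{P}$ is said to define a symplectic $k$-instanton bundle if $AJA^t=0$, $A$ has rank $k$ at every point of $\mathbb{P}$, and the cohomology bundle $E_A$ of the monad $$\mathcal{O}_{\mathbb{P}}(-1)^{\oplus k}\xrightarrow{\ JA^t\ }\mathcal{O}_{\mathbb{P}}^{\oplus(2n+2k)}\xrightarrow{\ A\ }\mathcal{O}_{\mathbb{P}}(1)^{\oplus k}$$ is trivial on a general line; $E_A$ is then a symplectic $k$-instanton bundle. It is a 't Hooft bundle if it is isomorphic to some $E_T$, where $T$ defines a symplectic $k$-instanton bundle and $T=a\cdot(D|D')$ with $a\in\mathrm{Mat}_{k\times(n+k)}(\mathbb{C})$ and $D,D'$ diagonal matrices of linear forms. It is an RS-instanton bundle if $A=(F|H)$, where $F$ is the $k\times(n+k)$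 band matrix whose $i$-th row is $(0,\dots,0,f_0,\dots,f_n,0,\dots,0)$ with $f_0$ in column $i$, the linear forms $f_0,\dots,f_n$ cut out a linear $n$-space $L$, and $H=(h_{ij})$ is a $k\times(n+k)$ persymmetric matrix of linear forms ($h_{ij}=h_{st}$ whenever $i+j=s+t$) whose maximal minors have no common zero on $L$. A symplectic $k$-instanton bundle is a limit of 't Hooft bundles if it is isomorphic to $E_B$ for some matrix $B$ that defines a symplectic $k$-instanton bundle and lies in the Zariski closure (in the affine space of $k\times(2n+2k)$ matrices of linear forms) of the set of all $A$ that define symplectic $k$-instanton bundles which are 't Hooft bundles. For $\varepsilon\in\mathbb{C}$ let $A_\varepsilon=(F|H_\varepsilon)$, where $F$ is the band matrix with $f_s=x_s$, and $H_\varepsilon$ is the $k\times(n+k)$ matrix whose entry in row $i$ and column $j$ ($1\le i\le k$, $1\le j\le n+k$) is $y_{i+j-k-1}$ if $k+1\le i+j\le n+k+1$, is $\varepsilon y_1$ if $(i,j)=(1,1)$ or $(i,j)=(k,n+k)$, and is $0$ otherwise. Then there is a $\delta>0$ (depending on $n$ and $k$) such that for every $\varepsilon\in\mathbb{C}$ with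 $0<|\varepsilon|<\delta$ the matrix $A_\varepsilon$ defines a symplectic $k$-instanton bundle $E_\varepsilon=E_{A_\varepsilon}$, this is an RS-instanton bundle, it satisfies $$H^0(\mathbb{P},E_\varepsilon(1))=0,$$ and it is not a limit of 't Hooft bundles. -/

import Mathlib

open CategoryTheory AlgebraicGeometry TopologicalSpace Opposite MvPolynomial Limits

noncomputable section
namespace RSInstanton

instance gradedPoly (σ : Type) : GradedAlgebra (homogeneousSubmodule σ ℂ) := gradedAlgebra

/-- The projective space over `ℂ` with homogeneous coordinates `X v`, `v : σ`, as a scheme. -/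
abbrev PP (σ : Type) : Scheme.{0} := Proj (homogeneousSubmodule σ ℂ)

/-- The homogeneous prime ideal of a point. -/
abbrev primeAt {σ : Type} (x : PP σ) : Ideal (MvPolynomial σ ℂ) :=
  HomogeneousIdeal.toIdeal (ProjectiveSpectrum.asHomogeneousIdeal (𝒜 := homogeneousSubmodule σ ℂ) x)

instance primeAt_isPrime {σ : Type} (x : PP σ) : (primeAt x).IsPrime :=
  ProjectiveSpectrum.isPrime (𝒜 := homogeneousSubmodule σ ℂ) x

/-- The localization of the polynomial ring at the homogeneous prime ideal of `x`. -/
abbrev LocAt {σ : Type} (x : PP σ) : Type :=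
  Localization (primeAt x).primeCompl

/-- `f` is given on `U` by one fraction `r / s` of homogeneous polynomials with
`deg r - deg s = d`. -/
def IsFrac {σ : Type} (d : ℤ) {U : (PP σ).Opens} (f : ∀ x : U, LocAt x.1) : Prop :=
  ∃ (i j : ℕ) (r s : MvPolynomial σ ℂ), r.IsHomogeneous i ∧ s.IsHomogeneous j ∧ (i : ℤ) = j + d ∧
    ∃ hs : ∀ x : U, s ∈ (primeAt x.1).primeCompl,
    ∀ x : U, f x = Localization.mk r ⟨s, hs x⟩

/-- `f` is locally a fraction of homogeneous polynomials of degree `d`. -/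
def isLocFrac (σ : Type) (d : ℤ) :
    TopCat.LocalPredicate (X := (PP σ).carrier) (fun x => LocAt x) :=
  TopCat.PrelocalPredicate.sheafify
    { pred := fun {U} f => IsFrac (σ := σ) d (U := U) f
      res := by
        rintro U V i f ⟨a, b, r, s, hr, hs, hd, hn, hf⟩
        exact ⟨a, b, r, s, hr, hs, hd, fun x => hn (i x), fun x => hf (i x)⟩ }

/-- The germ at `x` of a regular function, in the localization at `x`. -/
def evalAt {σ : Type} {U : (PP σ).Opens} (r : Γ(PP σ, U)) (x : U) : LocAt x.1 :=
  HomogeneousLocalization.val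
    (Subtype.val (p := (ProjectiveSpectrum.StructureSheaf.isLocallyFraction
      (homogeneousSubmodule σ ℂ)).pred) r x)

theorem evalAt_add {σ : Type} {U : (PP σ).Opens} (r s : Γ(PP σ, U)) (x : U) :
    evalAt (r + s) x = evalAt r x + evalAt s x := by
  exact HomogeneousLocalization.val_add _ _
theorem evalAt_mul {σ : Type} {U : (PP σ).Opens} (r s : Γ(PP σ, U)) (x : U) :
    evalAt (r * s) x = evalAt r x * evalAt s x := by
  exact HomogeneousLocalization.val_mul _ _
theorem evalAt_one {σ : Type} {U : (PP σ).Opens} (x : U) : evalAt (1 : Γ(PP σ, U)) x = 1 := by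
  exact HomogeneousLocalization.val_one
theorem evalAt_zero {σ : Type} {U : (PP σ).Opens} (x : U) : evalAt (0 : Γ(PP σ, U)) x = 0 := by
  exact HomogeneousLocalization.val_zero
theorem evalAt_frac {σ : Type} {U : (PP σ).Opens} (r : Γ(PP σ, U)) (x : U) :
   ∃ (V : (PP σ).Opens) (_ : x.1 ∈ V) (i : V ⟶ U), IsFrac 0 (fun y : V => evalAt r (i y)) := by
  obtain ⟨V, hx, i, j, a, b, hs, h⟩ := r.2 x
  refine ⟨V, hx, i, j, j, a.1, b.1, a.2, b.2, by simp, hs, fun y => ?_⟩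
  exact (congrArg HomogeneousLocalization.val (h y)).trans (HomogeneousLocalization.val_mk _)


theorem IsFrac.res {σ : Type} {d : ℤ} {U V : (PP σ).Opens} {f : ∀ x : V, LocAt x.1}
    (h : IsFrac d f) (i : U ⟶ V) : IsFrac d (fun x : U => f (i x)) := by
  obtain ⟨a, b, r, s, hr, hs, hd, hn, hf⟩ := h
  exact ⟨a, b, r, s, hr, hs, hd, fun x => hn (i x), fun x => hf (i x)⟩

theorem IsFrac.cast {σ : Type} {d e : ℤ} {U : (PP σ).Opens} {f : ∀ x : U, LocAt x.1}
    (h : IsFrac d f) (hde : d = e) : IsFrac e f := hde ▸ h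

theorem exists_X_notMem {σ : Type} (x : PP σ) : ∃ v : σ, X v ∈ (primeAt x).primeCompl := by
  by_contra! h
  refine ProjectiveSpectrum.not_irrelevant_le (𝒜 := homogeneousSubmodule σ ℂ) x fun f hf => ?_
  have hf0 : coeff 0 f = 0 := by
    have h0 : homogeneousComponent 0 f = 0 :=
      (decomposition.decompose'_apply f 0).symm.trans ((HomogeneousIdeal.mem_irrelevant_iff _ _).1 hf)
    rw [homogeneousComponent_zero] at h0
    exact C_eq_zero.1 h0
  have hle : Ideal.span (Set.range (X : σ → MvPolynomial σ ℂ)) ≤ primeAt x := by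
    rw [Ideal.span_le]
    rintro _ ⟨v, rfl⟩
    exact not_not.1 (h v)
  refine hle ?_
  rw [← Set.image_univ, mem_ideal_span_X_image]
  intro m hm
  by_contra! hne
  have : m = 0 := Finsupp.ext fun v => hne v (Set.mem_univ v)
  exact mem_support_iff.1 hm (this ▸ hf0)

theorem isFrac_zero {σ : Type} (d : ℤ) {U : (PP σ).Opens} (v : σ)
    (hv : ∀ x : U, X v ∈ (primeAt x.1).primeCompl) :
    IsFrac d (fun x : U => (0 : LocAt x.1)) :=
  ⟨d.toNat, (-d).toNat, 0, X v ^ (-d).toNat, isHomogeneous_zero _ _ _,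
    by simpa using (isHomogeneous_X ℂ v).pow (-d).toNat, by omega,
    fun x => Submonoid.pow_mem _ (hv x) _, fun x => (Localization.mk_zero _).symm⟩

theorem isFrac_add {σ : Type} {d : ℤ} {U : (PP σ).Opens} {f g : ∀ x : U, LocAt x.1}
    (hf : IsFrac d f) (hg : IsFrac d g) : IsFrac d (fun x => f x + g x) := by
  obtain ⟨a, b, r, s, hr, hs, hd, hn, hf⟩ := hf
  obtain ⟨a', b', r', s', hr', hs', hd', hn', hf'⟩ := hg
  refine ⟨a + b', b + b', r * s' + r' * s, s * s', (hr.mul hs').add ?_, hs.mul hs', by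
    push_cast; omega, fun x => (primeAt x.1).primeCompl.mul_mem (hn x) (hn' x), fun x => ?_⟩
  · rw [show a + b' = a' + b by omega]
    exact hr'.mul hs
  · change f x + g x = _
    rw [hf x, hf' x, Localization.add_mk]
    congr 1
    simp only
    ring

theorem isFrac_mul {σ : Type} {d e : ℤ} {U : (PP σ).Opens} {f g : ∀ x : U, LocAt x.1}
    (hf : IsFrac d f) (hg : IsFrac e g) : IsFrac (d + e) (fun x => f x * g x) := by
  obtain ⟨a, b, r, s, hr, hs, hd, hn, hf⟩ := hf
  obtain ⟨a', b', r', s', hr', hs', hd', hn', hf'⟩ := hg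
  refine ⟨a + a', b + b', r * r', s * s', hr.mul hr', hs.mul hs', by
    push_cast; omega, fun x => (primeAt x.1).primeCompl.mul_mem (hn x) (hn' x), fun x => ?_⟩
  change f x * g x = _
  rw [hf x, hf' x, Localization.mk_mul]
  rfl

theorem isFrac_neg {σ : Type} {d : ℤ} {U : (PP σ).Opens} {f : ∀ x : U, LocAt x.1}
    (hf : IsFrac d f) : IsFrac d (fun x => - f x) := by
  obtain ⟨a, b, r, s, hr, hs, hd, hn, hf⟩ := hf
  exact ⟨a, b, -r, s, hr.neg, hs, hd, hn, fun x => by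
    change - f x = _
    rw [hf x, Localization.neg_mk]⟩

theorem isFrac_of_poly {σ : Type} {m : ℕ} {p : MvPolynomial σ ℂ} (hp : p.IsHomogeneous m)
    (U : (PP σ).Opens) : IsFrac m (fun x : U => algebraMap _ (LocAt x.1) p) :=
  ⟨m, 0, p, 1, hp, isHomogeneous_one _ _, by simp, fun x => one_mem _,
    fun x => (Localization.mk_one_eq_algebraMap p).symm⟩

/-- The sections of `O(d)` over `U`: functions with values in the local rings that are locally
fractions of homogeneous polynomials of degree `d`. -/
def sectionsO (σ : Type) (d : ℤ) (U : (PP σ).Opens) : AddSubgroup (∀ x : U, LocAt x.1) where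
  carrier := {f | (isLocFrac σ d).pred f}
  zero_mem' := fun x => by
    obtain ⟨v, hv⟩ := exists_X_notMem x.1
    exact ⟨U ⊓ Proj.basicOpen _ (X v), ⟨x.2, hv⟩, Opens.infLELeft _ _,
      isFrac_zero d v fun y => y.2.2⟩
  add_mem' := fun {f g} hf hg x => by
    obtain ⟨V, hxV, i, hV⟩ := hf x
    obtain ⟨W, hxW, j, hW⟩ := hg x
    exact ⟨V ⊓ W, ⟨hxV, hxW⟩, Opens.infLELeft V W ≫ i,
      isFrac_add (hV.res (Opens.infLELeft V W)) (hW.res (Opens.infLERight V W))⟩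
  neg_mem' := fun {f} hf x => by
    obtain ⟨V, hxV, i, hV⟩ := hf x
    exact ⟨V, hxV, i, isFrac_neg hV⟩

instance sectionsO_module (σ : Type) (d : ℤ) (U : (PP σ).Opens) :
    Module Γ(PP σ, U) (sectionsO σ d U) where
  smul r f := ⟨fun x => evalAt r x * f.1 x, fun x => by
    obtain ⟨V, hxV, i, hV⟩ := evalAt_frac r x
    obtain ⟨W, hxW, j, hW⟩ := f.2 x
    exact ⟨V ⊓ W, ⟨hxV, hxW⟩, Opens.infLELeft V W ≫ i,
      (isFrac_mul (hV.res (Opens.infLELeft V W)) (hW.res (Opens.infLERight V W))).cast (zero_add d)⟩⟩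
  one_smul f := Subtype.ext (funext fun x => by
    change evalAt 1 x * f.1 x = _
    rw [evalAt_one, one_mul])
  mul_smul r s f := Subtype.ext (funext fun x => by
    change evalAt (r * s) x * f.1 x = evalAt r x * (evalAt s x * f.1 x)
    rw [evalAt_mul, mul_assoc])
  smul_zero r := Subtype.ext (funext fun x => mul_zero _)
  smul_add r f g := Subtype.ext (funext fun x => mul_add _ _ _)
  add_smul r s f := Subtype.ext (funext fun x => by
    change evalAt (r + s) x * f.1 x = evalAt r x * f.1 x + evalAt s x * f.1 x
    rw [evalAt_add, add_mul])
  zero_smul f := Subtype.ext (funext fun x => by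
    change evalAt 0 x * f.1 x = 0
    rw [evalAt_zero, zero_mul])

/-- The presheaf of abelian groups underlying `O(d)`. -/
def presheafO (σ : Type) (d : ℤ) : TopCat.Presheaf Ab (PP σ) where
  obj U := AddCommGrpCat.of (sectionsO σ d U.unop)
  map {U V} i := AddCommGrpCat.ofHom
    { toFun := fun f => ⟨fun x => f.1 ⟨x.1, i.unop.le x.2⟩, (isLocFrac σ d).res i.unop f.1 f.2⟩
      map_zero' := rfl
      map_add' := fun _ _ => rfl }

instance presheafO_module (σ : Type) (d : ℤ) (U : (Opens (PP σ))ᵒᵖ) :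
    Module ((PP σ).ringCatSheaf.obj.obj U) ((presheafO σ d).obj U) :=
  inferInstanceAs (Module Γ(PP σ, U.unop) (sectionsO σ d U.unop))

/-- The sheaf of modules `O(d)`. -/
def O (σ : Type) (d : ℤ) : (PP σ).Modules where
  val := PresheafOfModules.ofPresheaf (presheafO σ d) (by
    intro U V i r m
    rfl)
  isSheaf := by
    change TopCat.Presheaf.IsSheaf (presheafO σ d)
    refine (TopCat.Presheaf.isSheaf_iff_isSheaf_comp (forget Ab) (presheafO σ d)).2 ?_
    exact (TopCat.subsheafToTypes (isLocFrac σ d)).2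

/-- Multiplication by a homogeneous polynomial of degree `m`, on sections. -/
def mulPresheaf {σ : Type} {d e : ℤ} (m : ℕ) (h : e = d + m) (p : homogeneousSubmodule σ ℂ m) :
    presheafO σ d ⟶ presheafO σ e where
  app U := AddCommGrpCat.ofHom
    { toFun := fun f => ⟨fun x => algebraMap _ _ p.1 * f.1 x, by
        intro x
        obtain ⟨V, hxV, i, hV⟩ := f.2 x
        exact ⟨V, hxV, i, (isFrac_mul (isFrac_of_poly p.2 V) hV).cast (by omega)⟩⟩
      map_zero' := Subtype.ext (funext fun x => mul_zero _)
      map_add' := fun f g => Subtype.ext (funext fun x => mul_add _ _ _) }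

/-- Multiplication `O(d) ⟶ O(d + m)` by a homogeneous polynomial of degree `m`. -/
def mulO {σ : Type} {d e : ℤ} (m : ℕ) (h : e = d + m) (p : homogeneousSubmodule σ ℂ m) :
    O σ d ⟶ O σ e where
  val := PresheafOfModules.homMk (mulPresheaf m h p) (by
    intro U r f
    exact Subtype.ext (funext fun x => mul_left_comm _ _ _))

theorem mulO_comp {σ : Type} {d e f : ℤ} (m l : ℕ) (h : e = d + m) (h' : f = e + l)
    (p : homogeneousSubmodule σ ℂ m) (q : homogeneousSubmodule σ ℂ l) :
    mulO m h p ≫ mulO l h' q = mulO (l + m) (by omega) ⟨q.1 * p.1, q.2.mul p.2⟩ := by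
  apply Scheme.Modules.hom_ext
  intro U
  ext f
  refine Subtype.ext (funext fun x => ?_)
  change algebraMap _ _ q.1 * (algebraMap _ _ p.1 * f.1 x) = algebraMap _ _ (q.1 * p.1) * f.1 x
  rw [map_mul, mul_assoc]
theorem mulO_zero {σ : Type} {d e : ℤ} (m : ℕ) (h : e = d + m) :
    mulO m h (0 : homogeneousSubmodule σ ℂ m) = 0 := by
  apply Scheme.Modules.hom_ext
  intro U
  ext f
  refine Subtype.ext (funext fun x => ?_)
  change algebraMap _ _ (0 : MvPolynomial σ ℂ) * f.1 x = 0
  rw [map_zero, zero_mul]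

theorem mulO_add {σ : Type} {d e : ℤ} (m : ℕ) (h : e = d + m)
    (p q : homogeneousSubmodule σ ℂ m) : mulO m h (p + q) = mulO m h p + mulO m h q := by
  apply Scheme.Modules.hom_ext
  intro U
  ext f
  refine Subtype.ext (funext fun x => ?_)
  change algebraMap _ _ (p.1 + q.1) * f.1 x =
    algebraMap _ _ p.1 * f.1 x + algebraMap _ _ q.1 * f.1 x
  rw [map_add, add_mul]

theorem mulO_sum {σ : Type} {d e : ℤ} (m : ℕ) (h : e = d + m) {ι : Type} (t : Finset ι)
    (p : ι → homogeneousSubmodule σ ℂ m) :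
    mulO m h (∑ i ∈ t, p i) = ∑ i ∈ t, mulO m h (p i) :=
  by
  classical
  induction t using Finset.induction_on with
  | empty => simpa using mulO_zero m h
  | insert a t ha ih => rw [Finset.sum_insert ha, Finset.sum_insert ha, mulO_add, ih]

instance hasFiniteBiproducts_modules (X : Scheme.{0}) : HasFiniteBiproducts X.Modules :=
  Abelian.hasFiniteBiproducts

/-- Linear forms, i.e. elements of `H⁰(P, O(1))`. -/
abbrev LinForm (σ : Type) : Type := homogeneousSubmodule σ ℂ 1

/-- The coordinate function `X v` as a linear form. -/
def coord {σ : Type} (v : σ) : LinForm σ := ⟨X v, isHomogeneous_X ℂ v⟩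

/-- `k × 2N` matrices of linear forms; the columns are split in two blocks of size `N`. -/
abbrev LinMat (k N : ℕ) (σ : Type) : Type := Matrix (Fin k) (Fin N ⊕ Fin N) (LinForm σ)

/-- A matrix of linear forms as a matrix over the polynomial ring. -/
def polys {ι κ σ : Type} (A : Matrix ι κ (LinForm σ)) : Matrix ι κ (MvPolynomial σ ℂ) :=
  A.map Subtype.val

/-- The value of a matrix of linear forms at a vector. -/
def evalMat {ι κ σ : Type} (A : Matrix ι κ (LinForm σ)) (p : σ → ℂ) : Matrix ι κ ℂ :=
  (polys A).map (eval p)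

/-- The standard symplectic form `J = (0 I; -I 0)` on `ℂ^{2N}`. -/
def symJ (N : ℕ) : Matrix (Fin N ⊕ Fin N) (Fin N ⊕ Fin N) ℂ := Matrix.fromBlocks 0 1 (-1) 0

/-- `A J Aᵗ = 0`. -/
def SelfDual {k N : ℕ} {σ : Type} (A : LinMat k N σ) : Prop :=
  polys A * (symJ N).map (C : ℂ →+* MvPolynomial σ ℂ) * (polys A).transpose =
    (0 : Matrix (Fin k) (Fin k) (MvPolynomial σ ℂ))

/-- The matrix of linear forms `J Aᵗ`. -/
def JAt {k N : ℕ} {σ : Type} (A : LinMat k N σ) : Matrix (Fin N ⊕ Fin N) (Fin k) (LinForm σ) :=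
  fun c j => ∑ l, symJ N c l • A j l

/-- `J Aᵗ : O(-1)^k ⟶ O^{2N}`. -/
def monadLeft {k N : ℕ} {σ : Type} (A : LinMat k N σ) :
    (⨁ fun _ : Fin k => O σ (-1)) ⟶ (⨁ fun _ : Fin N ⊕ Fin N => O σ 0) :=
  biproduct.matrix fun j c => mulO 1 (by norm_num) (JAt A c j)

/-- `A : O^{2N} ⟶ O(1)^k`. -/
def monadRight {k N : ℕ} {σ : Type} (A : LinMat k N σ) :
    (⨁ fun _ : Fin N ⊕ Fin N => O σ 0) ⟶ (⨁ fun _ : Fin k => O σ 1) :=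
  biproduct.matrix fun c i => mulO 1 (by norm_num) (A i c)

theorem monad_comp_zero {k N : ℕ} {σ : Type} (A : LinMat k N σ) (h : SelfDual A) :
    monadLeft A ≫ monadRight A = 0 := by
  refine biproduct.hom_ext' _ _ fun j => biproduct.hom_ext _ _ fun i => ?_
  have key : ∑ c, (⟨(A i c).1 * (JAt A c j).1, (A i c).2.mul (JAt A c j).2⟩ :
      homogeneousSubmodule σ ℂ (1 + 1)) = 0 := by
    apply Subtype.ext
    unfold SelfDual at h
    have h2 := congrFun (congrFun h i) j
    rw [Matrix.mul_assoc, Matrix.mul_apply] at h2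
    rw [AddSubmonoidClass.coe_finsetSum]
    refine Eq.trans (Finset.sum_congr rfl fun c _ => ?_) h2
    simp [polys, JAt, Matrix.mul_apply, MvPolynomial.smul_eq_C_mul]
  have : ∑ c, mulO (σ := σ) (d := -1) (e := 0) 1 (by norm_num) (JAt A c j) ≫
      mulO (e := 1) 1 (by norm_num) (A i c) = 0 := by
    simp only [mulO_comp]
    rw [← mulO_sum, key, mulO_zero]
  rw [monadLeft, monadRight, Limits.comp_zero, Limits.zero_comp, ← this]
  simp only [Category.assoc, biproduct.matrix_π, biproduct.ι_matrix_assoc, biproduct.lift_desc]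

/-- The symplectic monad `O(-1)^k ⟶ O^{2N} ⟶ O(1)^k` given by `A`. -/
def monad {k N : ℕ} {σ : Type} (A : LinMat k N σ) (h : SelfDual A) :
    ShortComplex (PP σ).Modules :=
  ShortComplex.mk (monadLeft A) (monadRight A) (monad_comp_zero A h)

/-- The cohomology sheaf of the monad given by `A`. -/
def bundle {k N : ℕ} {σ : Type} (A : LinMat k N σ) (h : SelfDual A) : (PP σ).Modules :=
  (monad A h).homology

/-- The tensor product of two sheaves of modules: the sheaf associated with the presheaf
`U ↦ M(U) ⊗ N(U)`. -/
def tensor {X : Scheme.{0}} (M N : X.Modules) : X.Modules :=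
  (PresheafOfModules.sheafification (𝟙 X.ringCatSheaf.obj)).obj
    (PresheafOfModules.Monoidal.tensorObj (R := X.presheaf) M.val N.val)

/-- The twist `M(d) = M ⊗ O(d)`. -/
def twist {σ : Type} (M : (PP σ).Modules) (d : ℤ) : (PP σ).Modules := tensor M (O σ d)

/-- Global sections of a sheaf of modules. -/
abbrev H0 {σ : Type} (M : (PP σ).Modules) : Ab := Γ(M, ⊤)

/-- Substitution of `s p + t q`, where `s, t` are homogeneous coordinates on the line. -/
def lineSubst {σ : Type} (p q : σ → ℂ) : MvPolynomial σ ℂ →ₐ[ℂ] MvPolynomial (Fin 2) ℂ :=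
  aeval fun v => C (p v) * X 0 + C (q v) * X 1

theorem lineSubst_isHomogeneous {σ : Type} (p q : σ → ℂ) (a : LinForm σ) :
    (lineSubst p q a.1).IsHomogeneous 1 := by
  have ha : a.1.IsHomogeneous 1 := a.2
  have h := ha.aeval (fun v => C (p v) * X 0 + C (q v) * X 1 : σ → MvPolynomial (Fin 2) ℂ)
    (n := 1) fun v => (isHomogeneous_C_mul_X _ _).add (isHomogeneous_C_mul_X _ _)
  exact h

/-- The restriction of a matrix of linear forms to the line spanned by `p` and `q`. -/
def restrictLine {k N : ℕ} {σ : Type} (A : LinMat k N σ) (p q : σ → ℂ) : LinMat k N (Fin 2) :=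
  fun i c => ⟨lineSubst p q (A i c).1, lineSubst_isHomogeneous p q (A i c)⟩

theorem SelfDual.restrictLine {k N : ℕ} {σ : Type} {A : LinMat k N σ} (h : SelfDual A)
    (p q : σ → ℂ) : SelfDual (restrictLine A p q) := by
  unfold SelfDual at h ⊢
  have h2 : polys (RSInstanton.restrictLine A p q) = (polys A).map (lineSubst p q) := rfl
  have h3 : (symJ N).map (C : ℂ →+* MvPolynomial (Fin 2) ℂ) =
      ((symJ N).map (C : ℂ →+* MvPolynomial σ ℂ)).map (lineSubst p q) := by
    ext i j : 2
    simp [lineSubst]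
  rw [h2, h3, ← Matrix.transpose_map, ← Matrix.map_mul, ← Matrix.map_mul, h]
  ext i j : 2
  simp

/-- The restriction of `bundle A` to a general line is trivial. The restriction to a line is the
cohomology of the restricted monad on `ℙ¹`; a condition holds for a general line if it holds for
the lines spanned by the pairs of vectors outside some hypersurface. -/
def TrivialSplittingType {k N : ℕ} {σ : Type} (r : ℕ) (A : LinMat k N σ) (h : SelfDual A) :
    Prop :=
  ∃ Φ : MvPolynomial (σ ⊕ σ) ℂ, Φ ≠ 0 ∧ ∀ p q : σ → ℂ, LinearIndependent ℂ ![p, q] →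
    eval (Sum.elim p q) Φ ≠ 0 →
    Nonempty (bundle (restrictLine A p q) (h.restrictLine p q) ≅ ⨁ fun _ : Fin r => O (Fin 2) 0)

/-- The homogeneous coordinates `x_0, …, x_n` (left) and `y_0, …, y_n` (right). -/
abbrev Coords (n : ℕ) : Type := Fin (n + 1) ⊕ Fin (n + 1)

/-- `A` defines a symplectic `k`-instanton bundle on `ℙ^{2n+1}` via the symplectic monad. -/
structure IsSymplecticInstanton (n k : ℕ) (A : LinMat k (n + k) (Coords n)) : Prop where
  selfDual : SelfDual A
  full_rank : ∀ p : Coords n → ℂ, p ≠ 0 → (evalMat A p).rank = k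
  trivial_splitting : TrivialSplittingType (2 * n) A selfDual

/-- `A = a · (D | D')` with `a` a matrix of scalars and `D`, `D'` diagonal matrices of linear
forms. -/
def IsTHooftMatrix (n k : ℕ) (A : LinMat k (n + k) (Coords n)) : Prop :=
  ∃ (a : Matrix (Fin k) (Fin (n + k)) ℂ) (l l' : Fin (n + k) → LinForm (Coords n)),
    polys A = a.map C * Matrix.fromCols (Matrix.diagonal fun j => (l j).1)
      (Matrix.diagonal fun j => (l' j).1)

/-- The `k × (n + k)` matrix whose `i`-th row is `(0, …, 0, f_0, …, f_n, 0, …, 0)`, with `f_0` in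
column `i`. -/
def bandMatrix {n : ℕ} (k : ℕ) {σ : Type} (f : Fin (n + 1) → LinForm σ) :
    Matrix (Fin k) (Fin (n + k)) (LinForm σ) :=
  fun i j => if h : i.1 ≤ j.1 ∧ j.1 - i.1 < n + 1 then f ⟨j.1 - i.1, h.2⟩ else 0

/-- `A = (F | H)` with `F` the band matrix of linear forms `f_0, …, f_n` cutting out an `n`-space
`L`, and `H` a persymmetric matrix whose maximal minors have no common zero on `L`. -/
def IsRSMatrix (n k : ℕ) (A : LinMat k (n + k) (Coords n)) : Prop :=
  ∃ (f : Fin (n + 1) → LinForm (Coords n)) (H : Matrix (Fin k) (Fin (n + k)) (LinForm (Coords n))),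
    LinearIndependent ℂ f ∧
    (∀ i j s t, i.1 + j.1 = s.1 + t.1 → H i j = H s t) ∧
    (∀ p : Coords n → ℂ, p ≠ 0 → (∀ s, eval p (f s).1 = 0) → (evalMat H p).rank = k) ∧
    A = Matrix.fromCols (bandMatrix k f) H

/-- `M` is a symplectic 't Hooft `k`-instanton bundle. -/
def IsTHooftBundle (n k : ℕ) (M : (PP (Coords n)).Modules) : Prop :=
  ∃ (T : LinMat k (n + k) (Coords n)) (hT : IsSymplecticInstanton n k T),
    IsTHooftMatrix n k T ∧ Nonempty (M ≅ bundle T hT.selfDual)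

/-- The coefficients of the entries of a matrix of linear forms: affine coordinates on the space
of such matrices. -/
def coeffs {k N : ℕ} {σ : Type} (A : LinMat k N σ) : Fin k × (Fin N ⊕ Fin N) × σ → ℂ :=
  fun t => coeff (Finsupp.single t.2.2 1) (A t.1 t.2.1).1

/-- The Zariski closure of a set of matrices of linear forms. -/
def zariskiClosure {k N : ℕ} {σ : Type} (S : Set (LinMat k N σ)) : Set (LinMat k N σ) :=
  {B | ∀ Φ : MvPolynomial (Fin k × (Fin N ⊕ Fin N) × σ) ℂ,
    (∀ A ∈ S, eval (coeffs A) Φ = 0) → eval (coeffs B) Φ = 0}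

/-- `M` is a limit of 't Hooft bundles: it is a symplectic instanton bundle given by some matrix in
the closure of the set of all matrices that define symplectic instanton bundles isomorphic to
't Hooft bundles. -/
def IsLimitOfTHooft (n k : ℕ) (M : (PP (Coords n)).Modules) : Prop :=
  ∃ (B : LinMat k (n + k) (Coords n)) (hB : IsSymplecticInstanton n k B),
    Nonempty (M ≅ bundle B hB.selfDual) ∧
    B ∈ zariskiClosure {A | ∃ hA : IsSymplecticInstanton n k A,
      IsTHooftBundle n k (bundle A hA.selfDual)}

/-- The persymmetric matrix `H_ε`: with rows and columns numbered from `0`, its entry `(i, j)` is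
`y_{i + j - (k - 1)}` for `k - 1 ≤ i + j ≤ n + k - 1`, it is `ε y_1` in the upper left and in the
lower right corner, and it is `0` elsewhere. -/
def Heps (n k : ℕ) (ε : ℂ) : Matrix (Fin k) (Fin (n + k)) (LinForm (Coords n)) :=
  fun i j =>
    if h : k ≤ i.1 + j.1 + 1 ∧ i.1 + j.1 + 1 - k < n + 1 then
      coord (Sum.inr ⟨i.1 + j.1 + 1 - k, h.2⟩)
    else if i.1 + j.1 = 0 ∨ i.1 + j.1 + 2 = n + 2 * k then ε • coord (Sum.inr 1)
    else 0

/-- `A_ε = (F | H_ε)`, where `F` is the band matrix of `x_0, …, x_n`. -/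
def Aeps (n k : ℕ) (ε : ℂ) : LinMat k (n + k) (Coords n) :=
  Matrix.fromCols (bandMatrix k fun s => coord (Sum.inl s)) (Heps n k ε)

end RSInstanton

end

/-! The invariant separating $E_\varepsilon$ from limits of 't Hooft bundles is $H^0(E(1))$.
Twisting the monad by $\mathcal{O}(1)$ and using $H^1(\mathcal{O})=0$, one finds that $H^0(E_A(1))$
is the space of vectors $w$ of linear forms with $Aw=0$ (linear syzygies), modulo constant
combinations of the columns of $JA^t$. `KerEqIm A` says that this quotient is zero. For `A`
self-dual of full rank, `subsingleton_H0_of_kerEqIm` and `kerEqIm_of_subsingleton_H0` show by a Čech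
argument that it is equivalent to $H^0(E_A(1))=0$, so it depends only on the isomorphism class of
the bundle.

A 't Hooft matrix $a(D|D')$ has the extra syzygies $l'_je_j-l_je_{N+j}$, so `KerEqIm` fails for it
(`not_kerEqIm_of_isTHooftMatrix`). On self-dual matrices of full rank `KerEqIm` is a lower bound for
the rank of a matrix depending polynomially on the coefficients of $A$, hence Zariski open
(`KerEqIm.exists_of_mem_zariskiClosure`). So no bundle with `KerEqIm` is a limit of 't Hooft bundles
(`not_isLimitOfTHooft_of_kerEqIm`).

It remains to study $A_\varepsilon$. Polarising $A_\varepsilon w=0$ gives linear recurrences for the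
coefficients of $w$. Those between two $x$'s or two $y$'s are skew and force zero, exactly or for
small $\varepsilon$. The mixed ones make the $x$-coefficients of the right half of $w$ constant
along antidiagonals, and the corner entries $\varepsilon y_1$, with $\varepsilon\neq0$, kill the
superfluous antidiagonals. Exactly the $k$ columns of $JA_\varepsilon^t$ survive (`kerEqIm_Aeps`).

Full rank follows by perturbation from $\varepsilon=0$, where both blocks act as polynomial
multiplication. The bundle is trivial on the line through $p$ and $q$ as soon as
$\det(A(p)JA(q)^t)\neq0$ (`trivialSplittingType_of_det_ne_zero`), which is checked on one explicit
line. -/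

open CategoryTheory AlgebraicGeometry TopologicalSpace Opposite MvPolynomial Limits
noncomputable section
namespace RSInstanton

/-! ### Sections of sheaves of modules: gluing, exactness, sheafification. -/

section Sections

variable {X : Scheme.{0}} {M N K : X.Modules}

/-- Restriction of sections of a sheaf of modules. -/
def res (M : X.Modules) {U V : X.Opens} (h : V ≤ U) : Γ(M, U) →+ Γ(M, V) :=
  (M.presheaf.map (homOfLE h).op).hom

theorem res_res {U V W : X.Opens} (h : V ≤ U) (h' : W ≤ V) (s : Γ(M, U)) :
    res M h' (res M h s) = res M (h'.trans h) s := by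
  change (M.presheaf.map (homOfLE h).op ≫ M.presheaf.map (homOfLE h').op) s = _
  rw [← Functor.map_comp]
  rfl

theorem app_res (φ : M ⟶ N) {U V : X.Opens} (h : V ≤ U) (s : Γ(M, U)) :
    φ.app V (res M h s) = res N h (φ.app U s) :=
  ConcreteCategory.congr_hom (φ.mapPresheaf.naturality (homOfLE h).op) s

theorem eq_of_locally_eq (M : X.Modules) {U : X.Opens} (s t : Γ(M, U))
    (H : ∀ x ∈ U, ∃ (V : X.Opens) (h : V ≤ U), x ∈ V ∧ res M h s = res M h t) : s = t := by
  choose V h hx e using H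
  refine TopCat.Sheaf.eq_of_locally_eq' (C := Ab) (X := X) ⟨M.presheaf, M.isSheaf⟩
    (fun x : U => V x.1 x.2) U (fun x => homOfLE (h x.1 x.2)) ?_ s t fun x => e x.1 x.2
  intro x hxU
  exact Opens.mem_iSup.2 ⟨⟨x, hxU⟩, hx x hxU⟩

theorem exists_gluing (M : X.Modules) {U : X.Opens} {ι : Type} (V : ι → X.Opens)
    (hV : ∀ i, V i ≤ U) (hU : U ≤ iSup V) (s : ∀ i, Γ(M, V i))
    (H : ∀ i j, res M (inf_le_left : V i ⊓ V j ≤ V i) (s i) = res M inf_le_right (s j)) :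
    ∃ t : Γ(M, U), ∀ i, res M (hV i) t = s i := by
  obtain ⟨t, ht, -⟩ := TopCat.Sheaf.existsUnique_gluing' (C := Ab) (X := X)
    ⟨M.presheaf, M.isSheaf⟩ V U (fun i => homOfLE (hV i)) hU s fun i j => H i j
  exact ⟨t, ht⟩

/-- A property of sections which is stable under restriction and determines the section glues. -/
theorem exists_of_locally_unique (M : X.Modules) {U : X.Opens}
    (P : ∀ V : X.Opens, Γ(M, V) → Prop)
    (hres : ∀ (V W : X.Opens) (h : W ≤ V) (s), V ≤ U → P V s → P W (res M h s))
    (huniq : ∀ (V : X.Opens) (s t), V ≤ U → P V s → P V t → s = t)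
    (hex : ∀ x ∈ U, ∃ V : X.Opens, V ≤ U ∧ x ∈ V ∧ ∃ s, P V s) :
    ∃ t : Γ(M, U), ∀ x ∈ U, ∃ (V : X.Opens) (h : V ≤ U), x ∈ V ∧ P V (res M h t) := by
  choose V h hx s hs using hex
  obtain ⟨t, ht⟩ := exists_gluing M (U := U) (fun x : U => V x.1 x.2) (fun x => h x.1 x.2)
    (fun x hxU => Opens.mem_iSup.2 ⟨⟨x, hxU⟩, hx x hxU⟩) (fun x => s x.1 x.2) (fun x y =>
      huniq _ _ _ (inf_le_left.trans (h x.1 x.2)) (hres _ _ _ _ (h x.1 x.2) (hs x.1 x.2))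
        (hres _ _ _ _ (h y.1 y.2) (hs y.1 y.2)))
  exact ⟨t, fun x hxU => ⟨_, h x hxU, hx x hxU, (ht ⟨x, hxU⟩).symm ▸ hs x hxU⟩⟩

/-- Sections over `U`, as a functor. -/
def sectionsFunctor (U : X.Opens) : X.Modules ⥤ Ab :=
  Scheme.Modules.toPresheaf X ⋙ (evaluation _ _).obj (op U)

instance (U : X.Opens) : PreservesFiniteLimits (sectionsFunctor U : X.Modules ⥤ Ab) := by
  have : PreservesFiniteLimits (Scheme.Modules.toPresheaf X) :=
    PreservesLimits.preservesFiniteLimits _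
  have : PreservesFiniteLimits ((evaluation (Opens X)ᵒᵖ Ab.{0}).obj (op U)) :=
    ⟨fun J _ _ => inferInstance⟩
  exact comp_preservesFiniteLimits _ _

instance (U : X.Opens) : (sectionsFunctor U : X.Modules ⥤ Ab).Additive where
  map_add := rfl

theorem app_injective_of_mono (f : M ⟶ N) [Mono f] (U : X.Opens) :
    Function.Injective (f.app U) := by
  have : Mono ((sectionsFunctor U).map f) := inferInstance
  exact (AddCommGrpCat.mono_iff_injective _).1 this

theorem mono_of_app_injective (f : M ⟶ N) (h : ∀ U, Function.Injective (f.app U)) : Mono f where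
  right_cancellation {Z} a b hab := by
    apply Scheme.Modules.hom_ext
    intro U
    ext s
    apply h U
    exact ConcreteCategory.congr_hom (congrArg (fun φ => Scheme.Modules.Hom.app φ U) hab) s

theorem exists_of_exact {S : ShortComplex X.Modules} (hS : S.Exact) [Mono S.f] {U : X.Opens}
    (s : Γ(S.X₂, U)) (hs : S.g.app U s = 0) : ∃ t, S.f.app U t = s := by
  have := hS.map_of_mono_of_preservesKernel (sectionsFunctor U) inferInstance inferInstance
  exact (ShortComplex.ab_exact_iff _).1 this s hs

/-- The sheaf of modules associated with a presheaf of modules. -/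
def sheafifyModules (P : X.PresheafOfModules) : X.Modules :=
  (PresheafOfModules.sheafification (𝟙 X.ringCatSheaf.obj)).obj P

/-- The canonical map from a presheaf of modules to its associated sheaf. -/
def toSheafifyModules (P : X.PresheafOfModules) :
    P ⟶ (Scheme.Modules.toPresheafOfModules X).obj (sheafifyModules P) :=
  (PresheafOfModules.sheafificationAdjunction (𝟙 X.ringCatSheaf.obj)).unit.app P

/-- Restriction of sections of a presheaf of modules. -/
def pres (P : X.PresheafOfModules) {U V : X.Opens} (h : V ≤ U) : P.obj (op U) →+ P.obj (op V) :=
  (P.presheaf.map (homOfLE h).op).hom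

/-- The canonical map to the associated sheaf, on sections. -/
def toSh (P : X.PresheafOfModules) (U : X.Opens) : P.obj (op U) →+ Γ(sheafifyModules P, U) :=
  ((CategoryTheory.toSheafify (Opens.grothendieckTopology X) P.presheaf).app (op U)).hom

theorem toSh_res (P : X.PresheafOfModules) {U V : X.Opens} (h : V ≤ U) (s : P.obj (op U)) :
    toSh P V (pres P h s) = res _ h (toSh P U s) :=
  ConcreteCategory.congr_hom ((CategoryTheory.toSheafify (Opens.grothendieckTopology X)
    P.presheaf).naturality (homOfLE h).op) s

theorem exists_of_toSh_eq (P : X.PresheafOfModules) {U : X.Opens} (s t : P.obj (op U))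
    (e : toSh P U s = toSh P U t) : ∀ x ∈ U, ∃ (V : X.Opens) (h : V ≤ U), x ∈ V ∧
      pres P h s = pres P h t := by
  have hE := Presheaf.equalizerSieve_mem (Opens.grothendieckTopology X)
    (CategoryTheory.toSheafify (Opens.grothendieckTopology X) P.presheaf)
    (X := op U) s t e
  intro x hx
  obtain ⟨V, i, hi, hxV⟩ := hE x hx
  exact ⟨V, i.le, hxV, hi⟩

theorem exists_toSh_eq (P : X.PresheafOfModules) {U : X.Opens} (s : Γ(sheafifyModules P, U)) :
    ∀ x ∈ U, ∃ (V : X.Opens) (h : V ≤ U), x ∈ V ∧ ∃ t, toSh P V t = res _ h s := by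
  have hE := Presheaf.imageSieve_mem (Opens.grothendieckTopology X)
    (CategoryTheory.toSheafify (Opens.grothendieckTopology X) P.presheaf) (U := op U) s
  intro x hx
  obtain ⟨V, i, hi, hxV⟩ := hE x hx
  exact ⟨V, i.le, hxV, hi⟩

/-- The presheaf cokernel of `f` has a sheafification that receives a map `ψ` from `N` killing `f`;
as `f` is epi, `ψ = 0`. So the image of `s` in the presheaf cokernel is locally zero, which is local
surjectivity. -/
theorem exists_locally_of_epi (f : M ⟶ N) [Epi f] {U : X.Opens} (s : Γ(N, U)) :
    ∀ x ∈ U, ∃ (V : X.Opens) (h : V ≤ U), x ∈ V ∧ ∃ t, f.app V t = res N h s := by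
  let F := Scheme.Modules.toPresheafOfModules X
  let π := cokernel.π (F.map f)
  let ψ : N ⟶ sheafifyModules (cokernel (F.map f)) := F.preimage (π ≫ toSheafifyModules _)
  have hψ : F.map ψ = π ≫ toSheafifyModules _ := F.map_preimage _
  have hfψ : f ≫ ψ = 0 := F.map_injective (by
    rw [F.map_comp, hψ, ← Category.assoc, cokernel.condition, zero_comp]
    rfl)
  have h0 : π ≫ toSheafifyModules _ = 0 := by
    rw [← hψ, zero_of_epi_comp f hfψ]
    rfl
  have hs : toSh (cokernel (F.map f)) U (π.app (op U) s) = toSh (cokernel (F.map f)) U 0 := by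
    rw [map_zero]
    exact congr(($h0).app (op U) s)
  intro x hx
  obtain ⟨V, h, hxV, hi⟩ := exists_of_toSh_eq _ _ _ hs x hx
  refine ⟨V, h, hxV, ?_⟩
  have hex : (ShortComplex.mk (F.map f) π (cokernel.condition _)).Exact :=
    ShortComplex.exact_cokernel _
  have := (hex.map (PresheafOfModules.evaluation _ (op V)))
  rw [ShortComplex.moduleCat_exact_iff] at this
  refine this (res N h s) (Eq.trans ?_ (hi.trans (map_zero _)))
  exact PresheafOfModules.naturality_apply π (homOfLE h).op s

end Sections

/-! ### Cycles and their homology classes, on sections. -/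

section Homology

variable {X : Scheme.{0}} {S : ShortComplex X.Modules} {U V : X.Opens}

/-- The section `v` of `S.X₂` is a cycle with class `m`. -/
def HasClass (S : ShortComplex X.Modules) {U : X.Opens} (v : Γ(S.X₂, U)) (m : Γ(S.homology, U)) :
    Prop :=
  ∃ t : Γ(S.cycles, U), S.iCycles.app U t = v ∧ S.homologyπ.app U t = m

theorem HasClass.res {v : Γ(S.X₂, U)} {m : Γ(S.homology, U)} (H : HasClass S v m) (h : V ≤ U) :
    HasClass S (res _ h v) (res _ h m) := by
  obtain ⟨t, rfl, rfl⟩ := H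
  exact ⟨RSInstanton.res _ h t, app_res _ _ _, app_res _ _ _⟩

theorem HasClass.sub {v w : Γ(S.X₂, U)} {m l : Γ(S.homology, U)} (H : HasClass S v m)
    (H' : HasClass S w l) : HasClass S (v - w) (m - l) := by
  obtain ⟨t, rfl, rfl⟩ := H
  obtain ⟨t', rfl, rfl⟩ := H'
  exact ⟨t - t', map_sub _ _ _, map_sub _ _ _⟩

theorem HasClass.smul {v : Γ(S.X₂, U)} {m : Γ(S.homology, U)} (H : HasClass S v m) (r : Γ(X, U)) :
    HasClass S (r • v) (r • m) := by
  obtain ⟨t, rfl, rfl⟩ := H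
  exact ⟨r • t, Scheme.Modules.Hom.app_smul _ _ _, Scheme.Modules.Hom.app_smul _ _ _⟩

theorem HasClass.g_eq_zero {v : Γ(S.X₂, U)} {m : Γ(S.homology, U)} (H : HasClass S v m) :
    S.g.app U v = 0 := by
  obtain ⟨t, rfl, rfl⟩ := H
  exact ConcreteCategory.congr_hom (congrArg (fun φ => Scheme.Modules.Hom.app φ U) S.iCycles_g) t

theorem exists_hasClass {v : Γ(S.X₂, U)} (hv : S.g.app U v = 0) : ∃ m, HasClass S v m := by
  have hex : (ShortComplex.mk S.iCycles S.g S.iCycles_g).Exact :=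
    ShortComplex.exact_of_f_is_kernel _ S.cyclesIsKernel
  obtain ⟨t, ht⟩ := exists_of_exact hex v hv
  exact ⟨_, t, ht, rfl⟩

theorem exists_locally_hasClass (m : Γ(S.homology, U)) :
    ∀ x ∈ U, ∃ (V : X.Opens) (h : V ≤ U), x ∈ V ∧ ∃ v, HasClass S v (res _ h m) := by
  intro x hx
  obtain ⟨V, h, hxV, t, ht⟩ := exists_locally_of_epi S.homologyπ m x hx
  exact ⟨V, h, hxV, _, t, rfl, ht⟩

theorem hasClass_f (r : Γ(S.X₁, U)) : HasClass S (S.f.app U r) 0 := by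
  refine ⟨S.toCycles.app U r, ?_, ?_⟩
  · exact ConcreteCategory.congr_hom (congrArg (fun φ => Scheme.Modules.Hom.app φ U)
      S.toCycles_i) r
  · exact ConcreteCategory.congr_hom (congrArg (fun φ => Scheme.Modules.Hom.app φ U)
      S.toCycles_comp_homologyπ) r

/-- When `S.f` is mono, `S.X₁` is the kernel of the map from cycles to homology, and taking sections
is left exact. Hence a cycle of class zero is a boundary over all of `U`, without shrinking. -/
theorem HasClass.exists_f_eq [Mono S.f] {v : Γ(S.X₂, U)} (H : HasClass S v 0) :
    ∃ r, S.f.app U r = v := by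
  obtain ⟨t, rfl, ht⟩ := H
  have hex : (ShortComplex.mk S.toCycles S.homologyπ S.toCycles_comp_homologyπ).Exact :=
    ShortComplex.exact_of_g_is_cokernel _ S.homologyIsCokernel
  have : Mono S.toCycles := mono_of_mono_fac S.toCycles_i
  obtain ⟨r, rfl⟩ := exists_of_exact hex t ht
  exact ⟨r, (ConcreteCategory.congr_hom (congrArg (fun φ => Scheme.Modules.Hom.app φ U)
      S.toCycles_i) r).symm⟩

end Homology

/-! ### Sections of $\mathcal{O}(d)^\iota$ as vectors of germs. -/

section Values

variable {σ : Type} {d e : ℤ} {ι κ : Type} [Finite ι] [Finite κ] {U V : (PP σ).Opens}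

/-- The `i`-th component of a section of `O(d)^ι`, as a function with values in local rings. -/
def bval (v : Γ(⨁ fun _ : ι => O σ d, U)) (i : ι) : ∀ x : U, LocAt x.1 :=
  Subtype.val (p := fun f => f ∈ sectionsO σ d U)
    ((biproduct.π (fun _ : ι => O σ d) i).app U v)

theorem bval_mem (v : Γ(⨁ fun _ : ι => O σ d, U)) (i : ι) : bval v i ∈ sectionsO σ d U :=
  Subtype.property (p := fun f => f ∈ sectionsO σ d U) _

theorem hom_app_sum {X : Scheme.{0}} {M N : X.Modules} {J : Type} (t : Finset J) (f : J → (M ⟶ N))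
    {U : X.Opens} (s : Γ(M, U)) : (∑ j ∈ t, f j).app U s = ∑ j ∈ t, (f j).app U s := by
  classical
  induction t using Finset.induction_on with
  | empty => rfl
  | insert a t ha ih =>
    rw [Finset.sum_insert ha, Finset.sum_insert ha, ← ih]
    rfl

theorem exists_bval_eq (f : ι → ∀ x : U, LocAt x.1) (hf : ∀ i, f i ∈ sectionsO σ d U) :
    ∃ v : Γ(⨁ fun _ : ι => O σ d, U), bval v = f := by
  classical
  cases nonempty_fintype ι
  refine ⟨∑ i, (biproduct.ι (fun _ : ι => O σ d) i).app U (⟨f i, hf i⟩ : sectionsO σ d U), ?_⟩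
  funext j
  unfold bval
  rw [map_sum, Finset.sum_eq_single j]
  · exact congrArg Subtype.val (congr(($(biproduct.ι_π_self (fun _ : ι => O σ d) j)).app U
      (⟨f j, hf j⟩ : sectionsO σ d U)))
  · intro i _ hij
    exact congr(($(biproduct.ι_π_ne (fun _ : ι => O σ d) hij)).app U
      (⟨f i, hf i⟩ : sectionsO σ d U))
  · simp

theorem eq_of_bval_eq {v w : Γ(⨁ fun _ : ι => O σ d, U)} (h : bval v = bval w) : v = w := by
  classical
  cases nonempty_fintype ι
  have key : ∀ u : Γ(⨁ fun _ : ι => O σ d, U), u = ∑ i, (biproduct.ι (fun _ : ι => O σ d) i).app U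
      ((biproduct.π (fun _ : ι => O σ d) i).app U u) := by
    intro u
    have := hom_app_sum (U := U) Finset.univ
      (fun i => biproduct.π (fun _ : ι => O σ d) i ≫ biproduct.ι (fun _ : ι => O σ d) i) u
    rw [biproduct.total] at this
    exact this
  rw [key v, key w]
  refine Finset.sum_congr rfl fun i _ => congrArg _ ?_
  exact Subtype.ext (p := fun f => f ∈ sectionsO σ d U) (congrFun h i)

theorem bval_zero (i : ι) (x : U) : bval (0 : Γ(⨁ fun _ : ι => O σ d, U)) i x = 0 := by
  unfold bval
  rw [map_zero]
  rfl

theorem bval_sub (v w : Γ(⨁ fun _ : ι => O σ d, U)) (i : ι) (x : U) :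
    bval (v - w) i x = bval v i x - bval w i x := by
  unfold bval
  rw [map_sub]
  rfl

theorem bval_smul (r : Γ(PP σ, U)) (v : Γ(⨁ fun _ : ι => O σ d, U)) (i : ι) (x : U) :
    bval (r • v) i x = evalAt r x * bval v i x := by
  unfold bval
  rw [Scheme.Modules.Hom.app_smul]
  rfl

theorem bval_res (h : V ≤ U) (v : Γ(⨁ fun _ : ι => O σ d, U)) (i : ι) (x : V) :
    bval (res _ h v) i x = bval v i ⟨x.1, h x.2⟩ := by
  unfold bval
  rw [app_res]
  rfl

theorem bval_matrix [Fintype ι] {l : ℕ} (h : e = d + l) (m : ι → κ → homogeneousSubmodule σ ℂ l)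
    (v : Γ(⨁ fun _ : ι => O σ d, U)) (j : κ) (x : U) :
    bval ((biproduct.matrix fun i j => mulO (d := d) (e := e) l h (m i j)).app U v) j x =
      ∑ i, (algebraMap _ (LocAt x.1) (m i j).1 : LocAt x.1) * bval v i x := by
  have h1 : (biproduct.matrix fun i j => mulO (d := d) (e := e) l h (m i j)) ≫ biproduct.π _ j =
      ∑ i, biproduct.π (fun _ : ι => O σ d) i ≫ mulO l h (m i j) := by
    rw [biproduct.matrix_π, biproduct.desc_eq]
  unfold bval
  rw [← ConcreteCategory.comp_apply, ← Scheme.Modules.Hom.comp_app, h1, hom_app_sum]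
  have h2 : ∀ (t : Finset ι) (f : ι → sectionsO σ e U),
      (∑ i ∈ t, f i).1 x = ∑ i ∈ t, (f i).1 x := by
    intro t f
    rw [AddSubgroup.val_finsetSum, Finset.sum_apply]
  exact h2 _ _

end Values

/-! ### Homogeneous fractions in the local rings. -/

section LocalRings

variable {σ : Type}

/-- The inclusion of the polynomial ring in the localization at a point. -/
abbrev toLoc (x : PP σ) : MvPolynomial σ ℂ →+* LocAt x := algebraMap _ _

instance (x : PP σ) : IsDomain (LocAt x) :=
  IsLocalization.isDomain_localization (primeAt x).primeCompl_le_nonZeroDivisors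

theorem algebraMap_locAt_injective (x : PP σ) :
    Function.Injective (toLoc x) :=
  IsLocalization.injective _ (primeAt x).primeCompl_le_nonZeroDivisors

theorem isUnit_algebraMap_locAt {x : PP σ} {s : MvPolynomial σ ℂ} (hs : s ∈ (primeAt x).primeCompl) :
    IsUnit (toLoc x s) :=
  IsLocalization.map_units (LocAt x) (⟨s, hs⟩ : (primeAt x).primeCompl)

/-- The open set where the coordinate `X v` does not vanish. -/
abbrev DX (v : σ) : (PP σ).Opens := Proj.basicOpen (homogeneousSubmodule σ ℂ) (X v)

theorem isUnit_X {v : σ} {x : PP σ} (hx : x ∈ DX v) :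
    IsUnit (toLoc x (X v)) :=
  isUnit_algebraMap_locAt hx

theorem exists_mem_DX (x : PP σ) : ∃ v : σ, x ∈ DX v := exists_X_notMem x

theorem sectionsO_mul {d e : ℤ} {U : (PP σ).Opens} {f g : ∀ x : U, LocAt x.1}
    (hf : f ∈ sectionsO σ d U) (hg : g ∈ sectionsO σ e U) :
    (fun x => f x * g x) ∈ sectionsO σ (d + e) U := by
  intro x
  obtain ⟨V, hxV, i, hV⟩ := hf x
  obtain ⟨W, hxW, j, hW⟩ := hg x
  exact ⟨V ⊓ W, ⟨hxV, hxW⟩, Opens.infLELeft V W ≫ i,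
    isFrac_mul (hV.res (Opens.infLELeft V W)) (hW.res (Opens.infLERight V W))⟩

theorem sectionsO_of_frac {d : ℤ} {U : (PP σ).Opens} {f : ∀ x : U, LocAt x.1} (h : IsFrac d f) :
    f ∈ sectionsO σ d U := fun x => ⟨U, x.2, 𝟙 _, h⟩

theorem sectionsO_of_poly {m : ℕ} {p : MvPolynomial σ ℂ} (hp : p.IsHomogeneous m)
    (U : (PP σ).Opens) : (fun x : U => toLoc x.1 p) ∈ sectionsO σ m U :=
  sectionsO_of_frac (isFrac_of_poly hp U)

theorem sectionsO_of_mul_eq {d : ℤ} {U : (PP σ).Opens} {f : ∀ x : U, LocAt x.1}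
    {i j : ℕ} {r s : MvPolynomial σ ℂ} (hr : r.IsHomogeneous i) (hs : s.IsHomogeneous j)
    (hd : (i : ℤ) = j + d) (hU : ∀ x : U, s ∈ (primeAt x.1).primeCompl)
    (hf : ∀ x : U, f x * toLoc x.1 s = toLoc x.1 r) :
    f ∈ sectionsO σ d U :=
  sectionsO_of_frac ⟨i, j, r, s, hr, hs, hd, hU, fun x => by
    rw [Localization.mk_eq_mk', IsLocalization.eq_mk'_iff_mul_eq]
    exact hf x⟩

/-- A function which becomes a section of `O(d)` after multiplication by an invertible coordinate
power is a section. -/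
theorem sectionsO_of_X_pow_mul {d e : ℤ} (m : ℕ) {v : σ} {U : (PP σ).Opens} (hU : U ≤ DX v)
    {f : ∀ x : U, LocAt x.1}
    (hf : (fun x : U => toLoc x.1 (X v) ^ m * f x) ∈ sectionsO σ e U)
    (h : e = d + m) : f ∈ sectionsO σ d U := by
  intro x
  obtain ⟨V, hxV, i, a, b, r, s, hr, hs, hd, hn, hV⟩ := hf x
  have key : (fun y : V => f (i y)) ∈ sectionsO σ d V := by
    refine sectionsO_of_mul_eq (r := r) (s := X v ^ m * s) hr
      (((isHomogeneous_X ℂ v).pow m).mul hs) (by push_cast; omega)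
      (fun y => Submonoid.mul_mem _ (Submonoid.pow_mem _ (hU (i.le y.2)) _) (hn y)) fun y => ?_
    have := hV y
    rw [Localization.mk_eq_mk', IsLocalization.eq_mk'_iff_mul_eq] at this
    change (toLoc y.1 (X v) ^ m * (f (i y) : LocAt y.1)) * toLoc y.1 s = toLoc y.1 r at this
    rw [map_mul, map_pow, ← this]
    change (f (i y) : LocAt y.1) * (_ * _) = _
    ring
  obtain ⟨W, hxW, j, hW⟩ := key ⟨x.1, hxV⟩
  exact ⟨W, hxW, j ≫ i, hW⟩

end LocalRings

/-! ### Regular functions on basic open sets. -/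

section RegularFunctions

variable {σ : Type}

theorem evalAt_injective {U : (PP σ).Opens} {r s : Γ(PP σ, U)} (h : ∀ x, evalAt r x = evalAt s x) :
    r = s :=
  Subtype.ext (p := (ProjectiveSpectrum.StructureSheaf.isLocallyFraction
      (homogeneousSubmodule σ ℂ)).pred) (funext fun x =>
        HomogeneousLocalization.val_injective _ (h x))

/-- Connects two models: sections of $\mathcal{O}(0)$ take values in the full localizations, while
the structure sheaf is built from their degree-zero parts. -/
theorem exists_evalAt_eq {U : (PP σ).Opens} {f : ∀ x : U, LocAt x.1} (hf : f ∈ sectionsO σ 0 U) :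
    ∃ r : Γ(PP σ, U), ∀ x, evalAt r x = f x := by
  have H : ∀ x : U, ∃ z : HomogeneousLocalization.AtPrime (homogeneousSubmodule σ ℂ) (primeAt x.1),
      z.val = f x := by
    intro x
    obtain ⟨V, hxV, i, a, b, r, s, hr, hs, hd, hn, hV⟩ := hf x
    obtain rfl : a = b := by omega
    exact ⟨HomogeneousLocalization.mk ⟨a, ⟨r, hr⟩, ⟨s, hs⟩, hn ⟨x.1, hxV⟩⟩,
      (HomogeneousLocalization.val_mk _).trans (hV ⟨x.1, hxV⟩).symm⟩
  choose z hz using H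
  refine ⟨⟨z, fun x => ?_⟩, hz⟩
  obtain ⟨V, hxV, i, a, b, r, s, hr, hs, hd, hn, hV⟩ := hf x
  obtain rfl : a = b := by omega
  refine ⟨V, hxV, i, a, ⟨r, hr⟩, ⟨s, hs⟩, hn, fun y => ?_⟩
  apply HomogeneousLocalization.val_injective
  exact (hz (i y)).trans (hV y)

/-- Regular functions on the basic open set of `g` form the degree-zero part of the localization
away from `g`, so a single power of `g` clears the denominators everywhere on it. -/
theorem exists_frac_of_mem_sectionsO {m : ℕ} (hm : 0 < m) {g : MvPolynomial σ ℂ}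
    (hg : g.IsHomogeneous m) {f : ∀ x : Proj.basicOpen (homogeneousSubmodule σ ℂ) g, LocAt x.1}
    (hf : f ∈ sectionsO σ 0 (Proj.basicOpen (homogeneousSubmodule σ ℂ) g)) :
    ∃ (k : ℕ) (p : MvPolynomial σ ℂ), p.IsHomogeneous (k * m) ∧
      ∀ x, toLoc x.1 g ^ k * f x = toLoc x.1 p := by
  obtain ⟨r, hr⟩ := exists_evalAt_eq hf
  obtain ⟨z, rfl⟩ : ∃ z, Proj.awayToSection (homogeneousSubmodule σ ℂ) g z = r := by
    have := (ConcreteCategory.bijective_of_isIso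
      (Proj.basicOpenIsoAway (homogeneousSubmodule σ ℂ) g hg hm).hom).2 r
    exact this
  obtain ⟨k, p, hp, rfl⟩ := HomogeneousLocalization.Away.mk_surjective _ hg z
  refine ⟨k, p, hp, fun x => ?_⟩
  rw [← hr x]
  have h1 : evalAt (Proj.awayToSection (homogeneousSubmodule σ ℂ) g
      (HomogeneousLocalization.Away.mk (homogeneousSubmodule σ ℂ) hg k p hp)) x =
      Localization.mk p ⟨g ^ k, Submonoid.pow_mem _ x.2 k⟩ := rfl
  rw [h1, Localization.mk_eq_mk', ← map_pow]
  exact IsLocalization.mk'_spec' (M := (primeAt x.1).primeCompl) (LocAt x.1) p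
    ⟨g ^ k, Submonoid.pow_mem _ x.2 k⟩

end RegularFunctions

/-! ### The twist by $\mathcal{O}(1)$ over the coordinate charts. -/

section Twist

open TensorProduct

variable {σ : Type} {M : (PP σ).Modules} {U V : (PP σ).Opens}

/-- The presheaf `U ↦ M(U) ⊗ O(1)(U)`. -/
abbrev preTwist (M : (PP σ).Modules) : (PP σ).PresheafOfModules :=
  PresheafOfModules.Monoidal.tensorObj (R := (PP σ).presheaf) M.val (O σ 1).val

/-- The coordinate `X v` as a section of `O(1)`. -/
def coordSec (v : σ) (U : (PP σ).Opens) : sectionsO σ 1 U :=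
  ⟨fun x => toLoc x.1 (X v), sectionsO_of_poly (isHomogeneous_X ℂ v) U⟩

theorem smul_coordSec_bijective {v : σ} (h : U ≤ DX v) :
    Function.Bijective (LinearMap.toSpanSingleton Γ(PP σ, U) (sectionsO σ 1 U) (coordSec v U)) := by
  constructor
  · intro r s e
    apply evalAt_injective
    intro x
    have : evalAt r x * toLoc x.1 (X v) = evalAt s x * toLoc x.1 (X v) :=
      congrFun (congrArg Subtype.val e) x
    exact (isUnit_X (h x.2)).mul_right_cancel this
  · intro s
    have : ∀ x : U, ∃ z : LocAt x.1, z * toLoc x.1 (X v) = s.1 x := fun x => by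
      obtain ⟨u, hu⟩ := isUnit_X (h x.2)
      exact ⟨s.1 x * ↑u⁻¹, by rw [← hu, Units.inv_mul_cancel_right]⟩
    choose f hf using this
    obtain ⟨r, hr⟩ := exists_evalAt_eq (f := f) (sectionsO_of_X_pow_mul (e := 1) 1 h (by
      have : (fun x : U => toLoc x.1 (X v) ^ 1 * f x) = s.1 := funext fun x => by
        rw [pow_one, mul_comm, hf]
      rw [this]
      exact s.2) (by norm_num))
    refine ⟨r, Subtype.ext (funext fun x => ?_)⟩
    change evalAt r x * toLoc x.1 (X v) = _
    rw [hr, hf]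

/-- `m ⊗ X v` as a section of the tensor product presheaf. -/
def tmulX (M : (PP σ).Modules) (v : σ) (U : (PP σ).Opens) : Γ(M, U) →+ (preTwist M).obj (op U) where
  toFun m := (m ⊗ₜ[Γ(PP σ, U)] coordSec v U : Γ(M, U) ⊗[Γ(PP σ, U)] sectionsO σ 1 U)
  map_zero' := TensorProduct.zero_tmul _ _
  map_add' := fun m m' => TensorProduct.add_tmul m m' _

theorem pres_tmulX (v : σ) (h : V ≤ U) (m : Γ(M, U)) :
    pres (preTwist M) h (tmulX M v U m) = tmulX M v V (res M h m) := rfl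

theorem tmulX_smul (v : σ) (m : Γ(M, U)) (r : Γ(PP σ, U)) :
    tmulX M v U (r • m) =
      (m ⊗ₜ[Γ(PP σ, U)] (r • coordSec v U) : Γ(M, U) ⊗[Γ(PP σ, U)] sectionsO σ 1 U) :=
  TensorProduct.smul_tmul r m (coordSec v U)

theorem tmulX_bijective {v : σ} (h : U ≤ DX v) : Function.Bijective (tmulX M v U) := by
  let e : Γ(PP σ, U) ≃ₗ[Γ(PP σ, U)] sectionsO σ 1 U :=
    LinearEquiv.ofBijective _ (smul_coordSec_bijective h)
  let φ : TensorProduct Γ(PP σ, U) Γ(M, U) (sectionsO σ 1 U) ≃ₗ[Γ(PP σ, U)] Γ(M, U) :=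
    (TensorProduct.congr (LinearEquiv.refl _ _) e.symm).trans (TensorProduct.rid _ _)
  have hφ : ∀ m, φ (m ⊗ₜ coordSec v U) = m := by
    intro m
    have : e.symm (coordSec v U) = 1 := by
      rw [LinearEquiv.symm_apply_eq]
      exact (one_smul Γ(PP σ, U) (coordSec v U)).symm
    simp [φ, this]
  have hφ' : ∀ m, φ.symm m = m ⊗ₜ coordSec v U := fun m => by
    rw [LinearEquiv.symm_apply_eq, hφ]
  have : (⇑(tmulX M v U) : Γ(M, U) → _) = φ.symm := funext fun m => (hφ' m).symm
  rw [this]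
  exact φ.symm.bijective

/-- On the open set where `X v` is invertible, sections of `M` are identified with sections of
`M(1)` by `m ↦ m ⊗ X v`. -/
def twistX (M : (PP σ).Modules) (v : σ) (U : (PP σ).Opens) : Γ(M, U) →+ Γ(twist M 1, U) :=
  (toSh (preTwist M) U).comp (tmulX M v U)

theorem res_twistX (v : σ) (h : V ≤ U) (m : Γ(M, U)) :
    res _ h (twistX M v U m) = twistX M v V (res M h m) := by
  refine (toSh_res (preTwist M) h (tmulX M v U m)).symm.trans ?_
  rw [pres_tmulX]
  rfl

theorem twistX_injective {v : σ} (h : U ≤ DX v) : Function.Injective (twistX M v U) := by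
  intro m m' e
  apply eq_of_locally_eq
  intro x hx
  obtain ⟨V, hV, hxV, hi⟩ := exists_of_toSh_eq _ _ _ e x hx
  rw [pres_tmulX, pres_tmulX] at hi
  exact ⟨V, hV, hxV, (tmulX_bijective (hV.trans h)).1 hi⟩

/-- Locally a section of the sheafified tensor product comes from the presheaf, which over opens
inside `DX v` is a copy of `M`. The preimages are unique by injectivity, so they glue in `M`. -/
theorem twistX_surjective {v : σ} (h : U ≤ DX v) : Function.Surjective (twistX M v U) := by
  intro s
  obtain ⟨m, hm⟩ := exists_of_locally_unique M (U := U)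
    (fun V m => ∃ hV : V ≤ U, twistX M v V m = res _ hV s)
    (fun V W hW m hV ⟨hV', e⟩ => ⟨hW.trans hV, by rw [← res_twistX, e, res_res]⟩)
    (fun V m m' hV ⟨_, e⟩ ⟨_, e'⟩ => twistX_injective (hV.trans h) (e.trans e'.symm))
    (fun x hx => by
      obtain ⟨V, hV, hxV, t, ht⟩ := exists_toSh_eq _ s x hx
      obtain ⟨m, rfl⟩ := (tmulX_bijective (hV.trans h)).2 t
      exact ⟨V, hV, hxV, m, hV, ht⟩)
  refine ⟨m, eq_of_locally_eq _ _ _ fun x hx => ?_⟩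
  obtain ⟨V, hV, hxV, _, e⟩ := hm x hx
  exact ⟨V, hV, hxV, by rw [res_twistX, e]⟩

/-- The transition rule between charts: with $r=X_u/X_v$ one has $m\otimes X_u=m\otimes
rX_v=rm\otimes X_v$. -/
theorem twistX_eq {u v : σ} (m m' : Γ(M, U)) (r : Γ(PP σ, U))
    (hr : ∀ x, evalAt r x * toLoc x.1 (X v) = toLoc x.1 (X u)) (hm : r • m = m') :
    twistX M u U m = twistX M v U m' := by
  subst hm
  refine congrArg (toSh (preTwist M) U) ?_
  rw [tmulX_smul]
  have : r • coordSec v U = coordSec u U := Subtype.ext (funext hr)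
  rw [this]
  rfl

end Twist

/-! ### Homogeneous components and powers of coordinates. -/

section Polynomials

variable {σ : Type}

theorem homogeneousComponent_mul_of_isHomogeneous {a b : MvPolynomial σ ℂ} {i : ℕ}
    (ha : a.IsHomogeneous i) (n : ℕ) :
    homogeneousComponent (i + n) (a * b) = a * homogeneousComponent n b := by
  classical
  have h := DirectSum.coe_decompose_mul_of_left_mem_of_le (homogeneousSubmodule σ ℂ) (n := i + n)
    (b := b) ha (Nat.le_add_right i n)
  rw [Nat.add_sub_cancel_left] at h
  exact (decomposition.decompose'_apply (a * b) (i + n)).symm.trans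
    (h.trans (congrArg (a * ·) (decomposition.decompose'_apply b n)))

/-- The homogeneous components of a vector of polynomials. -/
def vecComponent {ι : Type} (n : ℕ) (w : ι → MvPolynomial σ ℂ) : ι → MvPolynomial σ ℂ :=
  fun c => homogeneousComponent n (w c)

theorem vecComponent_isHomogeneous {ι : Type} (n : ℕ) (w : ι → MvPolynomial σ ℂ) (c : ι) :
    (vecComponent n w c).IsHomogeneous n := homogeneousComponent_isHomogeneous _ _

theorem vecComponent_eq_self {ι : Type} {n : ℕ} {w : ι → MvPolynomial σ ℂ}
    (h : ∀ c, (w c).IsHomogeneous n) : vecComponent n w = w :=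
  funext fun c => homogeneousComponent_eq_self (h c)

theorem vecComponent_sub {ι : Type} (n : ℕ) (w w' : ι → MvPolynomial σ ℂ) :
    vecComponent n (w - w') = vecComponent n w - vecComponent n w' :=
  funext fun _ => map_sub _ _ _

theorem vecComponent_smul {ι : Type} (n : ℕ) {i : ℕ} {a : MvPolynomial σ ℂ}
    (ha : a.IsHomogeneous i) (w : ι → MvPolynomial σ ℂ) :
    vecComponent (i + n) (a • w) = a • vecComponent n w :=
  funext fun _ => homogeneousComponent_mul_of_isHomogeneous ha n

theorem vecComponent_mulVec {ι κ : Type} [Fintype ι] (n : ℕ) (B : Matrix κ ι (LinForm σ))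
    (w : ι → MvPolynomial σ ℂ) :
    vecComponent (1 + n) ((polys B).mulVec w) = (polys B).mulVec (vecComponent n w) := by
  funext c
  simp only [vecComponent, Matrix.mulVec, dotProduct, map_sum]
  exact Finset.sum_congr rfl fun i _ => homogeneousComponent_mul_of_isHomogeneous (B c i).2 n

theorem X_pow_dvd_of_X_pow_mul {u v : σ} (huv : u ≠ v) (K : ℕ) {a b : MvPolynomial σ ℂ}
    (h : X u ^ K * a = X v ^ K * b) : X v ^ K ∣ a := by
  refine (X_prime (i := v)).pow_dvd_of_dvd_mul_left K (a := X u ^ K) ?_ ⟨b, h⟩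
  intro hd
  exact huv (X_dvd_X.1 ((X_prime (i := v)).dvd_of_dvd_pow hd)).symm

/-- Membership in the monomial ideal $(X_u^K,X_v^K)$ is read off the exponents of $X_u$ and $X_v$,
which multiplication by $X_t$ does not change. This is the vanishing of $H^1(\mathcal{O}(d))$ in the
form needed for three charts. -/
theorem exists_eq_of_X_pow_mul_eq {u v t : σ} (htu : t ≠ u) (htv : t ≠ v) (K : ℕ)
    {q a b : MvPolynomial σ ℂ} (h : X t ^ K * q = X u ^ K * a + X v ^ K * b) :
    ∃ a' b', q = X u ^ K * a' + X v ^ K * b' := by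
  classical
  have key : ∀ p : MvPolynomial σ ℂ, (∃ a b, p = X u ^ K * a + X v ^ K * b) ↔
      ∀ m ∈ p.support, K ≤ m u ∨ K ≤ m v := by
    intro p
    have h1 := mem_ideal_span_monomial_image (x := p)
      (s := {Finsupp.single u K, Finsupp.single v K})
    rw [Set.image_pair, Ideal.mem_span_pair] at h1
    simp only [← X_pow_eq_monomial, Set.mem_insert_iff, Set.mem_singleton_iff, exists_eq_or_imp,
      exists_eq_left, Finsupp.single_le_iff] at h1
    rw [← h1]
    refine exists_congr fun a => exists_congr fun b => ?_
    rw [eq_comm, mul_comm a, mul_comm b]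
  rw [key]
  have h2 := (key (X t ^ K * q)).1 ⟨a, b, h⟩
  intro m hm
  have h3 := h2 (m + Finsupp.single t K) (by
    rw [mem_support_iff, X_pow_eq_monomial, add_comm, coeff_monomial_mul, one_mul]
    exact mem_support_iff.1 hm)
  simpa [Finsupp.single_apply, htu, htv] using h3

end Polynomials

/-! ### One-sided inverses of full-rank matrices, and the Čech argument on polynomials. -/

section LeftInverse

variable {σ : Type} {k N : ℕ} {A : LinMat k N σ}

/-- `A` has rank `k` at every point of the projective space. -/
def FullRank (A : LinMat k N σ) : Prop := ∀ p : σ → ℂ, p ≠ 0 → (evalMat A p).rank = k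

/-- Every vector of linear forms annihilated by `A` is a constant combination of the columns of
`J Aᵗ`. -/
def KerEqIm (A : LinMat k N σ) : Prop :=
  ∀ w : Fin N ⊕ Fin N → MvPolynomial σ ℂ, (∀ c, (w c).IsHomogeneous 1) →
    (polys A).mulVec w = 0 → ∃ γ : Fin k → ℂ, w = (polys (JAt A)).mulVec fun j => C (γ j)

theorem polys_JAt (A : LinMat k N σ) :
    polys (JAt A) = (symJ N).map (C : ℂ →+* MvPolynomial σ ℂ) * (polys A).transpose := by
  ext1 c j
  simp [polys, JAt, Matrix.mul_apply, MvPolynomial.smul_eq_C_mul]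

theorem SelfDual.mul_eq_zero (h : SelfDual A) : polys A * polys (JAt A) = 0 := by
  rw [polys_JAt, ← Matrix.mul_assoc]
  exact h

theorem SelfDual.mulVec_eq_zero (h : SelfDual A) (q : Fin k → MvPolynomial σ ℂ) :
    (polys A).mulVec ((polys (JAt A)).mulVec q) = 0 := by
  rw [Matrix.mulVec_mulVec, h.mul_eq_zero, Matrix.zero_mulVec]

theorem symJ_mul_self (N : ℕ) : symJ N * symJ N = -1 := by
  simp [symJ, Matrix.fromBlocks_multiply, ← Matrix.fromBlocks_one, Matrix.fromBlocks_neg]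

theorem exists_mul_eq_one_of_rank {ι : Type} [Fintype ι] (B : Matrix (Fin k) ι ℂ) (hB : B.rank = k) :
    ∃ D : Matrix ι (Fin k) ℂ, B * D = 1 := by
  classical
  rw [Matrix.rank] at hB
  have hs : Function.Surjective B.mulVecLin := by
    rw [← LinearMap.range_eq_top]
    apply Submodule.eq_top_of_finrank_eq
    rw [hB, Module.finrank_fin_fun]
  obtain ⟨g, hg⟩ := B.mulVecLin.exists_rightInverse_of_surjective (LinearMap.range_eq_top.2 hs)
  refine ⟨LinearMap.toMatrix' g, ?_⟩
  have := congrArg LinearMap.toMatrix' hg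
  rwa [LinearMap.toMatrix'_comp, LinearMap.toMatrix'_id, ← Matrix.toLin'_apply', LinearMap.toMatrix'_toLin'] at this

/-- Nullstellensatz. The polynomials $f$ for which $f\cdot 1$ factors through $A$ form an ideal. At
a point $p\neq0$ a constant right inverse $D$ of $A(p)$ gives the member $\det(AD)$ of this ideal,
which does not vanish at $p$. So its zero locus is at most the origin, and a power of $X_v$ belongs
to it. -/
theorem exists_rightInverse_X_pow [Finite σ] (hA : FullRank A) (v : σ) :
    ∃ (m : ℕ) (B : Matrix (Fin N ⊕ Fin N) (Fin k) (MvPolynomial σ ℂ)),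
      (∀ c i, (B c i).IsHomogeneous m) ∧ polys A * B = (X v ^ (m + 1) : MvPolynomial σ ℂ) • 1 := by
  classical
  let I : Ideal (MvPolynomial σ ℂ) :=
    { carrier := {p | ∃ B : Matrix (Fin N ⊕ Fin N) (Fin k) (MvPolynomial σ ℂ), polys A * B = p • 1}
      add_mem' := by
        rintro p q ⟨B, hB⟩ ⟨B', hB'⟩
        exact ⟨B + B', by rw [Matrix.mul_add, hB, hB', add_smul]⟩
      zero_mem' := ⟨0, by simp⟩
      smul_mem' := by
        rintro p q ⟨B, hB⟩
        exact ⟨p • B, by rw [Matrix.mul_smul, hB, smul_smul, smul_eq_mul]⟩ }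
  have hI : (X v : MvPolynomial σ ℂ) ∈ I.radical := by
    rw [← vanishingIdeal_zeroLocus_eq_radical (K := ℂ), mem_vanishingIdeal_iff]
    intro p hp
    rw [mem_zeroLocus_iff] at hp
    by_contra hv
    have hp0 : p ≠ 0 := by
      rintro rfl
      simp at hv
    obtain ⟨D, hD⟩ := exists_mul_eq_one_of_rank _ (hA p hp0)
    let D' : Matrix (Fin N ⊕ Fin N) (Fin k) (MvPolynomial σ ℂ) := D.map C
    have hmem : (polys A * D').det ∈ I :=
      ⟨D' * (polys A * D').adjugate, by rw [← Matrix.mul_assoc, Matrix.mul_adjugate]⟩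
    have h0 := hp _ hmem
    have h1 : (eval p) (polys A * D').det = 1 := by
      have h2 : (eval p).mapMatrix (polys A * D') = 1 := by
        rw [RingHom.mapMatrix_apply, Matrix.map_mul, ← hD]
        congr 1
        ext i j
        simp [D']
      rw [RingHom.map_det, h2, Matrix.det_one]
    rw [← aeval_eq_eval] at h1
    exact one_ne_zero (h1.symm.trans h0)
  obtain ⟨m, B, hB⟩ := hI
  -- One more factor $X_v$ makes the exponent $m+1$ positive, so that the degree $m$ part of $X_vB$
  -- is a right inverse up to $X_v^{m+1}$.
  refine ⟨m, Matrix.of fun c i => homogeneousComponent m (X v * B c i),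
    fun c i => homogeneousComponent_isHomogeneous _ _, ?_⟩
  have hB' : polys A * ((X v : MvPolynomial σ ℂ) • B) =
      (X v ^ (m + 1) : MvPolynomial σ ℂ) • (1 : Matrix (Fin k) (Fin k) (MvPolynomial σ ℂ)) := by
    rw [Matrix.mul_smul, hB, smul_smul, pow_succ']
  ext1 i j
  have h1 := congrArg (homogeneousComponent (1 + m)) (congrFun (congrFun hB' i) j)
  rw [Matrix.mul_apply, map_sum] at h1
  rw [Matrix.mul_apply]
  refine (Finset.sum_congr rfl fun c _ =>
    (homogeneousComponent_mul_of_isHomogeneous (A i c).2 m).symm).trans (h1.trans ?_)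
  apply homogeneousComponent_eq_self
  rw [Matrix.smul_apply, smul_eq_mul, Matrix.one_apply, add_comm 1 m]
  split_ifs
  · rw [mul_one]
    simpa using (isHomogeneous_X ℂ v).pow (m + 1)
  · rw [mul_zero]
    exact isHomogeneous_zero _ _ _

/-- Since $J^2=-1$, the matrix $-B^tJ$ satisfies $(-B^tJ)(JA^t)=(AB)^t$ for the right inverse $B$ of
$A$ up to a power of $X_v$. -/
theorem exists_leftInverse_X_pow [Finite σ] (hA : FullRank A) (v : σ) :
    ∃ (m : ℕ) (L : Matrix (Fin k) (Fin N ⊕ Fin N) (MvPolynomial σ ℂ)),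
      (∀ i c, (L i c).IsHomogeneous m) ∧
        L * polys (JAt A) = (X v ^ (m + 1) : MvPolynomial σ ℂ) • 1 := by
  obtain ⟨m, B, hB, h⟩ := exists_rightInverse_X_pow hA v
  refine ⟨m, -(B.transpose * (symJ N).map (C : ℂ →+* MvPolynomial σ ℂ)), fun i c => ?_, ?_⟩
  · rw [Matrix.neg_apply, Matrix.mul_apply]
    refine (IsHomogeneous.sum _ _ _ fun l _ => ?_).neg
    rw [mul_comm]
    exact (hB l i).C_mul _
  · rw [polys_JAt, Matrix.neg_mul, Matrix.mul_assoc, ← Matrix.mul_assoc (Matrix.map _ _),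
      ← Matrix.map_mul, symJ_mul_self]
    have h1 : (-1 : Matrix (Fin N ⊕ Fin N) (Fin N ⊕ Fin N) ℂ).map (C : ℂ →+* MvPolynomial σ ℂ) = -1 := by
      ext1 i j
      simp [Matrix.one_apply, apply_ite]
    rw [h1, Matrix.neg_mul, Matrix.one_mul, Matrix.mul_neg, neg_neg, ← Matrix.transpose_mul, h]
    simp

theorem mulVec_JAt_injective [Finite σ] [Nonempty σ] (hA : FullRank A)
    {q : Fin k → MvPolynomial σ ℂ} (h : (polys (JAt A)).mulVec q = 0) : q = 0 := by
  obtain ⟨v⟩ := ‹Nonempty σ›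
  obtain ⟨m, L, -, hL⟩ := exists_leftInverse_X_pow hA v
  have h1 := congrArg L.mulVec h
  rw [Matrix.mulVec_mulVec, hL, Matrix.smul_mulVec, Matrix.one_mulVec, Matrix.mulVec_zero] at h1
  exact (smul_eq_zero.1 h1).resolve_left (pow_ne_zero _ (X_ne_zero v))

/-- Vanishing of a Čech cocycle: local lifts of a section of the twisted cohomology bundle can be
corrected to a global one, which is trivial if `KerEqIm A` holds. -/
theorem KerEqIm.exists_of_cocycle [Finite σ] (hA : FullRank A) (hdual : SelfDual A)
    (hK : KerEqIm A) {u v t : σ} (huv : u ≠ v) (hut : u ≠ t) (hvt : v ≠ t) {K : ℕ}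
    {pu pv pt : Fin N ⊕ Fin N → MvPolynomial σ ℂ} {q₁ q₂ q₃ : Fin k → MvPolynomial σ ℂ}
    (hpu : ∀ c, (pu c).IsHomogeneous K) (hAu : (polys A).mulVec pu = 0)
    (h₁ : (X u * X v ^ K : MvPolynomial σ ℂ) • pu - (X v * X u ^ K : MvPolynomial σ ℂ) • pv =
      (polys (JAt A)).mulVec q₁)
    (h₂ : (X v * X t ^ K : MvPolynomial σ ℂ) • pv - (X t * X v ^ K : MvPolynomial σ ℂ) • pt =
      (polys (JAt A)).mulVec q₂)
    (h₃ : (X u * X t ^ K : MvPolynomial σ ℂ) • pu - (X t * X u ^ K : MvPolynomial σ ℂ) • pt =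
      (polys (JAt A)).mulVec q₃) :
    ∃ r : Fin k → MvPolynomial σ ℂ, (∀ j, (r j).IsHomogeneous K) ∧
      (X u : MvPolynomial σ ℂ) • pu = (polys (JAt A)).mulVec r := by
  have : Nonempty σ := ⟨u⟩
  -- In this combination of `h₁`, `h₂`, `h₃` the left-hand sides cancel; as $JA^t$ is injective, the
  -- $q_i$ satisfy the cocycle condition themselves.
  have hq : (X t ^ K : MvPolynomial σ ℂ) • q₁ + (X u ^ K : MvPolynomial σ ℂ) • q₂ -
      (X v ^ K : MvPolynomial σ ℂ) • q₃ = 0 := by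
    apply mulVec_JAt_injective hA
    rw [Matrix.mulVec_sub, Matrix.mulVec_add, Matrix.mulVec_smul, Matrix.mulVec_smul,
      Matrix.mulVec_smul, ← h₁, ← h₂, ← h₃]
    module
  have hab : ∀ j, ∃ a b, q₁ j = X u ^ K * a + X v ^ K * b := fun j => by
    refine exists_eq_of_X_pow_mul_eq hut.symm hvt.symm K (a := - q₂ j) (b := q₃ j) ?_
    have := congrFun hq j
    simp only [Pi.add_apply, Pi.sub_apply, Pi.smul_apply, smul_eq_mul, Pi.zero_apply] at this
    linear_combination this
  choose a b hab using hab
  have hq₁ : q₁ = (X u ^ K : MvPolynomial σ ℂ) • a + (X v ^ K : MvPolynomial σ ℂ) • b :=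
    funext hab
  -- Splitting $q_1=X_u^Ka+X_v^Kb$ corrects the two lifts by $b$ and $a$ so that they agree; the
  -- common value is then divisible by $X_u^K$ after dividing out $X_v^K$.
  have h4 : (X v ^ K : MvPolynomial σ ℂ) • ((X u : MvPolynomial σ ℂ) • pu -
      (polys (JAt A)).mulVec b) = (X u ^ K : MvPolynomial σ ℂ) •
        ((X v : MvPolynomial σ ℂ) • pv + (polys (JAt A)).mulVec a) := by
    rw [hq₁, Matrix.mulVec_add, Matrix.mulVec_smul, Matrix.mulVec_smul] at h₁
    linear_combination (norm := module) (1 : MvPolynomial σ ℂ) • h₁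
  have h5 : ∀ c, ∃ w, ((X u : MvPolynomial σ ℂ) • pu - (polys (JAt A)).mulVec b) c =
      X u ^ K * w := fun c => X_pow_dvd_of_X_pow_mul huv.symm K (congrFun h4 c)
  choose w hw using h5
  have hw' : (X u : MvPolynomial σ ℂ) • pu - (polys (JAt A)).mulVec b =
      (X u ^ K : MvPolynomial σ ℂ) • w := funext hw
  -- The degree $K+1$ part of the equation replaces $b$ by a form of degree $K$ and $w$ by a vector
  -- of linear forms, to which `KerEqIm` applies.
  have h6 := congrArg (vecComponent (1 + K)) hw'
  have hXK : (X u ^ K : MvPolynomial σ ℂ).IsHomogeneous K := by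
    simpa using (isHomogeneous_X ℂ u).pow K
  rw [vecComponent_sub, vecComponent_smul K (isHomogeneous_X ℂ u), vecComponent_mulVec,
    vecComponent_eq_self hpu, add_comm 1 K, vecComponent_smul 1 hXK] at h6
  have h7 : (polys A).mulVec (vecComponent 1 w) = 0 := by
    have := congrArg (polys A).mulVec h6
    rw [Matrix.mulVec_sub, Matrix.mulVec_smul, Matrix.mulVec_smul, hAu, hdual.mulVec_eq_zero,
      smul_zero, sub_zero] at this
    exact (smul_eq_zero.1 this.symm).resolve_left (pow_ne_zero _ (X_ne_zero u))
  obtain ⟨γ, hγ⟩ := hK _ (vecComponent_isHomogeneous 1 w) h7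
  refine ⟨vecComponent K b + (X u ^ K : MvPolynomial σ ℂ) • fun j => C (γ j), fun j => ?_, ?_⟩
  · refine (vecComponent_isHomogeneous K b j).add ?_
    simpa using hXK.mul (isHomogeneous_C σ (γ j))
  · rw [Matrix.mulVec_add, Matrix.mulVec_smul, ← hγ, ← h6]
    abel

/-- Injectivity of $JA^t$ gives $X_v^Kq_u=X_u^Kq_v$, and by coprimality $X_u^K$ divides $q_u$. The
quotient expresses $w$ without denominators, and only its constant term matters since $w$ is linear.
-/
theorem kerEqIm_of_X_pow_smul [Finite σ] (hA : FullRank A) {u v : σ} (huv : u ≠ v) {K : ℕ}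
    {w : Fin N ⊕ Fin N → MvPolynomial σ ℂ} (hw : ∀ c, (w c).IsHomogeneous 1)
    {qu qv : Fin k → MvPolynomial σ ℂ}
    (hu : (X u ^ K : MvPolynomial σ ℂ) • w = (polys (JAt A)).mulVec qu)
    (hv : (X v ^ K : MvPolynomial σ ℂ) • w = (polys (JAt A)).mulVec qv) :
    ∃ γ : Fin k → ℂ, w = (polys (JAt A)).mulVec fun j => C (γ j) := by
  have : Nonempty σ := ⟨u⟩
  have hq : (X v ^ K : MvPolynomial σ ℂ) • qu - (X u ^ K : MvPolynomial σ ℂ) • qv = 0 := by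
    apply mulVec_JAt_injective hA
    rw [Matrix.mulVec_sub, Matrix.mulVec_smul, Matrix.mulVec_smul, ← hu, ← hv]
    module
  have h1 : ∀ j, ∃ g, qu j = X u ^ K * g := fun j =>
    X_pow_dvd_of_X_pow_mul huv.symm K (congrFun (sub_eq_zero.1 hq) j)
  choose g hg using h1
  have h2 : qu = (X u ^ K : MvPolynomial σ ℂ) • g := funext hg
  rw [h2, Matrix.mulVec_smul] at hu
  have h3 : w = (polys (JAt A)).mulVec g :=
    smul_right_injective _ (pow_ne_zero K (X_ne_zero u)) hu
  refine ⟨fun j => coeff 0 (g j), ?_⟩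
  have h4 := congrArg (vecComponent (1 + 0)) h3
  rw [vecComponent_mulVec, vecComponent_eq_self hw] at h4
  rw [h4]
  congr 1
  funext j
  exact homogeneousComponent_zero _

end LeftInverse

/-! ### Sections of the monad and lifting of classes to cycles. -/

section MonadSections

variable {σ : Type} {k N : ℕ} {A : LinMat k N σ} {U V : (PP σ).Opens}

/-- The value of a section of `O(d)^ι` at a point. -/
def bvec {ι : Type} [Finite ι] {d : ℤ} (v : Γ(⨁ fun _ : ι => O σ d, U)) (x : U) : ι → LocAt x.1 :=
  fun i => bval v i x

theorem bvec_monadLeft (A : LinMat k N σ) (r : Γ(⨁ fun _ : Fin k => O σ (-1), U)) (x : U) :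
    bvec ((monadLeft A).app U r) x = ((polys (JAt A)).map (toLoc x.1)).mulVec (bvec r x) :=
  funext fun c => bval_matrix (by norm_num) (fun j c => JAt A c j) r c x

theorem bvec_monadRight (A : LinMat k N σ) (v : Γ(⨁ fun _ : Fin N ⊕ Fin N => O σ 0, U)) (x : U) :
    bvec ((monadRight A).app U v) x = ((polys A).map (toLoc x.1)).mulVec (bvec v x) :=
  funext fun i => bval_matrix (by norm_num) (fun c i => A i c) v i x

theorem eq_of_bvec_eq {ι : Type} [Finite ι] {d : ℤ} {v w : Γ(⨁ fun _ : ι => O σ d, U)}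
    (h : ∀ x, bvec v x = bvec w x) : v = w :=
  eq_of_bval_eq (funext fun i => funext fun x => congrFun (h x) i)

theorem bvec_zero {ι : Type} [Finite ι] {d : ℤ} (x : U) :
    bvec (0 : Γ(⨁ fun _ : ι => O σ d, U)) x = 0 := funext fun i => bval_zero i x

theorem bvec_sub {ι : Type} [Finite ι] {d : ℤ} (v w : Γ(⨁ fun _ : ι => O σ d, U)) (x : U) :
    bvec (v - w) x = bvec v x - bvec w x := funext fun i => bval_sub v w i x

theorem bvec_smul {ι : Type} [Finite ι] {d : ℤ} (r : Γ(PP σ, U)) (v : Γ(⨁ fun _ : ι => O σ d, U))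
    (x : U) : bvec (r • v) x = evalAt r x • bvec v x := funext fun i => bval_smul r v i x

theorem bvec_res {ι : Type} [Finite ι] {d : ℤ} (h : V ≤ U) (v : Γ(⨁ fun _ : ι => O σ d, U))
    (x : V) : bvec (res _ h v) x = bvec v ⟨x.1, h x.2⟩ := funext fun i => bval_res h v i x

theorem exists_bvec_eq {ι : Type} [Finite ι] {d : ℤ} (f : ∀ x : U, ι → LocAt x.1)
    (hf : ∀ i, (fun x => f x i) ∈ sectionsO σ d U) :
    ∃ v : Γ(⨁ fun _ : ι => O σ d, U), ∀ x, bvec v x = f x := by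
  obtain ⟨v, hv⟩ := exists_bval_eq (fun i x => f x i) hf
  exact ⟨v, fun x => funext fun i => congrFun (congrFun hv i) x⟩

theorem sectionsO_sum {ι : Type} (t : Finset ι) {d : ℤ} {f : ι → ∀ x : U, LocAt x.1}
    (hf : ∀ i, f i ∈ sectionsO σ d U) : (fun x => ∑ i ∈ t, f i x) ∈ sectionsO σ d U := by
  have : (fun x => ∑ i ∈ t, f i x) = ∑ i ∈ t, f i := funext fun x => (Finset.sum_apply _ _ _).symm
  rw [this]
  exact sum_mem fun i _ => hf i

theorem map_mulVec_toLoc {ι κ : Type} [Fintype ι] (x : PP σ) (B : Matrix κ ι (MvPolynomial σ ℂ))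
    (w : ι → MvPolynomial σ ℂ) :
    (B.map (toLoc x)).mulVec (fun i => toLoc x (w i)) = fun c => toLoc x (B.mulVec w c) := by
  funext c
  exact (RingHom.map_mulVec (toLoc x) B w c).symm

theorem map_smul_one {R S : Type} [CommRing R] [CommRing S] (f : R →+* S) (a : R) (k : ℕ) :
    (a • (1 : Matrix (Fin k) (Fin k) R)).map f = f a • 1 := by
  ext1 i j
  by_cases h : i = j <;> simp [h]

theorem mono_monadLeft [Finite σ] (hA : FullRank A) : Mono (monadLeft A) := by
  apply mono_of_app_injective
  intro U r s hrs
  apply eq_of_bvec_eq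
  intro x
  obtain ⟨v, hv⟩ := exists_mem_DX x.1
  obtain ⟨m, L, -, hL⟩ := exists_leftInverse_X_pow hA v
  have h1 := congrArg (fun z => ((L.map (toLoc x.1)).mulVec (bvec z x))) hrs
  simp only [bvec_monadLeft, Matrix.mulVec_mulVec, ← Matrix.map_mul, hL] at h1
  rw [map_smul_one, map_pow, Matrix.smul_mulVec, Matrix.smul_mulVec, Matrix.one_mulVec,
    Matrix.one_mulVec] at h1
  exact ((isUnit_X hv).pow (m + 1)).smul_left_cancel.1 h1

theorem hasClass_zero_unique {X : Scheme.{0}} {S : ShortComplex X.Modules} {U : X.Opens}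
    {v : Γ(S.X₂, U)} {m l : Γ(S.homology, U)} (h : HasClass S v m) (h' : HasClass S v l) :
    m = l := by
  obtain ⟨t, rfl, rfl⟩ := h
  obtain ⟨t', e, rfl⟩ := h'
  rw [app_injective_of_mono S.iCycles U e]

theorem monad_exists_hasClass {h : SelfDual A} {w : Γ(⨁ fun _ : Fin N ⊕ Fin N => O σ 0, U)}
    (hw : ∀ x, ((polys A).map (toLoc x.1)).mulVec (bvec w x) = 0) :
    ∃ m, HasClass (monad A h) (U := U) w m := by
  apply exists_hasClass
  exact eq_of_bvec_eq (ι := Fin k) (d := 1) fun x =>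
    (bvec_monadRight A w x).trans ((hw x).trans (bvec_zero x).symm)

theorem HasClass.mulVec_eq_zero {h : SelfDual A} {w : Γ(⨁ fun _ : Fin N ⊕ Fin N => O σ 0, U)}
    {m} (hw : HasClass (monad A h) (U := U) w m) (x : U) :
    ((polys A).map (toLoc x.1)).mulVec (bvec w x) = 0 := by
  rw [← bvec_monadRight]
  have : (monadRight A).app U w = 0 := hw.g_eq_zero
  rw [this, bvec_zero]

theorem HasClass.exists_mulVec_eq [Finite σ] (hA : FullRank A) {h : SelfDual A}
    {w : Γ(⨁ fun _ : Fin N ⊕ Fin N => O σ 0, U)} (hw : HasClass (monad A h) (U := U) w 0) :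
    ∃ r : Γ(⨁ fun _ : Fin k => O σ (-1), U), ∀ x,
      bvec w x = ((polys (JAt A)).map (toLoc x.1)).mulVec (bvec r x) := by
  have : Mono (monad A h).f := mono_monadLeft hA
  obtain ⟨r, hr⟩ := hw.exists_f_eq
  exact ⟨r, fun x => (congrArg (fun z => bvec (ι := Fin N ⊕ Fin N) (d := 0) z x) hr.symm).trans
    (bvec_monadLeft A r x)⟩

theorem hasClass_zero_of_mulVec_eq {h : SelfDual A}
    {w : Γ(⨁ fun _ : Fin N ⊕ Fin N => O σ 0, U)} (r : Γ(⨁ fun _ : Fin k => O σ (-1), U))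
    (hw : ∀ x, bvec w x = ((polys (JAt A)).map (toLoc x.1)).mulVec (bvec r x)) :
    HasClass (monad A h) (U := U) w 0 := by
  have : w = (monadLeft A).app U r := eq_of_bvec_eq fun x => by rw [hw, bvec_monadLeft]
  rw [this]
  exact hasClass_f (S := monad A h) r

/-- Over an open set where a coordinate is invertible, sections of the cohomology bundle lift to
cycles. -/
theorem exists_hasClass_of_le_DX [Finite σ] (hA : FullRank A) (h : SelfDual A) {v : σ}
    (hU : U ≤ DX v) (m : Γ(bundle A h, U)) :
    ∃ w : Γ(⨁ fun _ : Fin N ⊕ Fin N => O σ 0, U), HasClass (monad A h) (U := U) w m := by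
  obtain ⟨n, L, hLh, hL⟩ := exists_leftInverse_X_pow hA v
  have hLJ : ∀ x : PP σ, ∀ r : Fin k → LocAt x, (L.map (toLoc x)).mulVec
      (((polys (JAt A)).map (toLoc x)).mulVec r) = toLoc x (X v) ^ (n + 1) • r := by
    intro x r
    rw [Matrix.mulVec_mulVec, ← Matrix.map_mul, hL, map_smul_one, map_pow, Matrix.smul_mulVec,
      Matrix.one_mulVec]
  -- Lifts are normalised by $Lw=0$. Where $X_v$ is invertible this selects a single cycle in each
  -- class, because $LJA^t$ is then invertible; hence local normalised lifts glue.
  have key := exists_of_locally_unique (⨁ fun _ : Fin N ⊕ Fin N => O σ 0) (U := U)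
    (fun V w => ∃ hV : V ≤ U, HasClass (monad A h) (U := V) w (res (bundle A h) hV m) ∧
      ∀ x : V, (L.map (toLoc x.1)).mulVec (bvec w x) = 0) ?_ ?_ ?_
  · obtain ⟨w, hw⟩ := key
    have h0 : ∀ x, ((polys A).map (toLoc x.1)).mulVec (bvec w x) = 0 := by
      intro x
      obtain ⟨V, hV, hxV, _, hc, -⟩ := hw x.1 x.2
      have := hc.mulVec_eq_zero ⟨x.1, hxV⟩
      rwa [bvec_res] at this
    obtain ⟨m', hm'⟩ := monad_exists_hasClass (h := h) h0
    have : m' = m := by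
      apply eq_of_locally_eq
      intro x hx
      obtain ⟨V, hV, hxV, _, hc, -⟩ := hw x hx
      exact ⟨V, hV, hxV, hasClass_zero_unique (hm'.res hV) hc⟩
    exact ⟨w, this ▸ hm'⟩
  · rintro V W hW w hV ⟨hV', hc, hz⟩
    refine ⟨hW.trans hV, ?_, fun x => ?_⟩
    · have := hc.res hW
      erw [res_res] at this
      exact this
    · rw [bvec_res]
      exact hz ⟨x.1, hW x.2⟩
  · rintro V w w' hV ⟨_, hc, hz⟩ ⟨_, hc', hz'⟩
    have hd : HasClass (monad A h) (U := V) (w - w') 0 :=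
      (congrArg (HasClass (monad A h) (U := V) (w - w')) (sub_self (res (bundle A h) hV m))).mp
        (hc.sub hc')
    obtain ⟨r, hr⟩ := hd.exists_mulVec_eq hA
    refine eq_of_bvec_eq fun x => ?_
    have h1 := congrArg (L.map (toLoc x.1)).mulVec (hr x)
    rw [hLJ, bvec_sub, Matrix.mulVec_sub, hz, hz', sub_self] at h1
    have h2 : bvec r x = 0 := by
      have h3 : toLoc x.1 (X v) ^ (n + 1) • bvec r x = toLoc x.1 (X v) ^ (n + 1) • 0 := by
        rw [← h1, smul_zero]
      exact ((isUnit_X (hU (hV x.2))).pow (n + 1)).smul_left_cancel.1 h3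
    have h4 := hr x
    rw [h2, Matrix.mulVec_zero, bvec_sub] at h4
    exact sub_eq_zero.1 h4
  · intro x hx
    obtain ⟨V, hV, hxV, w, hw⟩ := exists_locally_hasClass (S := monad A h) m x hx
    -- A local lift $w$ is normalised by subtracting the boundary $JA^tr$ with $r=X_v^{-(n+1)}Lw$,
    -- of degree $-1$.
    have hr : ∀ y : V, ∃ r : Fin k → LocAt y.1, toLoc y.1 (X v) ^ (n + 1) • r =
        (L.map (toLoc y.1)).mulVec (bvec (ι := Fin N ⊕ Fin N) (d := 0) w y) := fun y => by
      obtain ⟨u, hu⟩ := (isUnit_X (hU (hV y.2))).pow (n + 1)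
      refine ⟨(↑u⁻¹ : LocAt y.1) •
        (L.map (toLoc y.1)).mulVec (bvec (ι := Fin N ⊕ Fin N) (d := 0) w y), ?_⟩
      rw [← hu, smul_smul, Units.mul_inv, one_smul]
    choose r hr using hr
    obtain ⟨ρ, hρ⟩ := exists_bvec_eq (ι := Fin k) (d := -1) r fun j => by
      refine sectionsO_of_X_pow_mul (e := n) (n + 1) (hV.trans hU) ?_ (by push_cast; ring)
      have : (fun y : V => toLoc y.1 (X v) ^ (n + 1) * r y j) = fun y : V =>
          ∑ c, toLoc y.1 (L j c) * bval (ι := Fin N ⊕ Fin N) (d := 0) w c y := funext fun y =>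
        congrFun (hr y) j
      rw [this]
      refine sectionsO_sum _ fun c => ?_
      have := sectionsO_mul (sectionsO_of_poly (hLh j c) V)
        (bval_mem (ι := Fin N ⊕ Fin N) (d := 0) w c)
      rwa [add_zero] at this
    have hz := hw.sub (hasClass_f (S := monad A h) ρ)
    rw [sub_zero] at hz
    refine ⟨V, hV, hxV, _, hV, hz, fun y => ?_⟩
    have h1 := bvec_monadLeft A ρ y
    have h2 := bvec_sub (ι := Fin N ⊕ Fin N) (d := 0) w ((monadLeft A).app V ρ) y
    refine (congrArg (L.map (toLoc y.1)).mulVec h2).trans ?_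
    rw [Matrix.mulVec_sub, h1, hLJ, hρ, hr, sub_self]

end MonadSections

/-! ### Global sections of $E(1)$ and linear syzygies. -/

section GlobalSections

variable {σ : Type} {k N : ℕ} {A : LinMat k N σ}

/-- The zero ideal gives a point lying in all charts. Polynomials embed in its local ring, so an
identity of germs there is an identity of polynomials. -/
theorem exists_generic_point [Nonempty σ] : ∃ x : PP σ, ∀ v, x ∈ DX v := by
  obtain ⟨v₀⟩ := ‹Nonempty σ›
  have hX : ∀ v : σ, (X v : MvPolynomial σ ℂ) ∉
      HomogeneousIdeal.toIdeal (⊥ : HomogeneousIdeal (homogeneousSubmodule σ ℂ)) := by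
    intro v hv
    rw [HomogeneousIdeal.toIdeal_bot, Ideal.mem_bot] at hv
    exact X_ne_zero v hv
  refine ⟨(⟨⊥, ?_, ?_⟩ : ProjectiveSpectrum (homogeneousSubmodule σ ℂ)), hX⟩
  · rw [HomogeneousIdeal.toIdeal_bot]
    exact Ideal.isPrime_bot
  · intro hle
    refine hX v₀ (hle ?_)
    rw [HomogeneousIdeal.mem_irrelevant_iff]
    refine (decomposition.decompose'_apply (X v₀ : MvPolynomial σ ℂ) 0).trans ?_
    rw [homogeneousComponent_of_mem (isHomogeneous_X ℂ v₀), if_neg (by norm_num)]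

/-- The exponent may be any sufficiently large `K`, so that denominators coming from several charts
and overlaps can be cleared with one common exponent. -/
theorem exists_frac_family {ι : Type} [Finite ι] {m : ℕ} (hm : 0 < m) {g : MvPolynomial σ ℂ}
    (hg : g.IsHomogeneous m) {U : (PP σ).Opens}
    (hU : Proj.basicOpen (homogeneousSubmodule σ ℂ) g = U) {f : ∀ x : U, ι → LocAt x.1}
    (hf : ∀ i, (fun x => f x i) ∈ sectionsO σ 0 U) :
    ∃ K₀, ∀ K ≥ K₀, ∃ p : ι → MvPolynomial σ ℂ, (∀ i, (p i).IsHomogeneous (K * m)) ∧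
      ∀ x : U, (toLoc x.1 g ^ K) • f x = fun i => toLoc x.1 (p i) := by
  subst hU
  have := fun i => exists_frac_of_mem_sectionsO hm hg (hf i)
  choose κ p hp hκ using this
  cases nonempty_fintype ι
  refine ⟨Finset.univ.sup κ, fun K hK => ⟨fun i => g ^ (K - κ i) * p i, fun i => ?_, fun x => ?_⟩⟩
  · have h1 : κ i ≤ K := (Finset.le_sup (Finset.mem_univ i)).trans hK
    have h2 := (hg.pow (K - κ i)).mul (hp i)
    have h3 : m * (K - κ i) + κ i * m = K * m := by
      rw [mul_comm m, ← add_mul, Nat.sub_add_cancel h1]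
    rwa [h3] at h2
  · funext i
    have h1 : κ i ≤ K := (Finset.le_sup (Finset.mem_univ i)).trans hK
    rw [map_mul, map_pow, ← hκ i x, Pi.smul_apply, smul_eq_mul, ← mul_assoc, ← pow_add,
      Nat.sub_add_cancel h1]

theorem exists_ratio {U : (PP σ).Opens} (u : σ) {v : σ} (hU : U ≤ DX v) :
    ∃ r : Γ(PP σ, U), ∀ x, evalAt r x * toLoc x.1 (X v) = toLoc x.1 (X u) := by
  obtain ⟨r, hr⟩ := (smul_coordSec_bijective hU).2 (coordSec u U)
  exact ⟨r, fun x => congrFun (congrArg Subtype.val hr) x⟩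

theorem basicOpen_X_mul (u v : σ) :
    Proj.basicOpen (homogeneousSubmodule σ ℂ) (X u * X v) = DX u ⊓ DX v :=
  Proj.basicOpen_mul _ _ _

theorem toLoc_smul_mulVec {x : PP σ} (a : LocAt x) (r : Fin k → LocAt x) :
    ((polys (JAt A)).map (toLoc x)).mulVec (a • r) =
      a • ((polys (JAt A)).map (toLoc x)).mulVec r := Matrix.mulVec_smul _ _ _

/-- The difference of two local lifts of a section of the twisted cohomology bundle, after
clearing denominators. -/
theorem exists_cocycle [Finite σ] (hA : FullRank A) (h : SelfDual A) {u v : σ}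
    {m : Γ(bundle A h, DX u)} {l : Γ(bundle A h, DX v)}
    {w : Γ(⨁ fun _ : Fin N ⊕ Fin N => O σ 0, DX u)} {z : Γ(⨁ fun _ : Fin N ⊕ Fin N => O σ 0, DX v)}
    (hw : HasClass (monad A h) (U := DX u) w m) (hz : HasClass (monad A h) (U := DX v) z l)
    (hml : res (twist (bundle A h) 1) (inf_le_left : DX u ⊓ DX v ≤ DX u)
      (twistX (bundle A h) u _ m) = res _ inf_le_right (twistX (bundle A h) v _ l)) :
    ∃ K₀, ∀ K ≥ K₀, ∃ q : Fin k → MvPolynomial σ ℂ, ∀ x (hu : x ∈ DX u) (hv : x ∈ DX v),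
      (toLoc x (X u * X v) ^ K) • (toLoc x (X u) • bvec w ⟨x, hu⟩ -
        toLoc x (X v) • bvec z ⟨x, hv⟩) = fun c => toLoc x ((polys (JAt A)).mulVec q c) := by
  obtain ⟨r, hr⟩ := exists_ratio (U := DX u ⊓ DX v) u inf_le_right
  have h1 : r • res (bundle A h) inf_le_left m = res (bundle A h) inf_le_right l := by
    apply twistX_injective (v := v) (inf_le_right : DX u ⊓ DX v ≤ DX v)
    rw [← twistX_eq (u := u) (res (bundle A h) inf_le_left m) _ r hr rfl, ← res_twistX,
      ← res_twistX]
    exact hml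
  have h2 : HasClass (monad A h) (U := DX u ⊓ DX v)
      (r • res (⨁ fun _ : Fin N ⊕ Fin N => O σ 0) inf_le_left w - res _ inf_le_right z) 0 := by
    have h3 := (((hw.res (inf_le_left : DX u ⊓ DX v ≤ DX u)).smul r).sub
      (hz.res (inf_le_right : DX u ⊓ DX v ≤ DX v)))
    exact (congrArg (HasClass (monad A h) (U := DX u ⊓ DX v) _) (sub_eq_zero.2 h1)).mp h3
  obtain ⟨c, hc⟩ := h2.exists_mulVec_eq hA
  obtain ⟨K₀, hK₀⟩ := exists_frac_family (m := 2) (by norm_num)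
    (by simpa using (isHomogeneous_X ℂ u).mul (isHomogeneous_X ℂ v)) (basicOpen_X_mul u v)
    (f := fun x => toLoc x.1 (X v) • bvec c x) (fun i => by
      have := sectionsO_mul (sectionsO_of_poly (isHomogeneous_X ℂ v) (DX u ⊓ DX v)) (bval_mem c i)
      exact this)
  refine ⟨K₀, fun K hK => ?_⟩
  obtain ⟨q, -, hq⟩ := hK₀ K hK
  have key : ∀ y : ↥(DX u ⊓ DX v), (toLoc y.1 (X u * X v) ^ K) • (toLoc y.1 (X u) •
      bvec w ⟨y.1, y.2.1⟩ - toLoc y.1 (X v) • bvec z ⟨y.1, y.2.2⟩) =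
        fun c => toLoc y.1 ((polys (JAt A)).mulVec q c) := by
    intro y
    have e : ((polys (JAt A)).map (toLoc y.1)).mulVec (bvec c y) =
        evalAt r y • bvec w ⟨y.1, inf_le_left (b := DX v) y.2⟩ -
          bvec z ⟨y.1, inf_le_right (a := DX u) y.2⟩ :=
      (hc y).symm.trans ((bvec_sub (ι := Fin N ⊕ Fin N) (d := 0) _ _ y).trans
        (by rw [bvec_smul, bvec_res, bvec_res]))
    rw [← map_mulVec_toLoc, ← hq y, toLoc_smul_mulVec, toLoc_smul_mulVec, e,
      smul_sub (toLoc y.1 (X v)), smul_smul (toLoc y.1 (X v)), mul_comm (toLoc y.1 (X v)), hr]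
  exact ⟨q, fun x hu hv => key ⟨x, hu, hv⟩⟩

/-- On each chart a section of $E(1)$ is $m_v\otimes X_v$, with $m_v$ the class of a cycle. Clearing
denominators on three charts gives a polynomial cocycle, and `KerEqIm.exists_of_cocycle` turns each
of these cycles into a boundary. -/
theorem subsingleton_H0_of_kerEqIm [Finite σ] (hA : FullRank A) (h : SelfDual A)
    (hK : KerEqIm A) (h3 : ∀ u : σ, ∃ v t : σ, u ≠ v ∧ u ≠ t ∧ v ≠ t) :
    Subsingleton (H0 (twist (bundle A h) 1)) := by
  refine subsingleton_of_forall_eq 0 fun s => ?_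
  have hm : ∀ v : σ, ∃ m, twistX (bundle A h) v (DX v) m = res _ le_top s := fun v =>
    twistX_surjective le_rfl _
  choose m hm using hm
  choose w hw using fun v => exists_hasClass_of_le_DX hA h (le_refl (DX v)) (m v)
  have hzero : ∀ u, m u = 0 := by
    intro u
    obtain ⟨v, t, huv, hut, hvt⟩ := h3 u
    have hp : ∀ u, ∃ K₀, ∀ K ≥ K₀, ∃ p : Fin N ⊕ Fin N → MvPolynomial σ ℂ,
        (∀ i, (p i).IsHomogeneous K) ∧
          ∀ x : DX u, (toLoc x.1 (X u) ^ K) • bvec (w u) x = fun i => toLoc x.1 (p i) := by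
      intro u
      obtain ⟨K₀, hK₀⟩ := exists_frac_family one_pos (isHomogeneous_X ℂ u) rfl
        (f := fun x : DX u => bvec (w u) x) (fun i => bval_mem (w u) i)
      simp only [mul_one] at hK₀
      exact ⟨K₀, hK₀⟩
    have hq := fun u v => exists_cocycle hA h (hw u) (hw v) (by
      rw [hm, hm, res_res, res_res])
    choose κ hκ using hp
    choose η hη using hq
    obtain ⟨K, h1, h2, h3, h4, h5, h6⟩ : ∃ K, κ u ≤ K ∧ κ v ≤ K ∧ κ t ≤ K ∧ η u v ≤ K ∧
        η v t ≤ K ∧ η u t ≤ K := ⟨κ u + κ v + κ t + η u v + η v t + η u t, by omega⟩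
    obtain ⟨pu, hpu, hpu'⟩ := hκ u K h1
    obtain ⟨pv, hpv, hpv'⟩ := hκ v K h2
    obtain ⟨pt, hpt, hpt'⟩ := hκ t K h3
    obtain ⟨q₁, hq₁⟩ := hη u v K h4
    obtain ⟨q₂, hq₂⟩ := hη v t K h5
    obtain ⟨q₃, hq₃⟩ := hη u t K h6
    have : Nonempty σ := ⟨u⟩
    obtain ⟨x, hx⟩ := exists_generic_point (σ := σ)
    have hcoc : ∀ {u v : σ} {pu pv : Fin N ⊕ Fin N → MvPolynomial σ ℂ}
        {q : Fin k → MvPolynomial σ ℂ}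
        (_ : ∀ x : DX u, (toLoc x.1 (X u) ^ K) • bvec (w u) x = fun i => toLoc x.1 (pu i))
        (_ : ∀ x : DX v, (toLoc x.1 (X v) ^ K) • bvec (w v) x = fun i => toLoc x.1 (pv i))
        (_ : ∀ x (hu : x ∈ DX u) (hv : x ∈ DX v),
          (toLoc x (X u * X v) ^ K) • (toLoc x (X u) • bvec (w u) ⟨x, hu⟩ -
          toLoc x (X v) • bvec (w v) ⟨x, hv⟩) = fun c => toLoc x ((polys (JAt A)).mulVec q c)),
        (X u * X v ^ K : MvPolynomial σ ℂ) • pu - (X v * X u ^ K : MvPolynomial σ ℂ) • pv =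
          (polys (JAt A)).mulVec q := by
      intro u v pu pv q h1 h2 h3
      funext c
      apply algebraMap_locAt_injective x
      have e1 := congrFun (h1 ⟨x, hx u⟩) c
      have e2 := congrFun (h2 ⟨x, hx v⟩) c
      have e3 := congrFun (h3 x (hx u) (hx v)) c
      simp only [Pi.smul_apply, Pi.sub_apply, smul_eq_mul, map_mul] at e1 e2 e3
      simp only [Pi.smul_apply, Pi.sub_apply, smul_eq_mul, map_mul, map_sub, map_pow]
      rw [← e3, ← e1, ← e2]
      ring
    have hAu : (polys A).mulVec pu = 0 := by
      funext i
      apply algebraMap_locAt_injective x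
      have e1 := (hw u).mulVec_eq_zero ⟨x, hx u⟩
      have e2 := congrFun (map_mulVec_toLoc x (polys A) pu) i
      rw [← hpu' ⟨x, hx u⟩, Matrix.mulVec_smul, e1, smul_zero] at e2
      rw [← e2, Pi.zero_apply, Pi.zero_apply, map_zero]
    obtain ⟨r, hr, hru⟩ := hK.exists_of_cocycle hA h huv hut hvt hpu hAu (hcoc hpu' hpv' hq₁)
      (hcoc hpv' hpt' hq₂) (hcoc hpu' hpt' hq₃)
    -- Since $p_u=X_u^Kw_u$, the relation $X_up_u=JA^tr$ becomes $w_u=JA^t(r/X_u^{K+1})$; the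
    -- quotient has degree $-1$, as a section of $\mathcal{O}(-1)^k$ must.
    have hex : ∀ y : DX u, ∃ z : Fin k → LocAt y.1,
        toLoc y.1 (X u) ^ (K + 1) • z = fun j => toLoc y.1 (r j) := fun y => by
      obtain ⟨e, he⟩ := (isUnit_X y.2).pow (K + 1)
      refine ⟨(↑e⁻¹ : LocAt y.1) • fun j => toLoc y.1 (r j), ?_⟩
      rw [← he, smul_smul, Units.mul_inv, one_smul]
    choose z hz using hex
    obtain ⟨ρ, hρ⟩ := exists_bvec_eq (d := -1) z fun j => by
      refine sectionsO_of_X_pow_mul (e := K) (K + 1) le_rfl ?_ (by push_cast; ring)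
      have : (fun y : DX u => toLoc y.1 (X u) ^ (K + 1) * z y j) = fun y : DX u =>
          toLoc y.1 (r j) := funext fun y => congrFun (hz y) j
      rw [this]
      exact sectionsO_of_poly (hr j) _
    refine hasClass_zero_unique (hw u) (hasClass_zero_of_mulVec_eq ρ fun y => ?_)
    have e1 := congrArg (fun f => toLoc y.1 (X u) • f) (hpu' y)
    have e2 : (toLoc y.1 (X u) • fun i => toLoc y.1 (pu i)) =
        fun c => toLoc y.1 ((polys (JAt A)).mulVec r c) := by
      rw [← hru]
      funext c
      simp
    rw [← map_mulVec_toLoc, ← hz y, ← hρ y, toLoc_smul_mulVec] at e2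
    have e3 := e1.trans e2
    simp only [smul_smul, ← pow_succ'] at e3
    exact ((isUnit_X y.2).pow (K + 1)).smul_left_cancel.1 e3
  apply eq_of_locally_eq
  intro x hx
  obtain ⟨v, hv⟩ := exists_mem_DX x
  exact ⟨DX v, le_top, hv, by rw [← hm, hzero, map_zero, map_zero]⟩

/-- A syzygy $w$ gives cycles $w/X_v$ on the charts, and the classes of $(w/X_v)\otimes X_v$ glue to
a section of $E(1)$. When this section is zero, each $w/X_v$ is a boundary, and two charts suffice
to remove the denominators. -/
theorem kerEqIm_of_subsingleton_H0 [Finite σ] (hA : FullRank A) (h : SelfDual A)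
    (h3 : ∃ u v : σ, u ≠ v) (hs : Subsingleton (H0 (twist (bundle A h) 1))) : KerEqIm A := by
  intro w hw hAw
  have hex : ∀ (v : σ) (y : DX v), ∃ z : Fin N ⊕ Fin N → LocAt y.1,
      toLoc y.1 (X v) • z = fun c => toLoc y.1 (w c) := fun v y => by
    obtain ⟨e, he⟩ := isUnit_X y.2
    refine ⟨(↑e⁻¹ : LocAt y.1) • fun c => toLoc y.1 (w c), ?_⟩
    rw [← he, smul_smul, Units.mul_inv, one_smul]
  choose z hz using hex
  have hζ : ∀ v, ∃ ζ : Γ(⨁ fun _ : Fin N ⊕ Fin N => O σ 0, DX v), ∀ x, bvec ζ x = z v x := by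
    intro v
    apply exists_bvec_eq
    intro c
    refine sectionsO_of_X_pow_mul (e := 1) 1 le_rfl ?_ (by norm_num)
    have : (fun y : DX v => toLoc y.1 (X v) ^ 1 * z v y c) = fun y : DX v =>
        toLoc y.1 (w c) := funext fun y => by
      rw [pow_one]
      exact congrFun (hz v y) c
    rw [this]
    exact sectionsO_of_poly (hw c) _
  choose ζ hζ using hζ
  have hm : ∀ v, ∃ m : Γ(bundle A h, DX v), HasClass (monad A h) (U := DX v) (ζ v) m := by
    intro v
    apply monad_exists_hasClass
    intro x
    have e1 : toLoc x.1 (X v) • ((polys A).map (toLoc x.1)).mulVec (bvec (ζ v) x) =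
        toLoc x.1 (X v) • 0 := by
      rw [← Matrix.mulVec_smul, hζ, hz, map_mulVec_toLoc, hAw, smul_zero]
      funext i
      exact map_zero _
    exact (isUnit_X x.2).smul_left_cancel.1 e1
  choose m hm using hm
  have hcomp : ∀ u v, res (twist (bundle A h) 1) (inf_le_left : DX u ⊓ DX v ≤ DX u)
      (twistX (bundle A h) u _ (m u)) = res _ inf_le_right (twistX (bundle A h) v _ (m v)) := by
    intro u v
    obtain ⟨r, hr⟩ := exists_ratio (U := DX u ⊓ DX v) u inf_le_right
    rw [res_twistX, res_twistX]
    refine twistX_eq _ _ r hr ?_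
    refine hasClass_zero_unique (v := res _ (inf_le_right : DX u ⊓ DX v ≤ DX v) (ζ v))
      (S := monad A h) ?_ ((hm v).res _)
    have h1 := ((hm u).res (inf_le_left : DX u ⊓ DX v ≤ DX u)).smul r
    have h2 : r • res (⨁ fun _ : Fin N ⊕ Fin N => O σ 0) (inf_le_left : DX u ⊓ DX v ≤ DX u) (ζ u) =
        res _ (inf_le_right : DX u ⊓ DX v ≤ DX v) (ζ v) := by
      apply eq_of_bvec_eq
      intro x
      rw [bvec_smul, bvec_res, bvec_res, hζ, hζ]
      have e1 := hz u ⟨x.1, x.2.1⟩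
      have e2 := hz v ⟨x.1, x.2.2⟩
      have e3 := e1.trans e2.symm
      rw [← hr x, mul_comm, mul_smul] at e3
      exact (isUnit_X x.2.2).smul_left_cancel.1 e3
    exact (congrArg (fun y => HasClass (monad A h) (U := DX u ⊓ DX v) y _) h2).mp h1
  obtain ⟨s, hs'⟩ := exists_gluing (twist (bundle A h) 1) (U := ⊤) (fun v => DX v)
    (fun v => le_top) (fun x _ => by
      obtain ⟨v, hv⟩ := exists_mem_DX x
      exact Opens.mem_iSup.2 ⟨v, hv⟩) _ hcomp
  have hm0 : ∀ v, m v = 0 := fun v => by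
    apply twistX_injective (v := v) (le_refl (DX v))
    rw [← hs', Subsingleton.elim s 0, map_zero, map_zero]
  have hq : ∀ v, ∃ K₀, ∀ K ≥ K₀, ∃ q : Fin k → MvPolynomial σ ℂ,
      (X v ^ K : MvPolynomial σ ℂ) • w = (polys (JAt A)).mulVec q := by
    intro v
    have hm' := hm v
    rw [hm0] at hm'
    obtain ⟨c, hc⟩ := hm'.exists_mulVec_eq hA
    obtain ⟨K₀, hK₀⟩ := exists_frac_family one_pos (isHomogeneous_X ℂ v) rfl
      (f := fun x => toLoc x.1 (X v) • bvec c x) (fun i => by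
        have := sectionsO_mul (sectionsO_of_poly (isHomogeneous_X ℂ v) (DX v)) (bval_mem c i)
        exact this)
    refine ⟨K₀, fun K hK => ?_⟩
    obtain ⟨q, -, hq⟩ := hK₀ K hK
    refine ⟨q, ?_⟩
    have : Nonempty σ := ⟨v⟩
    obtain ⟨x, hx⟩ := exists_generic_point (σ := σ)
    funext i
    apply algebraMap_locAt_injective x
    have key : ∀ y : DX v, toLoc y.1 (X v) ^ K • (fun c => toLoc y.1 (w c)) =
        fun c => toLoc y.1 ((polys (JAt A)).mulVec q c) := by
      intro y
      rw [← map_mulVec_toLoc, ← hq y, toLoc_smul_mulVec, toLoc_smul_mulVec, ← hc, hζ, hz]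
    refine Eq.trans ?_ (congrFun (key ⟨x, hx v⟩) i)
    simp
  obtain ⟨u, v, huv⟩ := h3
  obtain ⟨Ku, hu⟩ := hq u
  obtain ⟨Kv, hv⟩ := hq v
  obtain ⟨qu, hqu⟩ := hu (Ku ⊔ Kv) le_sup_left
  obtain ⟨qv, hqv⟩ := hv (Ku ⊔ Kv) le_sup_right
  exact kerEqIm_of_X_pow_smul hA huv hw hqu hqv

end GlobalSections

/-! ### Linear algebra of the splitting on a line. -/

section LinearAlgebra

/-- A split surjection of vector spaces, in coordinates. -/
theorem exists_split_kernel {ι μ : Type} [Fintype ι] [DecidableEq ι] [Fintype μ] [DecidableEq μ]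
    {m : ℕ} (P : Matrix μ ι ℂ) (B : Matrix ι μ ℂ) (hPB : P * B = 1)
    (hm : Fintype.card ι = m + Fintype.card μ) :
    ∃ (G : Matrix ι (Fin m) ℂ) (T : Matrix (Fin m) ι ℂ),
      P * G = 0 ∧ T * G = 1 ∧ T * B = 0 ∧ G * T + B * P = 1 := by
  obtain ⟨V, hV0, hdim⟩ : ∃ V : Submodule ℂ (ι → ℂ), (∀ w, w ∈ V ↔ P.mulVec w = 0) ∧
      Module.finrank ℂ V = m := by
    refine ⟨LinearMap.ker P.mulVecLin, fun w => Iff.rfl, ?_⟩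
    have hsurj : LinearMap.range P.mulVecLin = ⊤ := by
      refine LinearMap.range_eq_top.2 fun w => ⟨B.mulVec w, ?_⟩
      rw [Matrix.mulVecLin_apply, Matrix.mulVec_mulVec, hPB, Matrix.one_mulVec]
    have := LinearMap.finrank_range_add_finrank_ker P.mulVecLin
    rw [hsurj, finrank_top, Module.finrank_fintype_fun_eq_card,
      Module.finrank_fintype_fun_eq_card] at this
    omega
  obtain ⟨φ⟩ : Nonempty (V ≃ₗ[ℂ] (Fin m → ℂ)) := ⟨LinearEquiv.ofFinrankEq _ _ (by simp [hdim])⟩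
  have hV : ∀ w, w - B.mulVec (P.mulVec w) ∈ V := fun w => by
    rw [hV0, Matrix.mulVec_sub, Matrix.mulVec_mulVec (P.mulVec w) P B, hPB, Matrix.one_mulVec,
      sub_self]
  obtain ⟨E, hE⟩ : ∃ E : (ι → ℂ) →ₗ[ℂ] V, ∀ w, (E w).1 = w - B.mulVec (P.mulVec w) :=
    ⟨LinearMap.codRestrict V (LinearMap.id - B.mulVecLin ∘ₗ P.mulVecLin) hV, fun w => rfl⟩
  obtain ⟨G, hG⟩ : ∃ G : Matrix ι (Fin m) ℂ, ∀ w, G.mulVec w = (φ.symm w : V).1 :=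
    ⟨LinearMap.toMatrix' (V.subtype ∘ₗ φ.symm.toLinearMap), fun w =>
      LinearMap.toMatrix'_mulVec _ _⟩
  obtain ⟨T, hT⟩ : ∃ T : Matrix (Fin m) ι ℂ, ∀ w, T.mulVec w = φ (E w) :=
    ⟨LinearMap.toMatrix' (φ.toLinearMap ∘ₗ E), fun w => LinearMap.toMatrix'_mulVec _ _⟩
  have hEV : ∀ w : V, E w.1 = w := fun w => Subtype.ext (by
    have : P.mulVec w.1 = 0 := (hV0 _).1 w.2
    rw [hE, this, Matrix.mulVec_zero, sub_zero])
  refine ⟨G, T, Matrix.ext_of_mulVec_single fun i => ?_, Matrix.ext_of_mulVec_single fun i => ?_,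
    Matrix.ext_of_mulVec_single fun i => ?_, Matrix.ext_of_mulVec_single fun i => ?_⟩ <;>
    generalize (Pi.single i (1 : ℂ) : _ → ℂ) = w
  · rw [← Matrix.mulVec_mulVec, hG, Matrix.zero_mulVec]
    exact (hV0 _).1 (φ.symm w).2
  · rw [← Matrix.mulVec_mulVec, hG, hT, hEV, LinearEquiv.apply_symm_apply, Matrix.one_mulVec]
  · rw [← Matrix.mulVec_mulVec, hT, Matrix.zero_mulVec]
    have : E (B.mulVec w) = 0 := Subtype.ext (by
      rw [hE, Matrix.mulVec_mulVec _ P B, hPB, Matrix.one_mulVec, sub_self]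
      rfl)
    rw [this, map_zero]
  · rw [Matrix.add_mulVec, ← Matrix.mulVec_mulVec, hG, hT, LinearEquiv.symm_apply_apply,
      ← Matrix.mulVec_mulVec, Matrix.one_mulVec, hE, sub_add_cancel]

/-- The linear algebra behind the splitting of the cohomology bundle of a monad on a line. -/
theorem exists_splitting {k N m : ℕ} (B : Fin 2 → Matrix (Fin k) (Fin N ⊕ Fin N) ℂ)
    (hB : ∀ i, B i * symJ N * (B i).transpose = 0)
    (hB' : B 0 * symJ N * (B 1).transpose + B 1 * symJ N * (B 0).transpose = 0)
    (hdet : (B 0 * symJ N * (B 1).transpose).det ≠ 0) (hm : 2 * N = m + 2 * k) :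
    ∃ (G : Matrix (Fin N ⊕ Fin N) (Fin m) ℂ) (T : Matrix (Fin m) (Fin N ⊕ Fin N) ℂ)
      (D : Fin 2 → Matrix (Fin k) (Fin N ⊕ Fin N) ℂ) (L : Matrix (Fin k) (Fin k) ℂ),
      (∀ i, B i * G = 0) ∧ T * G = 1 ∧ (∀ i, T * (symJ N * (B i).transpose) = 0) ∧
      G * T + (symJ N * (B 0).transpose * D 0 + symJ N * (B 1).transpose * D 1) = 1 ∧
      D 0 = -(L * B 1) ∧ D 1 = L * B 0 := by
  have hu : IsUnit (B 0 * symJ N * (B 1).transpose).det := isUnit_iff_ne_zero.2 hdet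
  set M := B 0 * symJ N * (B 1).transpose with hM
  have hM' : B 1 * symJ N * (B 0).transpose = -M := eq_neg_of_add_eq_zero_right hB'
  have h1 : M⁻¹ * M = 1 := Matrix.nonsing_inv_mul M hu
  have h2 : M * M⁻¹ = 1 := Matrix.mul_nonsing_inv M hu
  -- Since $B_iJB_i^t=0$ and $B_1JB_0^t=-M$, the matrix $(JB_0^t\,|\,JB_1^t)$ has the left inverse
  -- with rows $-M^{-1}B_1$, $M^{-1}B_0$. The kernel of this left inverse is $\ker B_0\cap\ker B_1$,
  -- of dimension $2N-2k=m$.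
  have hPB : Matrix.fromRows (-(M⁻¹ * B 1)) (M⁻¹ * B 0) *
      Matrix.fromCols (symJ N * (B 0).transpose) (symJ N * (B 1).transpose) = 1 := by
    rw [Matrix.fromRows_mul_fromCols, ← Matrix.fromBlocks_one]
    simp only [Matrix.neg_mul, Matrix.mul_assoc] at hB hM' hM ⊢
    rw [hB, hB, hM', ← hM, h1]
    simp [h1]
  obtain ⟨G, T, hG, hTG, hT, hGT⟩ := exists_split_kernel (m := m) _ _ hPB (by simp; omega)
  rw [Matrix.fromRows_mul, ← Matrix.fromRows_zero] at hG
  replace hG := Matrix.fromRows_inj hG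
  rw [Matrix.mul_fromCols, ← Matrix.fromCols_zero] at hT
  replace hT := Matrix.fromCols_inj hT
  rw [Matrix.fromCols_mul_fromRows] at hGT
  refine ⟨G, T, ![-(M⁻¹ * B 1), M⁻¹ * B 0], M⁻¹, ?_, hTG, ?_, hGT, rfl, rfl⟩
  · rw [Fin.forall_fin_two]
    constructor
    · rw [← Matrix.one_mul (B 0), ← h2, Matrix.mul_assoc M, Matrix.mul_assoc M, hG.2,
        Matrix.mul_zero]
    · have := hG.1
      rw [Matrix.neg_mul, neg_eq_zero] at this
      rw [← Matrix.one_mul (B 1), ← h2, Matrix.mul_assoc M, Matrix.mul_assoc M, this,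
        Matrix.mul_zero]
  · rw [Fin.forall_fin_two]
    exact hT

theorem rank_eq_of_det_mul_ne_zero {ι : Type} [Fintype ι] {k : ℕ} (A : Matrix (Fin k) ι ℂ)
    (D : Matrix ι (Fin k) ℂ) (h : (A * D).det ≠ 0) : A.rank = k := by
  refine le_antisymm ((Matrix.rank_le_card_height A).trans (Fintype.card_fin k).le) ?_
  have hu : IsUnit (A * D) := (Matrix.isUnit_iff_isUnit_det (A * D)).2 (isUnit_iff_ne_zero.2 h)
  have h2 : (A * D).rank = k := (Matrix.rank_of_isUnit (A * D) hu).trans (Fintype.card_fin k)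
  exact h2.symm.le.trans (Matrix.rank_mul_le_left A D)

end LinearAlgebra

/-! ### Triviality of the cohomology bundle on a line. -/

section Splitting

variable {k N m : ℕ} {U : (PP (Fin 2)).Opens}

/-- The inclusion of the scalars in the localization at a point. -/
abbrev scalar {σ : Type} (x : PP σ) : ℂ →+* LocAt x := (toLoc x).comp C

/-- The morphism `O^m ⟶ O^{2N}` given by a matrix of scalars. -/
def scalarHom (σ : Type) (G : Matrix (Fin N ⊕ Fin N) (Fin m) ℂ) :
    (⨁ fun _ : Fin m => O σ 0) ⟶ ⨁ fun _ : Fin N ⊕ Fin N => O σ 0 :=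
  biproduct.matrix fun j c => mulO 0 (by norm_num) ⟨C (G c j), isHomogeneous_C _ _⟩

theorem bvec_scalarHom (G : Matrix (Fin N ⊕ Fin N) (Fin m) ℂ)
    (s : Γ(⨁ fun _ : Fin m => O (Fin 2) 0, U)) (x : U) :
    bvec ((scalarHom (Fin 2) G).app U s) x = (G.map (scalar x.1)).mulVec (bvec s x) :=
  funext fun c => bval_matrix (by norm_num)
    (fun j c => ⟨C (G c j), isHomogeneous_C _ _⟩) s c x

theorem isIso_of_locally_bijective {X : Scheme.{0}} {M N : X.Modules} (f : M ⟶ N)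
    (hinj : ∀ (U : X.Opens) (s : Γ(M, U)), f.app U s = 0 → s = 0)
    (hsurj : ∀ (U : X.Opens) (t : Γ(N, U)), ∀ x ∈ U, ∃ (V : X.Opens) (h : V ≤ U), x ∈ V ∧
      ∃ s, f.app V s = res N h t) : IsIso f := by
  have hi : ∀ U, Function.Injective (f.app U) := fun U =>
    (injective_iff_map_eq_zero _).2 (hinj U)
  rw [Scheme.Modules.Hom.isIso_iff_isIso_app]
  intro U
  rw [ConcreteCategory.isIso_iff_bijective]
  refine ⟨hi U, fun t => ?_⟩
  have key := exists_of_locally_unique M (U := U)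
    (fun V s => ∃ hV : V ≤ U, f.app V s = res N hV t) ?_ ?_ ?_
  · obtain ⟨s, hs⟩ := key
    refine ⟨s, eq_of_locally_eq _ _ _ fun x hx => ?_⟩
    obtain ⟨V, hV, hxV, _, h⟩ := hs x hx
    exact ⟨V, hV, hxV, (app_res f hV s).symm.trans h⟩
  · rintro V W hW s hV ⟨hV', h⟩
    exact ⟨hW.trans hV, by rw [app_res, h, res_res]⟩
  · rintro V s s' hV ⟨_, h⟩ ⟨_, h'⟩
    exact hi V (h.trans h'.symm)
  · intro x hx
    obtain ⟨V, hV, hxV, s, h⟩ := hsurj U t x hx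
    exact ⟨V, hV, hxV, s, hV, h⟩

variable {A : LinMat k N (Fin 2)} {B : Fin 2 → Matrix (Fin k) (Fin N ⊕ Fin N) ℂ}

theorem SelfDual.eval {σ : Type} {A : LinMat k N σ} (h : SelfDual A) (p : σ → ℂ) :
    evalMat A p * symJ N * (evalMat A p).transpose = 0 := by
  have h3 : symJ N = ((symJ N).map (C : ℂ →+* MvPolynomial σ ℂ)).map (MvPolynomial.eval p) := by
    ext i j
    simp
  rw [h3, evalMat, ← Matrix.transpose_map, ← Matrix.map_mul, ← Matrix.map_mul, h]
  ext i j
  simp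

theorem evalMat_of_pencil (hA : ∀ i c, (A i c).1 = C (B 0 i c) * X 0 + C (B 1 i c) * X 1)
    (p : Fin 2 → ℂ) : evalMat A p = p 0 • B 0 + p 1 • B 1 := by
  ext i c
  simp [evalMat, polys, hA, mul_comm]

theorem pencil_selfDual (hA : ∀ i c, (A i c).1 = C (B 0 i c) * X 0 + C (B 1 i c) * X 1)
    (h : SelfDual A) : (∀ i, B i * symJ N * (B i).transpose = 0) ∧
      B 0 * symJ N * (B 1).transpose + B 1 * symJ N * (B 0).transpose = 0 := by
  have h0 : B 0 * symJ N * (B 0).transpose = 0 := by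
    simpa [evalMat_of_pencil hA] using h.eval ![1, 0]
  have h1 : B 1 * symJ N * (B 1).transpose = 0 := by
    simpa [evalMat_of_pencil hA] using h.eval ![0, 1]
  refine ⟨Fin.forall_fin_two.2 ⟨h0, h1⟩, ?_⟩
  have := h.eval ![1, 1]
  simpa [evalMat_of_pencil hA, Matrix.add_mul, Matrix.mul_add, h0, h1, add_comm] using this

/-- With $M=B_0JB_1^t$, the product of $p_0B_0+p_1B_1$ with $JB_1^t$ is $p_0M$, and with $JB_0^t$ it
is $-p_1M$; one of the two is invertible. -/
theorem pencil_fullRank (hA : ∀ i c, (A i c).1 = C (B 0 i c) * X 0 + C (B 1 i c) * X 1)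
    (h : SelfDual A) (hdet : (B 0 * symJ N * (B 1).transpose).det ≠ 0) : FullRank A := by
  obtain ⟨hB, hB'⟩ := pencil_selfDual hA h
  have key : ∀ (a : ℂ) (p : Fin 2 → ℂ) (D : Matrix (Fin N ⊕ Fin N) (Fin k) ℂ), a ≠ 0 →
      evalMat A p * D = a • (B 0 * symJ N * (B 1).transpose) → (evalMat A p).rank = k := by
    intro a p D ha hD
    refine rank_eq_of_det_mul_ne_zero _ D ?_
    rw [hD, Matrix.det_smul]
    exact mul_ne_zero (pow_ne_zero _ ha) hdet
  intro p hp
  by_cases h0 : p 0 = 0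
  · refine key (- p 1) p (symJ N * (B 0).transpose) (neg_ne_zero.2 fun h1 => hp ?_) ?_
    · ext i
      fin_cases i <;> assumption
    · rw [evalMat_of_pencil hA, ← Matrix.mul_assoc, h0, zero_smul, zero_add, Matrix.smul_mul,
        Matrix.smul_mul, eq_neg_of_add_eq_zero_right hB', smul_neg, neg_smul]
  · refine key (p 0) p (symJ N * (B 1).transpose) h0 ?_
    rw [evalMat_of_pencil hA, ← Matrix.mul_assoc, Matrix.add_mul, Matrix.add_mul, Matrix.smul_mul,
      Matrix.smul_mul, Matrix.smul_mul, Matrix.smul_mul, hB, smul_zero, add_zero]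

theorem polys_pencil (hA : ∀ i c, (A i c).1 = C (B 0 i c) * X 0 + C (B 1 i c) * X 1)
    (x : PP (Fin 2)) : (polys A).map (toLoc x) =
      toLoc x (X 0) • (B 0).map (scalar x) + toLoc x (X 1) • (B 1).map (scalar x) := by
  ext i c
  simp [polys, hA, mul_comm, -algebraMap_smul]

theorem polys_JAt_pencil (hA : ∀ i c, (A i c).1 = C (B 0 i c) * X 0 + C (B 1 i c) * X 1)
    (x : PP (Fin 2)) : (polys (JAt A)).map (toLoc x) =
      toLoc x (X 0) • (symJ N * (B 0).transpose).map (scalar x) +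
      toLoc x (X 1) • (symJ N * (B 1).transpose).map (scalar x) := by
  have h3 : ((symJ N).map (C : ℂ →+* MvPolynomial (Fin 2) ℂ)).map (toLoc x) =
    (symJ N).map (scalar x) := by ext; rfl
  rw [polys_JAt, Matrix.map_mul, Matrix.transpose_map, polys_pencil hA, h3, Matrix.map_mul,
    Matrix.map_mul, Matrix.transpose_add, Matrix.mul_add, Matrix.transpose_smul,
    Matrix.transpose_smul, Matrix.mul_smul, Matrix.mul_smul]
  rfl

theorem mulVec_scalar_eq_zero {R : Type} {ι κ μ : Type} [CommRing R] [Fintype κ] [Fintype μ]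
    (f : ℂ →+* R)
    {P : Matrix ι κ ℂ} {G : Matrix κ μ ℂ} (h : P * G = 0) (w : μ → R) :
    (P.map f).mulVec ((G.map f).mulVec w) = 0 := by
  rw [Matrix.mulVec_mulVec, ← Matrix.map_mul, h, Matrix.map_zero _ (map_zero f), Matrix.zero_mulVec]

theorem mulVec_scalar_eq_self {R : Type} {ι κ : Type} [CommRing R] [Fintype ι] [Fintype κ]
    [DecidableEq ι] (f : ℂ →+* R)
    {P : Matrix ι κ ℂ} {G : Matrix κ ι ℂ} (h : P * G = 1) (w : ι → R) :
    (P.map f).mulVec ((G.map f).mulVec w) = w := by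
  rw [Matrix.mulVec_mulVec, ← Matrix.map_mul, h, Matrix.map_one _ (map_zero f) (map_one f),
    Matrix.one_mulVec]

theorem scalar_mulVec_mem {σ : Type} {ι κ : Type} [Fintype κ] [Finite ι] (T : Matrix ι κ ℂ)
    {U : (PP σ).Opens} (w : Γ(⨁ fun _ : κ => O σ 0, U)) (i : ι) :
    (fun x : U => (T.map (scalar x.1)).mulVec (bvec w x) i) ∈ sectionsO σ 0 U := by
  have : (fun x : U => (T.map (scalar x.1)).mulVec (bvec w x) i) =
      fun x : U => ∑ c, scalar x.1 (T i c) * bval w c x := rfl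
  rw [this]
  refine sectionsO_sum _ fun c => ?_
  have := sectionsO_mul (sectionsO_of_poly (isHomogeneous_C σ (T i c)) U) (bval_mem w c)
  rwa [Nat.cast_zero, add_zero] at this

/-- The cohomology bundle of a symplectic monad on a line is trivial if a determinant does not
vanish. -/
theorem nonempty_iso_of_pencil
    (hA : ∀ i c, (A i c).1 = C (B 0 i c) * X 0 + C (B 1 i c) * X 1)
    (h : SelfDual A) (hdet : (B 0 * symJ N * (B 1).transpose).det ≠ 0) (hm : 2 * N = m + 2 * k) :
    Nonempty (bundle A h ≅ ⨁ fun _ : Fin m => O (Fin 2) 0) := by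
  obtain ⟨hB, hB'⟩ := pencil_selfDual hA h
  obtain ⟨G, T, D, L, hBG, hTG, hTB, hGT, hD0, hD1⟩ := exists_splitting B hB hB' hdet hm
  have hfull := pencil_fullRank hA h hdet
  have hzero : scalarHom (Fin 2) G ≫ (monad A h).g = 0 := by
    apply Scheme.Modules.hom_ext
    intro U
    ext s
    refine eq_of_bvec_eq (ι := Fin k) (d := 1) fun x => ?_
    refine (bvec_monadRight A ((scalarHom (Fin 2) G).app U s) x).trans ?_
    rw [bvec_scalarHom, polys_pencil hA, Matrix.add_mulVec, Matrix.smul_mulVec, Matrix.smul_mulVec,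
      mulVec_scalar_eq_zero _ (hBG 0), mulVec_scalar_eq_zero _ (hBG 1), smul_zero, smul_zero,
      add_zero]
    exact (bvec_zero x).symm
  -- The columns of $G$ are constant vectors killed by $B_0$ and $B_1$, hence global cycles; their
  -- classes trivialise the bundle.
  let Ψ : (⨁ fun _ : Fin m => O (Fin 2) 0) ⟶ bundle A h :=
    (monad A h).liftCycles (scalarHom (Fin 2) G) hzero ≫ (monad A h).homologyπ
  have hΨ : ∀ (U : (PP (Fin 2)).Opens) (s : Γ(⨁ fun _ : Fin m => O (Fin 2) 0, U)),
      HasClass (monad A h) (U := U) ((scalarHom (Fin 2) G).app U s) (Ψ.app U s) := fun U s =>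
    ⟨((monad A h).liftCycles (scalarHom (Fin 2) G) hzero).app U s,
      ConcreteCategory.congr_hom (congrArg (fun φ => Scheme.Modules.Hom.app φ U)
        ((monad A h).liftCycles_i _ hzero)) s, rfl⟩
  have : IsIso Ψ := by
    refine isIso_of_locally_bijective Ψ ?_ ?_
    · intro U s hs
      have h1 := hΨ U s
      rw [hs] at h1
      obtain ⟨r, hr⟩ := h1.exists_mulVec_eq hfull
      refine eq_of_bvec_eq fun x => ?_
      have h2 := congrArg (T.map (scalar x.1)).mulVec (hr x)
      rw [bvec_scalarHom, mulVec_scalar_eq_self _ hTG, polys_JAt_pencil hA, Matrix.add_mulVec,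
        Matrix.smul_mulVec, Matrix.smul_mulVec, Matrix.mulVec_add, Matrix.mulVec_smul,
        Matrix.mulVec_smul, mulVec_scalar_eq_zero _ (hTB 0), mulVec_scalar_eq_zero _ (hTB 1),
        smul_zero, smul_zero, add_zero] at h2
      rw [h2, bvec_zero]
    · intro U t x hxU
      obtain ⟨V, hV, hxV, w₀, hw₀⟩ := exists_locally_hasClass (S := monad A h) t x hxU
      obtain ⟨v, hv⟩ := exists_mem_DX x
      obtain ⟨W, hWV, hWD, hxW⟩ : ∃ W : (PP (Fin 2)).Opens, W ≤ V ∧ W ≤ DX v ∧ x ∈ W :=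
        ⟨V ⊓ DX v, inf_le_left, inf_le_right, hxV, hv⟩
      have hw := hw₀.res hWV
      erw [res_res] at hw
      set w : Γ(⨁ fun _ : Fin N ⊕ Fin N => O (Fin 2) 0, W) := res _ hWV w₀ with hwdef
      have hAw := fun y => hw.mulVec_eq_zero (A := A) y
      -- Applying $L$ to the cycle equation $X_0B_0w+X_1B_1w=0$ shows that $(D_0w,D_1w)$ is
      -- proportional to $(X_0,X_1)$. The common quotient $r$ is a section of $\mathcal{O}(-1)^k$.
      have hrel : ∀ (y : W) (i j : Fin 2), toLoc y.1 (X i) • ((D j).map (scalar y.1)).mulVec (bvec w y) =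
          toLoc y.1 (X j) • ((D i).map (scalar y.1)).mulVec (bvec w y) := by
        intro y
        have h1 := hAw y
        rw [polys_pencil hA, Matrix.add_mulVec, Matrix.smul_mulVec, Matrix.smul_mulVec] at h1
        have h2 := congrArg (L.map (scalar y.1)).mulVec h1
        rw [Matrix.mulVec_add, Matrix.mulVec_smul, Matrix.mulVec_smul, Matrix.mulVec_mulVec,
          Matrix.mulVec_mulVec, ← Matrix.map_mul, ← Matrix.map_mul, Matrix.mulVec_zero, ← hD1,
          ← neg_neg (L * B 1), ← hD0, Matrix.map_neg _ (map_neg _), Matrix.neg_mulVec, smul_neg,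
          ← sub_eq_add_neg, sub_eq_zero] at h2
        rw [Fin.forall_fin_two]
        constructor <;> rw [Fin.forall_fin_two]
        · exact ⟨rfl, h2⟩
        · exact ⟨h2.symm, rfl⟩
      have hdiv : ∀ y : W, ∃ r : Fin k → LocAt y.1, toLoc y.1 (X v) • r =
          ((D v).map (scalar y.1)).mulVec (bvec w y) := fun y => by
        obtain ⟨u, hu⟩ := isUnit_X (hWD y.2)
        refine ⟨(↑u⁻¹ : LocAt y.1) • ((D v).map (scalar y.1)).mulVec (bvec w y), ?_⟩
        rw [← hu, smul_smul, Units.mul_inv, one_smul]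
      choose r hr using hdiv
      have hr' : ∀ (y : W) (j : Fin 2), toLoc y.1 (X j) • r y =
          ((D j).map (scalar y.1)).mulVec (bvec w y) := by
        intro y j
        refine (isUnit_X (hWD y.2)).smul_left_cancel.1 ?_
        rw [smul_comm, hr, hrel]
      obtain ⟨ρ, hρ⟩ := exists_bvec_eq (ι := Fin k) (d := -1) r fun j => by
        refine sectionsO_of_X_pow_mul (e := 0) 1 hWD ?_ (by norm_num)
        have : (fun y : W => toLoc y.1 (X v) ^ 1 * r y j) = fun y : W =>
            ((D v).map (scalar y.1)).mulVec (bvec w y) j := funext fun y => by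
          rw [pow_one]
          exact congrFun (hr y) j
        rw [this]
        exact scalar_mulVec_mem _ _ _
      obtain ⟨s, hs⟩ := exists_bvec_eq (ι := Fin m) (d := 0)
        (fun y : W => (T.map (scalar y.1)).mulVec (bvec w y)) fun j => scalar_mulVec_mem _ _ _
      refine ⟨W, hWV.trans hV, hxW, s, ?_⟩
      -- Applied to $w$, the decomposition `hGT` of the identity reads $w=GTw+JA^tr$.
      have h0 : HasClass (monad A h) (U := W) (w - (scalarHom (Fin 2) G).app W s) 0 := by
        refine hasClass_zero_of_mulVec_eq ρ fun y => ?_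
        rw [bvec_sub, bvec_scalarHom, hs, hρ, polys_JAt_pencil hA,
          Matrix.add_mulVec, Matrix.smul_mulVec, Matrix.smul_mulVec, ← Matrix.mulVec_smul,
          ← Matrix.mulVec_smul, hr', hr', Matrix.mulVec_mulVec, Matrix.mulVec_mulVec,
          Matrix.mulVec_mulVec, ← Matrix.map_mul, ← Matrix.map_mul, ← Matrix.map_mul,
          sub_eq_iff_eq_add', ← Matrix.add_mulVec, ← Matrix.add_mulVec,
          ← Matrix.map_add _ (map_add _), ← Matrix.map_add _ (map_add _), hGT,
          Matrix.map_one _ (map_zero _) (map_one _), Matrix.one_mulVec]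
      have h1 := hw.sub (hΨ W s)
      exact (sub_eq_zero.1 (hasClass_zero_unique h1 h0)).symm
  exact ⟨(asIso Ψ).symm⟩

end Splitting

/-! ### Linear forms as linear functions. -/

section LinearForms

variable {σ : Type}

theorem LinForm.induction {P : MvPolynomial σ ℂ → Prop} (hX : ∀ v, P (X v)) (h0 : P 0)
    (hadd : ∀ a b, P a → P b → P (a + b)) (hsmul : ∀ (c : ℂ) a, P a → P (c • a))
    {f : MvPolynomial σ ℂ} (hf : f.IsHomogeneous 1) : P f := by
  have hf' : f ∈ homogeneousSubmodule σ ℂ 1 := hf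
  clear hf
  rw [homogeneousSubmodule_one_eq_span_X] at hf'
  induction hf' using Submodule.span_induction with
  | mem x hx => obtain ⟨v, rfl⟩ := hx; exact hX v
  | zero => exact h0
  | add x y _ _ hx hy => exact hadd x y hx hy
  | smul c x _ hx => exact hsmul c x hx

theorem lineSubst_linForm (p q : σ → ℂ) {f : MvPolynomial σ ℂ} (hf : f.IsHomogeneous 1) :
    lineSubst p q f = C (eval p f) * X 0 + C (eval q f) * X 1 := by
  refine LinForm.induction (P := fun f => lineSubst p q f = C (eval p f) * X 0 +
    C (eval q f) * X 1) (fun v => ?_) ?_ (fun a b ha hb => ?_) (fun c a ha => ?_) hf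
  · simp [lineSubst]
  · simp
  · simp only [map_add, ha, hb]
    ring
  · rw [map_smul, ha, smul_eval, smul_eval, C_mul, C_mul, MvPolynomial.smul_eq_C_mul]
    ring

/-- A linear form as a linear function. -/
def linEval (f : LinForm σ) : (σ → ℂ) →ₗ[ℂ] ℂ where
  toFun p := eval p f.1
  map_add' p q := by
    refine LinForm.induction (P := fun f => eval (p + q) f = eval p f + eval q f)
      (fun v => ?_) ?_ (fun a b ha hb => ?_) (fun c a ha => ?_) f.2
    · simp
    · simp
    · simp only [map_add, ha, hb]
      ring
    · simp only [ha, smul_eval]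
      ring
  map_smul' t p := by
    refine LinForm.induction (P := fun f => eval (t • p) f = t * eval p f)
      (fun v => ?_) ?_ (fun a b ha hb => ?_) (fun c a ha => ?_) f.2
    · simp
    · simp
    · simp only [map_add, ha, hb]
      ring
    · simp only [ha, smul_eval]
      ring

theorem LinForm.eq_sum [Fintype σ] {f : MvPolynomial σ ℂ} (hf : f.IsHomogeneous 1) :
    f = ∑ v, C (coeff (Finsupp.single v 1) f) * X v := by
  classical
  refine LinForm.induction (P := fun f => f = ∑ v, C (coeff (Finsupp.single v 1) f) * X v)
    (fun v => ?_) ?_ (fun a b ha hb => ?_) (fun c a ha => ?_) hf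
  · rw [Finset.sum_eq_single v]
    · simp
    · intro u _ hu
      rw [coeff_X, if_neg (fun h => hu (Finsupp.single_left_injective one_ne_zero h).symm)]
      simp
    · simp
  · simp
  · simp only [coeff_add, C_add, add_mul, Finset.sum_add_distrib, ← ha, ← hb]
  · simp only [coeff_smul, smul_eq_mul, C_mul, mul_assoc, ← Finset.mul_sum, ← ha]
    rw [MvPolynomial.smul_eq_C_mul]

theorem eval_single [Fintype σ] [DecidableEq σ] {f : MvPolynomial σ ℂ} (hf : f.IsHomogeneous 1)
    (v : σ) : eval (Pi.single v 1) f = coeff (Finsupp.single v 1) f := by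
  conv_lhs => rw [LinForm.eq_sum hf]
  rw [map_sum, Finset.sum_eq_single v]
  · simp
  · intro u _ hu
    simp [hu]
  · simp

end LinearForms

/-! ### The bundle on a general line. -/

section GeneralLine

variable {σ : Type} {k N : ℕ}

/-- The cohomology bundle of a symplectic monad is trivial on a general line if a determinant does
not vanish identically. -/
theorem trivialSplittingType_of_det_ne_zero {m : ℕ} {A : LinMat k N σ} (h : SelfDual A)
    (hm : 2 * N = m + 2 * k) (p q : σ → ℂ)
    (hdet : (evalMat A p * symJ N * (evalMat A q).transpose).det ≠ 0) :
    TrivialSplittingType m A h := by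
  -- This is $A(p)JA(q)^t$ with both points left indeterminate; its determinant serves as the
  -- equation `Φ` of the excluded lines.
  let M : Matrix (Fin k) (Fin k) (MvPolynomial (σ ⊕ σ) ℂ) :=
    (polys A).map (rename Sum.inl : MvPolynomial σ ℂ → MvPolynomial (σ ⊕ σ) ℂ) *
      (symJ N).map (C : ℂ → MvPolynomial (σ ⊕ σ) ℂ) *
      ((polys A).map (rename Sum.inr : MvPolynomial σ ℂ → MvPolynomial (σ ⊕ σ) ℂ)).transpose
  have hM : ∀ p q : σ → ℂ, eval (Sum.elim p q) M.det =
      (evalMat A p * symJ N * (evalMat A q).transpose).det := by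
    intro p q
    rw [RingHom.map_det]
    congr 1
    change M.map (eval (Sum.elim p q)) = _
    rw [Matrix.map_mul, Matrix.map_mul, Matrix.transpose_map]
    congr 2
    · ext i c
      simp [evalMat, eval_rename]
    · ext c j
      simp
    · ext c j
      simp [evalMat, eval_rename]
  refine ⟨M.det, fun h0 => hdet ?_, fun p q _ hpq => ?_⟩
  · rw [← hM, h0, map_zero]
  · refine nonempty_iso_of_pencil (B := ![evalMat A p, evalMat A q])
      (fun i c => lineSubst_linForm p q (A i c).2) _ ?_ hm
    rw [hM] at hpq
    exact hpq

end GeneralLine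

/-! ### The family $A_\varepsilon$: self-duality, rank, RS form, general line. -/

section Family

variable {n k : ℕ}

theorem evalMat_fromCols {ι κ μ σ : Type} (F : Matrix ι κ (LinForm σ)) (H : Matrix ι μ (LinForm σ))
    (p : σ → ℂ) : evalMat (Matrix.fromCols F H) p = Matrix.fromCols (evalMat F p) (evalMat H p) := by
  ext i (j | j) <;> rfl

/-- Vectors are written as restrictions of functions on `ℕ`, so that shifted indices such as `i + s`
need no bound. -/
theorem evalMat_bandMatrix_mulVec {σ : Type} (f : Fin (n + 1) → LinForm σ) (p : σ → ℂ) (u : ℕ → ℂ)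
    (i : Fin k) : (evalMat (bandMatrix k f) p).mulVec (fun j : Fin (n + k) => u j) i =
      ∑ s : Fin (n + 1), eval p (f s).1 * u (i + s) := by
  symm
  refine Finset.sum_of_injOn (fun s : Fin (n + 1) => (⟨i + s, by omega⟩ : Fin (n + k))) ?_
    (fun _ _ => Finset.mem_coe.2 (Finset.mem_univ _)) ?_ ?_
  · intro s _ t _ h
    simp only [Fin.mk.injEq] at h
    exact Fin.ext (by omega)
  · intro j _ hj
    have : ¬ (i.1 ≤ j.1 ∧ j.1 - i.1 < n + 1) := fun h => hj
      ⟨⟨j.1 - i.1, h.2⟩, Finset.mem_coe.2 (Finset.mem_univ _), Fin.ext (by simp only; omega)⟩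
    have h0 : evalMat (bandMatrix k f) p i j = 0 := by
      change eval p (if h : i.1 ≤ j.1 ∧ j.1 - i.1 < n + 1 then f ⟨j.1 - i.1, h.2⟩ else 0).1 = 0
      rw [dif_neg this]
      simp
    exact mul_eq_zero_of_left h0 _
  · intro s _
    have : i.1 ≤ i.1 + s.1 ∧ i.1 + s.1 - i.1 < n + 1 := by omega
    simp only [evalMat, polys, bandMatrix, Matrix.map_apply, dif_pos this]
    congr 5
    exact Fin.ext (by simp)

theorem evalMat_Heps (hk : 3 ≤ k) (ε : ℂ) (p : Coords n → ℂ) (i : Fin k) (j : Fin (n + k)) :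
    evalMat (Heps n k ε) p i j =
      (if h : k ≤ i.1 + j.1 + 1 ∧ i.1 + j.1 + 1 - k < n + 1 then
        p (Sum.inr ⟨i.1 + j.1 + 1 - k, h.2⟩) else 0) +
      ε * p (Sum.inr 1) * ((if j.1 = 0 then if i.1 = 0 then 1 else 0 else 0) +
        if j.1 = n + k - 1 then if i.1 = k - 1 then 1 else 0 else 0) := by
  change eval p (if h : k ≤ i.1 + j.1 + 1 ∧ i.1 + j.1 + 1 - k < n + 1 then
      coord (Sum.inr ⟨i.1 + j.1 + 1 - k, h.2⟩)
    else if i.1 + j.1 = 0 ∨ i.1 + j.1 + 2 = n + 2 * k then ε • coord (Sum.inr 1)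
    else 0 : LinForm (Coords n)).1 = _
  by_cases h : k ≤ i.1 + j.1 + 1 ∧ i.1 + j.1 + 1 - k < n + 1
  · rw [dif_pos h, dif_pos h]
    have h1 : ¬ (j.1 = 0 ∧ i.1 = 0) := by omega
    have h2 : ¬ (j.1 = n + k - 1 ∧ i.1 = k - 1) := by omega
    rw [← ite_and, ← ite_and, if_neg h1, if_neg h2]
    simp [coord]
  · rw [dif_neg h, dif_neg h, ← ite_and, ← ite_and]
    by_cases h1 : j.1 = 0 ∧ i.1 = 0
    · have h2 : ¬ (j.1 = n + k - 1 ∧ i.1 = k - 1) := by omega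
      rw [if_pos h1, if_neg h2, if_pos (by omega)]
      simp [coord]
    · by_cases h2 : j.1 = n + k - 1 ∧ i.1 = k - 1
      · rw [if_neg h1, if_pos h2, if_pos (by omega)]
        simp [coord]
      · rw [if_neg h1, if_neg h2, if_neg (by omega)]
        simp

theorem evalMat_Heps_mulVec (hk : 3 ≤ k) (ε : ℂ) (p : Coords n → ℂ) (v : ℕ → ℂ) (i : Fin k) :
    (evalMat (Heps n k ε) p).mulVec (fun j : Fin (n + k) => v j) i =
      (∑ t : Fin (n + 1), p (Sum.inr t) * v (k - 1 - i + t)) +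
      ε * p (Sum.inr 1) * ((if i.1 = 0 then v 0 else 0) +
        if i.1 = k - 1 then v (n + k - 1) else 0) := by
  have h0 : ∀ (a : ℕ) (ha : a < n + k) (c : ℂ), ∑ j : Fin (n + k), (if j.1 = a then c else 0) * v j
      = c * v a := by
    intro a ha c
    rw [Finset.sum_eq_single (⟨a, ha⟩ : Fin (n + k))]
    · simp
    · intro j _ hj
      rw [if_neg (fun h => hj (Fin.ext h)), zero_mul]
    · simp
  have h1 : ∑ t : Fin (n + 1), p (Sum.inr t) * v (k - 1 - i + t) = ∑ j : Fin (n + k),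
      (if h : k ≤ i.1 + j.1 + 1 ∧ i.1 + j.1 + 1 - k < n + 1 then
        p (Sum.inr ⟨i.1 + j.1 + 1 - k, h.2⟩) else 0) * v j := by
    refine Finset.sum_of_injOn (fun s : Fin (n + 1) => (⟨k - 1 - i + s, by omega⟩ : Fin (n + k)))
      ?_ (fun _ _ => Finset.mem_coe.2 (Finset.mem_univ _)) ?_ ?_
    · intro s _ t _ h
      simp only [Fin.mk.injEq] at h
      exact Fin.ext (by omega)
    · intro j _ hj
      rw [dif_neg, zero_mul]
      exact fun h => hj ⟨⟨i.1 + j.1 + 1 - k, h.2⟩, Finset.mem_coe.2 (Finset.mem_univ _),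
        Fin.ext (by simp only; omega)⟩
    · intro s _
      rw [dif_pos (show k ≤ i.1 + (k - 1 - i.1 + s.1) + 1 ∧
        i.1 + (k - 1 - i.1 + s.1) + 1 - k < n + 1 by omega)]
      congr 3
      exact Fin.ext (by simp only; omega)
  rw [h1]
  simp only [Matrix.mulVec, dotProduct, evalMat_Heps hk, add_mul, Finset.sum_add_distrib, mul_add,
    mul_assoc, ← Finset.mul_sum]
  rw [h0 0 (by omega), h0 (n + k - 1) (by omega)]
  simp

theorem evalMat_Aeps_mulVec (hk : 3 ≤ k) (ε : ℂ) (p : Coords n → ℂ) (u v : ℕ → ℂ) (i : Fin k) :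
    (evalMat (Aeps n k ε) p).mulVec (Sum.elim (fun j : Fin (n + k) => u j) fun j => v j) i =
      (∑ s : Fin (n + 1), p (Sum.inl s) * u (i + s)) +
      ((∑ t : Fin (n + 1), p (Sum.inr t) * v (k - 1 - i + t)) +
      ε * p (Sum.inr 1) * ((if i.1 = 0 then v 0 else 0) +
        if i.1 = k - 1 then v (n + k - 1) else 0)) := by
  rw [Aeps, evalMat_fromCols, Matrix.fromCols_mulVec_sumElim, Pi.add_apply,
    evalMat_bandMatrix_mulVec, evalMat_Heps_mulVec hk]
  simp [coord]

theorem selfDual_of_eval {k N : ℕ} {σ : Type} {A : LinMat k N σ}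
    (h : ∀ p, evalMat A p * symJ N * (evalMat A p).transpose = 0) : SelfDual A := by
  unfold SelfDual
  ext1 i j
  refine MvPolynomial.funext fun p => ?_
  have h1 := congrFun (congrFun (h p) i) j
  have h3 : symJ N = ((symJ N).map (C : ℂ →+* MvPolynomial σ ℂ)).map (MvPolynomial.eval p) := by
    ext i j
    simp
  rw [h3, evalMat, ← Matrix.transpose_map, ← Matrix.map_mul, ← Matrix.map_mul] at h1
  rw [Matrix.zero_apply, map_zero]
  exact h1

theorem fromCols_symJ_mul {k N : ℕ} (F H F' H' : Matrix (Fin k) (Fin N) ℂ) :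
    Matrix.fromCols F H * symJ N * (Matrix.fromCols F' H').transpose =
      F * H'.transpose - H * F'.transpose := by
  rw [symJ, Matrix.fromCols_mul_fromBlocks, Matrix.transpose_fromCols,
    Matrix.fromCols_mul_fromRows]
  simp
  abel

/-- Self-duality means that $FH^t$ is symmetric. As $H$ is persymmetric, its entry $(i,j)$ is
$\sum_sx_sh_{i+j+s}$, which is symmetric in $i$ and $j$. -/
theorem selfDual_Aeps (n k : ℕ) (ε : ℂ) : SelfDual (Aeps n k ε) := by
  refine selfDual_of_eval fun p => ?_
  rw [Aeps, evalMat_fromCols, fromCols_symJ_mul, sub_eq_zero]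
  obtain ⟨h, hh⟩ : ∃ h : ℕ → ℂ, ∀ (i : Fin k) (j : Fin (n + k)),
      evalMat (Heps n k ε) p i j = h (i + j) := by
    refine ⟨fun m => eval p (if h : k ≤ m + 1 ∧ m + 1 - k < n + 1 then
      coord (Sum.inr ⟨m + 1 - k, h.2⟩)
    else if m = 0 ∨ m + 2 = n + 2 * k then ε • coord (Sum.inr 1)
    else 0 : LinForm (Coords n)).1, fun i j => rfl⟩
  have h1 : ∀ i j : Fin k, (evalMat (bandMatrix k fun s => coord (Sum.inl s)) p *
      (evalMat (Heps n k ε) p).transpose) i j =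
      ∑ s : Fin (n + 1), p (Sum.inl s) * h (i + j + s) := by
    intro i j
    have := evalMat_bandMatrix_mulVec (fun s : Fin (n + 1) => coord (Sum.inl s : Coords n)) p
      (fun l => h (j + l)) i
    simp only [coord, eval_X, ← hh, Matrix.mulVec] at this
    refine Eq.trans this (Finset.sum_congr rfl fun s _ => ?_)
    congr 2
    ring
  have h2 : evalMat (Heps n k ε) p * (evalMat (bandMatrix k fun s => coord (Sum.inl s)) p).transpose
      = (evalMat (bandMatrix k fun s => coord (Sum.inl s)) p *
        (evalMat (Heps n k ε) p).transpose).transpose := by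
    rw [Matrix.transpose_mul, Matrix.transpose_transpose]
  rw [h2]
  ext i j
  rw [Matrix.transpose_apply, h1, h1, add_comm i.1]

/-- Injectivity of a linear map in a family of linear maps is an open condition; here the source
is a product of two spheres. -/
theorem eventually_ne_zero {E F G : Type} [NormedAddCommGroup E] [NormedSpace ℂ E]
    [FiniteDimensional ℂ E] [NormedAddCommGroup F] [NormedSpace ℂ F] [FiniteDimensional ℂ F]
    [NormedAddCommGroup G] [NormedSpace ℂ G] (f : ℂ → E → F → G)
    (hf : Continuous fun z : ℂ × E × F => f z.1 z.2.1 z.2.2)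
    (hE : ∀ ε (t : ℂ) x y, f ε (t • x) y = t • f ε x y)
    (hF : ∀ ε (t : ℂ) x y, f ε x (t • y) = t • f ε x y)
    (h0 : ∀ x y, x ≠ 0 → y ≠ 0 → f 0 x y ≠ 0) :
    ∀ᶠ ε in nhds (0 : ℂ), ∀ x y, x ≠ 0 → y ≠ 0 → f ε x y ≠ 0 := by
  have : ProperSpace E := FiniteDimensional.proper ℂ E
  have : ProperSpace F := FiniteDimensional.proper ℂ F
  have hK := (isCompact_sphere (0 : E) 1).prod (isCompact_sphere (0 : F) 1)
  have h1 := hK.eventually_forall_of_forall_eventually (x₀ := (0 : ℂ))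
    (P := fun ε z => f ε z.1 z.2 ≠ 0) fun z hz =>
      (hf.continuousAt (x := ((0 : ℂ), z))).eventually_ne
        (h0 z.1 z.2 (ne_zero_of_mem_unit_sphere ⟨z.1, hz.1⟩)
          (ne_zero_of_mem_unit_sphere ⟨z.2, hz.2⟩))
  filter_upwards [h1] with ε hε x y hx hy h
  have hx' : ‖x‖ ≠ 0 := norm_ne_zero_iff.2 hx
  have hy' : ‖y‖ ≠ 0 := norm_ne_zero_iff.2 hy
  refine hε (((‖x‖⁻¹ : ℝ) : ℂ) • x, ((‖y‖⁻¹ : ℝ) : ℂ) • y) ⟨?_, ?_⟩ ?_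
  · simp [norm_smul, hx']
  · simp [norm_smul, hy']
  · rw [hE, hF, h, smul_zero, smul_zero]

theorem rank_eq_of_vecMul_ne_zero {ι : Type} [Fintype ι] (M : Matrix (Fin k) ι ℂ)
    (h : ∀ c : Fin k → ℂ, c ≠ 0 → Matrix.vecMul c M ≠ 0) : M.rank = k := by
  have hi : Function.Injective fun c => Matrix.vecMul c M := by
    intro c d hcd
    by_contra hne
    refine h (c - d) (sub_ne_zero.2 hne) ?_
    rw [Matrix.sub_vecMul]
    exact sub_eq_zero.2 hcd
  exact (Matrix.vecMul_injective_iff.1 hi).rank_matrix.trans (Fintype.card_fin k)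

/-- The polynomial with the given coefficients. -/
def coeffPoly {m : ℕ} (c : Fin m → ℂ) : Polynomial ℂ :=
  ∑ i : Fin m, Polynomial.monomial i.1 (c i)

theorem coeffPoly_ne_zero {m : ℕ} {c : Fin m → ℂ} (hc : c ≠ 0) : coeffPoly c ≠ 0 := by
  obtain ⟨i, hi⟩ := Function.ne_iff.1 hc
  intro h
  apply hi
  have := congrArg (fun p => Polynomial.coeff p i) h
  simp only [coeffPoly, Polynomial.finsetSum_coeff, Polynomial.coeff_monomial,
    Polynomial.coeff_zero] at this
  rw [Finset.sum_eq_single i (fun j _ hj => if_neg fun h => hj (Fin.ext h)) (by simp)] at this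
  simpa using this

theorem eval_coeffPoly {m : ℕ} (c : Fin m → ℂ) (t : ℂ) :
    (coeffPoly c).eval t = ∑ i, c i * t ^ i.1 := by
  simp [coeffPoly, Polynomial.eval_finsetSum]

/-- Pairing $cM$ with the vector of powers of $t$ gives the product of the polynomials with
coefficients $c$ and $y$, and $\mathbb{C}[t]$ is a domain. -/
theorem vecMul_ne_zero_of_powers {m l N : ℕ} {c : Fin m → ℂ} {y : Fin l → ℂ} (hc : c ≠ 0)
    (hy : y ≠ 0) (M : Matrix (Fin m) (Fin N) ℂ)
    (hM : ∀ (t : ℂ) i, M.mulVec (fun j => t ^ j.1) i = t ^ i.1 * ∑ s, y s * t ^ s.1) :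
    Matrix.vecMul c M ≠ 0 := by
  intro h
  refine mul_ne_zero (coeffPoly_ne_zero hc) (coeffPoly_ne_zero hy) (Polynomial.funext fun t => ?_)
  have h1 := Matrix.dotProduct_mulVec c M (fun j => t ^ j.1)
  rw [h, zero_dotProduct] at h1
  rw [Polynomial.eval_mul, eval_coeffPoly, eval_coeffPoly, Polynomial.eval_zero, ← h1,
    Finset.sum_mul]
  refine Finset.sum_congr rfl fun i _ => ?_
  rw [hM, mul_assoc]

theorem vecMul_band_ne_zero (p : Coords n → ℂ) (hp : (fun s => p (Sum.inl s)) ≠ 0)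
    (c : Fin k → ℂ) (hc : c ≠ 0) : Matrix.vecMul c
      (evalMat (bandMatrix k fun s : Fin (n + 1) => (coord (Sum.inl s) : LinForm (Coords n))) p)
        ≠ 0 := by
  refine vecMul_ne_zero_of_powers hc hp _ fun t i => ?_
  rw [evalMat_bandMatrix_mulVec (u := fun j => t ^ j), Finset.mul_sum]
  refine Finset.sum_congr rfl fun s _ => ?_
  simp only [coord, eval_X, pow_add]
  ring

/-- With its rows in reverse order, $H_0$ is the band matrix of $y_0,\dots,y_n$. -/
theorem vecMul_Heps_zero_ne_zero (hk : 3 ≤ k) (p : Coords n → ℂ)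
    (hp : (fun s => p (Sum.inr s)) ≠ 0) (c : Fin k → ℂ) (hc : c ≠ 0) :
    Matrix.vecMul c (evalMat (Heps n k 0) p) ≠ 0 := by
  intro h
  have hc' : (fun i => c (Fin.rev i)) ≠ 0 := fun h0 => hc (funext fun i => by
    simpa using congrFun h0 (Fin.rev i))
  refine vecMul_ne_zero_of_powers hc' hp ((evalMat (Heps n k 0) p).submatrix Fin.rev id)
    (fun t i => ?_) ?_
  · have := evalMat_Heps_mulVec hk 0 p (fun j => t ^ j) (Fin.rev i)
    rw [zero_mul, zero_mul, add_zero] at this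
    refine Eq.trans this ?_
    rw [Finset.mul_sum]
    refine Finset.sum_congr rfl fun s _ => ?_
    have hi : k - 1 - (Fin.rev i).1 = i.1 := by
      rw [Fin.val_rev]
      omega
    rw [hi, pow_add]
    ring
  · rw [← h]
    ext j
    exact Equiv.sum_comp Fin.revPerm (fun i => c i * evalMat (Heps n k 0) p i j)

/-- $cH_\varepsilon(y)$ is bilinear in $(c,y)$, continuous in $\varepsilon$, and nonzero at
$\varepsilon=0$ for nonzero $c,y$. Compactness of the unit spheres gives one neighbourhood of $0$
for all $c$ and $y$. -/
theorem eventually_vecMul_Heps_ne_zero (hk : 3 ≤ k) : ∀ᶠ ε in nhds (0 : ℂ),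
    ∀ (p : Coords n → ℂ), (fun s => p (Sum.inr s)) ≠ 0 → ∀ c : Fin k → ℂ, c ≠ 0 →
      Matrix.vecMul c (evalMat (Heps n k ε) p) ≠ 0 := by
  have h := eventually_ne_zero (fun ε (c : Fin k → ℂ) (y : Fin (n + 1) → ℂ) =>
    Matrix.vecMul c (evalMat (Heps n k ε) (Sum.elim 0 y))) ?_ ?_ ?_ ?_
  · filter_upwards [h] with ε hε p hp c hc h0
    refine hε c _ hc hp ?_
    rw [← h0]
    congr 1
    ext i j
    rw [evalMat_Heps hk, evalMat_Heps hk]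
    simp
  · have hent : ∀ i j, Continuous fun z : ℂ × (Fin k → ℂ) × (Fin (n + 1) → ℂ) =>
        evalMat (Heps n k z.1) (Sum.elim 0 z.2.2) i j := by
      intro i j
      simp only [evalMat_Heps hk, Sum.elim_inr]
      split_ifs <;> fun_prop
    refine continuous_pi fun j => ?_
    change Continuous fun z : ℂ × (Fin k → ℂ) × (Fin (n + 1) → ℂ) =>
      ∑ i, z.2.1 i * evalMat (Heps n k z.1) (Sum.elim 0 z.2.2) i j
    refine continuous_finsetSum _ fun i _ => ?_
    exact ((continuous_apply i).comp (continuous_fst.comp continuous_snd)).mul (hent i j)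
  · intro ε t x y
    exact Matrix.smul_vecMul _ _ _
  · intro ε t x y
    have : evalMat (Heps n k ε) (Sum.elim 0 (t • y)) = t • evalMat (Heps n k ε) (Sum.elim 0 y) := by
      ext i j
      rw [Matrix.smul_apply, evalMat_Heps hk, evalMat_Heps hk]
      split_ifs <;> simp <;> ring
    rw [this, Matrix.vecMul_smul]
  · intro c y hc hy
    exact vecMul_Heps_zero_ne_zero hk _ (by simpa using hy) c hc

/-- If some $x_s$ is nonzero at the point, the block $F$ already has rank $k$; otherwise some $y_s$
is nonzero and $H_\varepsilon$ does. -/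
theorem fullRank_Aeps {ε : ℂ} (hε : ∀ (p : Coords n → ℂ), (fun s => p (Sum.inr s)) ≠ 0 →
    ∀ c : Fin k → ℂ, c ≠ 0 → Matrix.vecMul c (evalMat (Heps n k ε) p) ≠ 0) :
    FullRank (Aeps n k ε) := by
  intro p hp
  refine rank_eq_of_vecMul_ne_zero _ fun c hc h => ?_
  rw [Aeps, evalMat_fromCols, Matrix.vecMul_fromCols] at h
  have hl : Matrix.vecMul c (evalMat (bandMatrix k fun s : Fin (n + 1) =>
      (coord (Sum.inl s) : LinForm (Coords n))) p) = 0 := funext fun j => congrFun h (Sum.inl j)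
  have hr : Matrix.vecMul c (evalMat (Heps n k ε) p) = 0 := funext fun j => congrFun h (Sum.inr j)
  by_cases h1 : (fun s => p (Sum.inl s)) = 0
  · by_cases h2 : (fun s => p (Sum.inr s)) = 0
    · refine hp (funext fun s => ?_)
      rcases s with s | s
      exacts [congrFun h1 s, congrFun h2 s]
    · exact hε p h2 c hc hr
  · exact vecMul_band_ne_zero p h1 c hc hl

theorem isRSMatrix_Aeps {ε : ℂ} (hε : ∀ (p : Coords n → ℂ), (fun s => p (Sum.inr s)) ≠ 0 →
    ∀ c : Fin k → ℂ, c ≠ 0 → Matrix.vecMul c (evalMat (Heps n k ε) p) ≠ 0) :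
    IsRSMatrix n k (Aeps n k ε) := by
  refine ⟨fun s => coord (Sum.inl s), Heps n k ε, ?_, ?_, fun p hp h0 => ?_, rfl⟩
  · rw [Fintype.linearIndependent_iff]
    intro g hg s
    have := congrArg (fun f : LinForm (Coords n) => eval (Pi.single (Sum.inl s) 1) f.1) hg
    simp only [AddSubmonoidClass.coe_finsetSum, SetLike.val_smul, map_sum, coord, smul_eval, eval_X,
      ZeroMemClass.coe_zero, map_zero] at this
    rw [Finset.sum_eq_single s] at this
    · simpa using this
    · intro t _ ht
      rw [Pi.single_eq_of_ne (by simpa using ht), mul_zero]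
    · simp
  · intro i j s t h
    unfold Heps
    simp only [h]
  · refine rank_eq_of_vecMul_ne_zero _ (hε p fun h1 => hp (funext fun s => ?_))
    rcases s with s | s
    · simpa [coord] using h0 s
    · exact congrFun h1 s

/-- The test line joins the coordinate points of $x_0$ and $y_0$. At the first, $H_\varepsilon=0$;
at the second, the corner terms vanish with $y_1$. The matrix $F(p)H_\varepsilon(q)^t$ is the
order-reversing permutation matrix, of determinant $\pm1$. -/
theorem trivialSplittingType_Aeps (hn : 2 ≤ n) (hk : 3 ≤ k) (ε : ℂ) :
    TrivialSplittingType (2 * n) (Aeps n k ε) (selfDual_Aeps n k ε) := by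
  refine trivialSplittingType_of_det_ne_zero _ (by ring) (Pi.single (Sum.inl 0) 1)
    (Pi.single (Sum.inr 0) 1) ?_
  rw [Aeps, evalMat_fromCols, evalMat_fromCols, fromCols_symJ_mul]
  have h1 : evalMat (Heps n k ε) (Pi.single (Sum.inl 0) 1) = 0 := by
    ext i j
    rw [evalMat_Heps hk]
    simp
  have h2 : evalMat (bandMatrix k fun s : Fin (n + 1) => (coord (Sum.inl s) : LinForm (Coords n)))
      (Pi.single (Sum.inl 0) 1) * (evalMat (Heps n k ε) (Pi.single (Sum.inr 0) 1)).transpose =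
      (Fin.revPerm (n := k)).permMatrix ℂ := by
    ext i j
    have h3 := evalMat_bandMatrix_mulVec (k := k) (fun s : Fin (n + 1) =>
      (coord (Sum.inl s) : LinForm (Coords n))) (Pi.single (Sum.inl 0) 1)
      (fun m => if hm : m < n + k then
        evalMat (Heps n k ε) (Pi.single (Sum.inr 0) 1) j ⟨m, hm⟩ else 0) i
    rw [Finset.sum_eq_single 0 (fun s _ hs => by
      simp [coord, hs]) (by simp)] at h3
    simp only [Fin.is_lt, dif_pos, Fin.eta] at h3
    refine Eq.trans h3 ?_
    have hi : i.1 < n + k := by omega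
    have h10 : (1 : Fin (n + 1)) ≠ 0 := by
      intro h
      have := congrArg Fin.val h
      simp at this
      omega
    have h0 : (Pi.single (Sum.inr 0) 1 : Coords n → ℂ) (Sum.inr 1) = 0 :=
      Pi.single_eq_of_ne (fun h => h10 (Sum.inr_injective h)) _
    rw [Fin.val_zero, add_zero, dif_pos hi, evalMat_Heps hk, h0, mul_zero, zero_mul, add_zero,
      Equiv.Perm.permMatrix, PEquiv.toMatrix_toPEquiv_eq, Matrix.submatrix_apply,
      Matrix.one_apply]
    simp only [id_eq, Fin.revPerm_apply]
    by_cases hij : Fin.rev i = j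
    · have : j.1 + i.1 + 1 = k := by
        rw [← hij, Fin.val_rev]
        omega
      rw [if_pos hij, dif_pos (by omega)]
      have hz : (⟨j.1 + i.1 + 1 - k, by omega⟩ : Fin (n + 1)) = 0 := Fin.ext (by simp [this])
      rw [hz, Pi.single_eq_same, mul_one]
      simp [coord]
    · rw [if_neg hij]
      split_ifs with h
      · rw [Pi.single_eq_of_ne (i := Sum.inr 0), mul_zero]
        intro hz
        apply hij
        have := congrArg Fin.val (Sum.inr_injective hz)
        simp only [Fin.val_zero] at this
        rw [Fin.ext_iff, Fin.val_rev]
        omega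
      · rw [mul_zero]
  rw [h1, h2, Matrix.zero_mul, sub_zero, Matrix.det_permutation]
  simp

end Family

/-! ### Skew double sequences. -/

section Sequences

variable {n k : ℕ}

/-- A double sequence which is locally constant along antidiagonals is constant along them. -/
theorem antidiagonal_const {N : ℕ} {c : ℕ → ℕ → ℂ}
    (h : ∀ r j, r + 1 ≤ n → j + 1 < N → c r (j + 1) = c (r + 1) j) (m r j : ℕ) (hr : r + m ≤ n)
    (hj : j + m < N) : c (r + m) j = c r (j + m) := by
  induction m generalizing j with
  | zero => rfl
  | succ m ih =>
    rw [← add_assoc, ← h (r + m) j (by omega) (by omega), ih (j + 1) (by omega) (by omega)]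
    congr 1
    omega

/-- The vanishing of a skew double sequence. -/
theorem skew_eq_zero (hk : 3 ≤ k) {a : ℕ → ℕ → ℂ}
    (h : ∀ i r s, i < k → r ≤ n → s ≤ n → a r (i + s) + a s (i + r) = 0) (r j : ℕ) (hr : r ≤ n)
    (hj : j < n + k) : a r j = 0 := by
  -- The relations for `(i + 1, s, t)` and `(i, s + 1, t)` share the term `a t (i + s + 1)`, so
  -- their difference shows constancy along antidiagonals.
  have hstep : ∀ r j, r + 1 ≤ n → j + 1 < n + k → a r (j + 1) = a (r + 1) j := by
    intro s j hs hj
    obtain ⟨t, i, htn, hik, rfl⟩ : ∃ t i, t ≤ n ∧ i + 1 < k ∧ j = i + t :=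
      ⟨min j n, j - min j n, min_le_right _ _, by omega, by omega⟩
    have h1 := h (i + 1) s t (by omega) (by omega) htn
    have h2 := h i (s + 1) t (by omega) hs htn
    rw [show i + t + 1 = i + 1 + t by ring]
    rw [show i + (s + 1) = i + 1 + s by ring] at h2
    exact add_right_cancel (h1.trans h2.symm)
  -- Every antidiagonal contains a place with `0 ≤ j₀ - r₀ < k`, where the relation with `r = s`
  -- reads `2 * a r₀ j₀ = 0`.
  obtain ⟨r₀, j₀, hr₀, hj₀, hT, hk₀, hle⟩ : ∃ r₀ j₀, r₀ ≤ n ∧ j₀ < n + k ∧ r₀ + j₀ = r + j ∧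
      j₀ - r₀ < k ∧ r₀ ≤ j₀ :=
    ⟨min ((r + j) / 2) n, r + j - min ((r + j) / 2) n, by omega, by omega, by omega, by omega,
      by omega⟩
  have h0 : a r₀ j₀ = 0 := by
    have := h (j₀ - r₀) r₀ r₀ hk₀ hr₀ hr₀
    rw [Nat.sub_add_cancel hle, ← two_mul] at this
    simpa using this
  rcases le_total r₀ r with hle' | hle'
  · obtain ⟨m, rfl⟩ := Nat.exists_eq_add_of_le hle'
    rw [antidiagonal_const hstep m r₀ j hr (by omega), ← h0]
    congr 1
    omega
  · obtain ⟨m, rfl⟩ := Nat.exists_eq_add_of_le hle'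
    rw [← h0, antidiagonal_const hstep m r j₀ hr₀ (by omega)]
    congr 1
    omega

/-- The vanishing of a skew double sequence, perturbed in the corners. -/
theorem eventually_skew_eq_zero (n : ℕ) (hk : 3 ≤ k) : ∀ᶠ ε in nhds (0 : ℂ),
    ∀ d : Fin (n + 1) → Fin (n + k) → ℂ,
    (∀ (i : Fin k) (r s : Fin (n + 1)), d r ⟨i + s, by omega⟩ + d s ⟨i + r, by omega⟩ +
      ε * ((if s.1 + 1 = n then (if i.1 = 0 then d r ⟨n + k - 1, by omega⟩ else 0) +
          if i.1 = k - 1 then d r ⟨0, by omega⟩ else 0 else 0) +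
        if r.1 + 1 = n then (if i.1 = 0 then d s ⟨n + k - 1, by omega⟩ else 0) +
          if i.1 = k - 1 then d s ⟨0, by omega⟩ else 0 else 0) = 0) → d = 0 := by
  -- The system is $L_0+\varepsilon L_1$. The map $L_0$ is injective by `skew_eq_zero`, and
  -- injectivity is an open condition in finite dimension.
  let L₀ : (Fin (n + 1) → Fin (n + k) → ℂ) →ₗ[ℂ]
      (Fin k → Fin (n + 1) → Fin (n + 1) → ℂ) :=
    { toFun := fun d i r s => d r ⟨i + s, by omega⟩ + d s ⟨i + r, by omega⟩
      map_add' := fun d e => by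
        funext i r s
        simp only [Pi.add_apply]
        ring
      map_smul' := fun t d => by
        funext i r s
        simp only [Pi.smul_apply, smul_eq_mul, RingHom.id_apply]
        ring }
  let L₁ : (Fin (n + 1) → Fin (n + k) → ℂ) →ₗ[ℂ]
      (Fin k → Fin (n + 1) → Fin (n + 1) → ℂ) :=
    { toFun := fun d i r s =>
        (if s.1 + 1 = n then (if i.1 = 0 then d r ⟨n + k - 1, by omega⟩ else 0) +
          if i.1 = k - 1 then d r ⟨0, by omega⟩ else 0 else 0) +
        if r.1 + 1 = n then (if i.1 = 0 then d s ⟨n + k - 1, by omega⟩ else 0) +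
          if i.1 = k - 1 then d s ⟨0, by omega⟩ else 0 else 0
      map_add' := fun d e => by
        funext i r s
        simp only [Pi.add_apply]
        split_ifs <;> ring
      map_smul' := fun t d => by
        funext i r s
        simp only [Pi.smul_apply, smul_eq_mul, RingHom.id_apply]
        split_ifs <;> ring }
  have h0 : Function.Injective L₀ := by
    refine (injective_iff_map_eq_zero _).2 fun d hd => ?_
    funext r j
    have := skew_eq_zero (n := n) hk
      (a := fun r j => if h : r < n + 1 ∧ j < n + k then d ⟨r, h.1⟩ ⟨j, h.2⟩ else 0)
      (fun i r s hi hr hs => by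
        rw [dif_pos (by omega), dif_pos (by omega)]
        exact congrFun (congrFun (congrFun hd ⟨i, hi⟩) ⟨r, by omega⟩) ⟨s, by omega⟩) r j
      (by omega) (by omega)
    simp only [dif_pos (show r.1 < n + 1 ∧ j.1 < n + k from ⟨r.2, j.2⟩)] at this
    exact this
  have hc : Continuous fun ε : ℂ =>
      LinearMap.toContinuousLinearMap L₀ + ε • LinearMap.toContinuousLinearMap L₁ := by
    fun_prop
  have hop := (ContinuousLinearMap.isOpen_injective (𝕜 := ℂ) (E := Fin (n + 1) → Fin (n + k) → ℂ)
    (F := Fin k → Fin (n + 1) → Fin (n + 1) → ℂ)).preimage hc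
  have hmem := hop.mem_nhds (x := 0) (by
    change Function.Injective ⇑(LinearMap.toContinuousLinearMap L₀ +
      (0 : ℂ) • LinearMap.toContinuousLinearMap L₁)
    have hz : LinearMap.toContinuousLinearMap L₀ + (0 : ℂ) • LinearMap.toContinuousLinearMap L₁ =
        LinearMap.toContinuousLinearMap L₀ := by
      ext d
      simp
    rw [hz]
    exact h0)
  filter_upwards [hmem] with ε hε d hd
  refine (injective_iff_map_eq_zero _).1 hε d ?_
  funext i r s
  exact hd i r s

end Sequences

/-! ### The linear syzygies of $A_\varepsilon$. -/

section Kernel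

variable {n k : ℕ}

theorem exists_extension {N : ℕ} (u : Fin N → ℂ) : ∃ U : ℕ → ℂ, u = fun j : Fin N => U j :=
  ⟨fun j => if h : j < N then u ⟨j, h⟩ else 0, funext fun j => by simp⟩

theorem Aeps_mulVec_x (hk : 3 ≤ k) (ε : ℂ) (w : Fin (n + k) ⊕ Fin (n + k) → ℂ) (i : Fin k)
    (r : Fin (n + 1)) : (evalMat (Aeps n k ε) (Pi.single (Sum.inl r) 1)).mulVec w i =
      w (Sum.inl ⟨i + r, by omega⟩) := by
  obtain ⟨u, hu⟩ := exists_extension (w ∘ Sum.inl)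
  obtain ⟨v, hv⟩ := exists_extension (w ∘ Sum.inr)
  rw [← Sum.elim_comp_inl_inr w, hu, hv, evalMat_Aeps_mulVec hk,
    Finset.sum_eq_single r (fun s _ hs => by simp [hs]) (by simp)]
  simp

/-- Reversing both the $y$-coordinates and the columns of the right block gives the same index
pattern `i + s` as in the $x$-case. The coordinate $y_1$ becomes `s = n - 1`, the only place where
the corners enter. -/
theorem Aeps_mulVec_y (hk : 3 ≤ k) (hn : 2 ≤ n) (ε : ℂ) (w : Fin (n + k) ⊕ Fin (n + k) → ℂ)
    (i : Fin k) (s : Fin (n + 1)) :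
    (evalMat (Aeps n k ε) (Pi.single (Sum.inr s.rev) 1)).mulVec w i =
      w (Sum.inr (Fin.rev ⟨i + s, by omega⟩)) +
      ε * (if s.1 + 1 = n then (if i.1 = 0 then w (Sum.inr (Fin.rev ⟨n + k - 1, by omega⟩)) else 0) +
          if i.1 = k - 1 then w (Sum.inr (Fin.rev ⟨0, by omega⟩)) else 0 else 0) := by
  obtain ⟨u, hu⟩ := exists_extension (w ∘ Sum.inl)
  obtain ⟨v, hv⟩ := exists_extension (w ∘ Sum.inr)
  rw [← Sum.elim_comp_inl_inr w, hu, hv, evalMat_Aeps_mulVec hk,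
    Finset.sum_eq_single (s := Finset.univ) (f := fun t => _ * v _) s.rev
      (fun s _ hs => by simp [hs]) (by simp)]
  have h1 : (Fin.rev s = 1) ↔ s.1 + 1 = n := by
    rw [Fin.ext_iff, Fin.val_rev]
    have : (1 : Fin (n + 1)).1 = 1 := by
      rw [Fin.val_one']
      exact Nat.mod_eq_of_lt (by omega)
    rw [this]
    omega
  have h2 : (Pi.single (Sum.inr s.rev) 1 : Coords n → ℂ) (Sum.inr 1) =
      if s.1 + 1 = n then 1 else 0 := by
    rw [Pi.single_apply]
    exact if_congr (by rw [← h1, Sum.inr.injEq, eq_comm]) rfl rfl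
  have h3 : k - 1 - i.1 + s.rev.1 = (Fin.rev (⟨i + s, by omega⟩ : Fin (n + k))).1 := by
    simp only [Fin.val_rev]
    omega
  rw [Pi.single_eq_same, h2, h3, Finset.sum_eq_zero (fun r _ => by simp), zero_add, one_mul,
    Sum.elim_inr, Sum.elim_inr, Sum.elim_inr]
  have h4 : (Fin.rev (⟨n + k - 1, by omega⟩ : Fin (n + k))).1 = 0 := by
    simp only [Fin.val_rev]
    omega
  have h5 : (Fin.rev (⟨0, by omega⟩ : Fin (n + k))).1 = n + k - 1 := by
    simp only [Fin.val_rev]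
  rw [h4, h5]
  split_ifs <;> ring

theorem evalMat_add {κ ι σ : Type} (A : Matrix ι κ (LinForm σ)) (p q : σ → ℂ) :
    evalMat A (p + q) = evalMat A p + evalMat A q := by
  ext i j
  exact (linEval (A i j)).map_add p q

/-- The entries of $Aw$ are quadratic; their polarisation turns the syzygy equation into linear
relations between coefficients of $w$, one for each pair of coordinate vectors and each row. -/
theorem polarize {k N : ℕ} {σ : Type} {A : LinMat k N σ} {w : Fin N ⊕ Fin N → LinForm σ}
    (h : (polys A).mulVec (fun c => (w c).1) = 0) (p q : σ → ℂ) :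
    (evalMat A p).mulVec (fun c => linEval (w c) q) +
      (evalMat A q).mulVec (fun c => linEval (w c) p) = 0 := by
  have key : ∀ p, (evalMat A p).mulVec (fun c => linEval (w c) p) = 0 := fun p => by
    have := congrArg (fun f => fun i => eval p (f i)) h
    funext i
    refine Eq.trans ?_ ((congrFun this i).trans (map_zero _))
    exact (RingHom.map_mulVec (eval p) (polys A) _ i).symm
  have h1 := key (p + q)
  have h2 : (fun c => linEval (w c) (p + q)) =
      (fun c => linEval (w c) p) + fun c => linEval (w c) q := funext fun c => map_add _ _ _
  rw [h2, evalMat_add, Matrix.add_mulVec, Matrix.mulVec_add, Matrix.mulVec_add, key, key, zero_add,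
    add_zero] at h1
  exact h1

/-- A vector of linear forms annihilated by `A_ε` is determined by part of its coefficients. -/
theorem eq_zero_of_mulVec_Aeps_eq_zero (hn : 2 ≤ n) (hk : 3 ≤ k) {ε : ℂ}
    (hε : ∀ d : Fin (n + 1) → Fin (n + k) → ℂ,
      (∀ (i : Fin k) (r s : Fin (n + 1)), d r ⟨i + s, by omega⟩ + d s ⟨i + r, by omega⟩ +
      ε * ((if s.1 + 1 = n then (if i.1 = 0 then d r ⟨n + k - 1, by omega⟩ else 0) +
          if i.1 = k - 1 then d r ⟨0, by omega⟩ else 0 else 0) +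
        if r.1 + 1 = n then (if i.1 = 0 then d s ⟨n + k - 1, by omega⟩ else 0) +
          if i.1 = k - 1 then d s ⟨0, by omega⟩ else 0 else 0) = 0) → d = 0)
    {w : Fin (n + k) ⊕ Fin (n + k) → LinForm (Coords n)}
    (h : (polys (Aeps n k ε)).mulVec (fun c => (w c).1) = 0)
    (hw : ∀ r j, linEval (w (Sum.inr j)) (Pi.single (Sum.inl r) 1) = 0) : w = 0 := by
  -- Pairs of $y$'s: the perturbed skew system for the $y$-coefficients of the right half.
  have hd : ∀ s j, linEval (w (Sum.inr (Fin.rev j))) (Pi.single (Sum.inr (Fin.rev s)) 1) = 0 := by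
    intro s j
    refine congrFun (congrFun (hε (fun s j => linEval (w (Sum.inr (Fin.rev j)))
      (Pi.single (Sum.inr (Fin.rev s)) 1)) fun i r s => ?_) s) j
    have := congrFun (polarize h (Pi.single (Sum.inr (Fin.rev s)) 1)
      (Pi.single (Sum.inr (Fin.rev r)) 1)) i
    rw [Pi.add_apply, Aeps_mulVec_y hk hn, Aeps_mulVec_y hk hn, Pi.zero_apply] at this
    linear_combination this
  -- Pairs of $x$'s: the unperturbed skew system for the $x$-coefficients of the left half.
  have ha : ∀ r j, linEval (w (Sum.inl j)) (Pi.single (Sum.inl r) 1) = 0 := by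
    intro r j
    have := skew_eq_zero (n := n) hk
      (a := fun r j => if h : r < n + 1 ∧ j < n + k then
        linEval (w (Sum.inl ⟨j, h.2⟩)) (Pi.single (Sum.inl ⟨r, h.1⟩) 1) else 0)
      (fun i r s hi hr hs => by
        have := congrFun (polarize h (Pi.single (Sum.inl ⟨s, by omega⟩) 1)
          (Pi.single (Sum.inl ⟨r, by omega⟩) 1)) ⟨i, hi⟩
        rw [Pi.add_apply, Aeps_mulVec_x hk, Aeps_mulVec_x hk, Pi.zero_apply] at this
        rw [dif_pos (by omega), dif_pos (by omega)]
        exact this) r j (by omega) (by omega)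
    simp only [dif_pos (show r.1 < n + 1 ∧ j.1 < n + k from ⟨r.2, j.2⟩)] at this
    exact this
  -- Mixed pairs express the $y$-coefficients of the left half through the $x$-coefficients of the
  -- right half, which vanish by `hw`.
  have hb : ∀ s j, linEval (w (Sum.inl j)) (Pi.single (Sum.inr (Fin.rev s)) 1) = 0 := by
    intro s j
    obtain ⟨i, r, hi, hr, hj⟩ : ∃ i r, i < k ∧ r < n + 1 ∧ j.1 = i + r :=
      ⟨j.1 - min j.1 n, min j.1 n, by omega, by omega, by omega⟩
    have hj' : j = ⟨i + r, hj ▸ j.2⟩ := Fin.ext hj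
    have := congrFun (polarize h (Pi.single (Sum.inl ⟨r, hr⟩) 1)
      (Pi.single (Sum.inr (Fin.rev s)) 1)) ⟨i, hi⟩
    rw [Pi.add_apply, Aeps_mulVec_x hk, Aeps_mulVec_y hk hn, Pi.zero_apply, hw, hw, hw] at this
    simp only [ite_self, add_zero, mul_zero] at this
    rw [hj']
    exact this
  funext c
  refine Subtype.ext ?_
  rw [LinForm.eq_sum (w c).2]
  refine Finset.sum_eq_zero fun v _ => ?_
  rw [← eval_single (w c).2]
  have : linEval (w c) (Pi.single v 1) = 0 := by
    rcases c with j | j <;> rcases v with v | v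
    · exact ha v j
    · rw [← Fin.rev_rev v]
      exact hb _ j
    · exact hw v j
    · rw [← Fin.rev_rev v, ← Fin.rev_rev j]
      exact hd _ _
  rw [show eval (Pi.single v 1) (w c).1 = 0 from this, C_0, zero_mul]

/-- The part of the coefficients of a vector annihilated by `A_ε` that determines it. -/
theorem coefficients_of_mulVec_Aeps_eq_zero (hn : 2 ≤ n) (hk : 3 ≤ k) {ε : ℂ} (hε : ε ≠ 0)
    {w : Fin (n + k) ⊕ Fin (n + k) → LinForm (Coords n)}
    (h : (polys (Aeps n k ε)).mulVec (fun c => (w c).1) = 0) (r : Fin (n + 1)) (j : Fin (n + k)) :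
    linEval (w (Sum.inr j)) (Pi.single (Sum.inl r) 1) =
      if r.1 ≤ j.1 ∧ j.1 - r.1 < k then
        linEval (w (Sum.inr ⟨j - r, by omega⟩)) (Pi.single (Sum.inl 0) 1) else 0 := by
  obtain ⟨c, hc⟩ : ∃ c : ℕ → ℕ → ℂ, ∀ (r : Fin (n + 1)) (j : Fin (n + k)),
      linEval (w (Sum.inr (Fin.rev j))) (Pi.single (Sum.inl r) 1) = c r j :=
    ⟨fun r j => if h : r < n + 1 ∧ j < n + k then
        linEval (w (Sum.inr (Fin.rev ⟨j, h.2⟩))) (Pi.single (Sum.inl ⟨r, h.1⟩) 1) else 0,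
      fun r j => by
        simp only [dif_pos (show r.1 < n + 1 ∧ j.1 < n + k from ⟨r.2, j.2⟩)]⟩
  -- The mixed relations for `(i + 1, r)` and `(i, r + 1)` contain the same coefficient of the left
  -- half, in column `i + r + 1`, which is eliminated.
  have hrel : ∀ i r s, i + 1 < k → r < n → s ≤ n →
      c r (i + 1 + s) + ε * (if s + 1 = n then if i + 1 = k - 1 then c r 0 else 0 else 0) =
      c (r + 1) (i + s) + ε * (if s + 1 = n then if i = 0 then c (r + 1) (n + k - 1) else 0
        else 0) := by
    intro i r s hi hr hs
    have h1 := congrFun (polarize h (Pi.single (Sum.inl ⟨r, by omega⟩) 1)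
      (Pi.single (Sum.inr (Fin.rev ⟨s, by omega⟩)) 1)) ⟨i + 1, hi⟩
    have h2 := congrFun (polarize h (Pi.single (Sum.inl ⟨r + 1, by omega⟩) 1)
      (Pi.single (Sum.inr (Fin.rev ⟨s, by omega⟩)) 1)) ⟨i, by omega⟩
    rw [Pi.add_apply, Aeps_mulVec_x hk, Aeps_mulVec_y hk hn, Pi.zero_apply, hc, hc, hc] at h1 h2
    simp only [Nat.succ_ne_zero, if_false, zero_add, show ¬ i = k - 1 by omega, add_zero,
      show i + (r + 1) = i + 1 + r by ring] at h1 h2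
    exact add_left_cancel (h1.trans h2.symm)
  -- Since $k\ge3$, each `j` can be written as `i + s` with `s ≠ n - 1`, and then no corner term
  -- enters.
  have hstep : ∀ r j, r + 1 ≤ n → j + 1 < n + k → c r (j + 1) = c (r + 1) j := by
    intro r j hr hj
    obtain ⟨i, s, hi, hs, hsn, rfl⟩ : ∃ i s, i + 1 < k ∧ s ≤ n ∧ s + 1 ≠ n ∧ j = i + s := by
      rcases lt_trichotomy (j + 1) n with h | h | h
      · exact ⟨0, j, by omega, by omega, by omega, by omega⟩
      · exact ⟨1, j - 1, by omega, by omega, by omega, by omega⟩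
      · exact ⟨j - n, n, by omega, by omega, by omega, by omega⟩
    have := hrel i r s hi hr hs
    rw [if_neg hsn, if_neg hsn, mul_zero, add_zero, add_zero] at this
    rw [← this]
    congr 1
    ring
  -- For `s = n - 1` and `i = 0` the main terms cancel by `hstep`, leaving $\varepsilon$ times one
  -- corner coefficient. The other corner enters only at `i = k - 2`, distinct from `0` as $k\ge3$.
  have hlast : ∀ r, r < n → c (r + 1) (n + k - 1) = 0 := by
    intro r hr
    have := hrel 0 r (n - 1) (by omega) hr (by omega)
    rw [if_pos (show n - 1 + 1 = n by omega), if_pos (show n - 1 + 1 = n by omega),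
      if_neg (show ¬ 0 + 1 = k - 1 by omega), if_pos rfl, mul_zero, add_zero,
      show 0 + 1 + (n - 1) = 0 + (n - 1) + 1 by ring, hstep r _ (by omega) (by omega)] at this
    simpa [hε] using this
  have hfirst : ∀ r, r < n → c r 0 = 0 := by
    intro r hr
    have := hrel (k - 2) r (n - 1) (by omega) hr (by omega)
    rw [if_pos (show n - 1 + 1 = n by omega), if_pos (show n - 1 + 1 = n by omega),
      if_pos (show k - 2 + 1 = k - 1 by omega), if_neg (show ¬ k - 2 = 0 by omega), mul_zero,
      add_zero, show k - 2 + 1 + (n - 1) = k - 2 + (n - 1) + 1 by ring,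
      hstep r _ (by omega) (by omega)] at this
    simpa [hε] using this
  have hcr := hc r (Fin.rev j)
  have hrj : (Fin.rev j).1 = n + k - 1 - j := by
    rw [Fin.val_rev]
    omega
  rw [Fin.rev_rev, hrj] at hcr
  rw [hcr]
  -- Inside the band the value is carried along its antidiagonal to row `0`; outside, it is carried
  -- to an end where `hfirst` or `hlast` gives zero.
  split_ifs with hif
  · have h0 := hc 0 (Fin.rev ⟨j - r, by omega⟩)
    rw [Fin.rev_rev, Fin.val_rev, Fin.val_zero] at h0
    rw [h0]
    have := antidiagonal_const hstep r 0 (n + k - 1 - j) (by omega) (by omega)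
    rw [zero_add] at this
    rw [this]
    congr 1
    simp only
    omega
  · by_cases hlt : r.1 ≤ j.1
    · have h2 := antidiagonal_const hstep (n + k - 1 - j) r 0 (by omega) (by omega)
      have h3 := hfirst (r + (n + k - 1 - j)) (by omega)
      rw [h2, zero_add] at h3
      exact h3
    · have h2 := antidiagonal_const hstep j.1 (r - j) (n + k - 1 - j) (by omega) (by omega)
      rw [Nat.sub_add_cancel (by omega)] at h2
      rw [h2, show n + k - 1 - j.1 + j.1 = n + k - 1 by omega]
      have h3 := hlast (r - j - 1) (by omega)
      rwa [Nat.sub_add_cancel (by omega)] at h3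

theorem JAt_inr {k N : ℕ} {σ : Type} (A : LinMat k N σ) (j : Fin N) (i : Fin k) :
    JAt A (Sum.inr j) i = -A i (Sum.inl j) := by
  simp only [JAt, symJ, Fintype.sum_sum_type, Matrix.fromBlocks_apply₂₁, Matrix.fromBlocks_apply₂₂,
    Matrix.zero_apply, zero_smul, Finset.sum_const_zero, add_zero, Matrix.neg_apply]
  rw [Finset.sum_eq_single j (fun l _ hl => by rw [Matrix.one_apply_ne' hl, neg_zero, zero_smul])
    (by simp), Matrix.one_apply_eq]
  exact neg_one_smul ℂ (A i (Sum.inl j))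

/-- The right half of $JA_\varepsilon^t$ is $-F^t$, so a combination of its columns can be
subtracted from $w$ to remove all $x$-coefficients from the right half; what is left vanishes by
`eq_zero_of_mulVec_Aeps_eq_zero`. -/
theorem kerEqIm_Aeps (hn : 2 ≤ n) (hk : 3 ≤ k) {ε : ℂ} (h0 : ε ≠ 0)
    (hε : ∀ d : Fin (n + 1) → Fin (n + k) → ℂ,
      (∀ (i : Fin k) (r s : Fin (n + 1)), d r ⟨i + s, by omega⟩ + d s ⟨i + r, by omega⟩ +
      ε * ((if s.1 + 1 = n then (if i.1 = 0 then d r ⟨n + k - 1, by omega⟩ else 0) +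
          if i.1 = k - 1 then d r ⟨0, by omega⟩ else 0 else 0) +
        if r.1 + 1 = n then (if i.1 = 0 then d s ⟨n + k - 1, by omega⟩ else 0) +
          if i.1 = k - 1 then d s ⟨0, by omega⟩ else 0 else 0) = 0) → d = 0) :
    KerEqIm (Aeps n k ε) := by
  intro w₀ hw₀ hker₀
  obtain ⟨w, rfl⟩ : ∃ w : Fin (n + k) ⊕ Fin (n + k) → LinForm (Coords n), w₀ = fun c => (w c).1 :=
    ⟨fun c => ⟨w₀ c, hw₀ c⟩, rfl⟩
  -- In $-F^t$ the form $x_0$ occurs, with coefficient $-1$, exactly at the places `(i, i)` with `i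
  -- < k`.
  let γ : Fin k → ℂ := fun i =>
    -linEval (w (Sum.inr ⟨i, by omega⟩)) (Pi.single (Sum.inl 0) 1)
  refine ⟨γ, ?_⟩
  let w' : Fin (n + k) ⊕ Fin (n + k) → LinForm (Coords n) :=
    fun c => w c - ∑ i, γ i • JAt (Aeps n k ε) c i
  have hw' : (fun c => (w' c).1) = (fun c => (w c).1) -
      (polys (JAt (Aeps n k ε))).mulVec fun j => C (γ j) := by
    funext c
    simp only [w', AddSubgroupClass.coe_sub, AddSubmonoidClass.coe_finsetSum, SetLike.val_smul,
      Pi.sub_apply, Matrix.mulVec, dotProduct, polys, Matrix.map_apply,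
      MvPolynomial.smul_eq_C_mul, mul_comm]
  have hker : (polys (Aeps n k ε)).mulVec (fun c => (w' c).1) = 0 := by
    rw [hw', Matrix.mulVec_sub, hker₀, (selfDual_Aeps n k ε).mulVec_eq_zero, sub_zero]
  have key := eq_zero_of_mulVec_Aeps_eq_zero hn hk hε hker fun r j => by
    have h1 : linEval (w' (Sum.inr j)) (Pi.single (Sum.inl r) 1) =
        linEval (w (Sum.inr j)) (Pi.single (Sum.inl r) 1) +
        ∑ i, γ i * evalMat (Aeps n k ε) (Pi.single (Sum.inl r) 1) i (Sum.inl j) := by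
      change eval _ (w' (Sum.inr j)).1 = eval _ (w (Sum.inr j)).1 + _
      simp [w', JAt_inr, evalMat, polys, smul_eval]
    have h2 : ∀ i, evalMat (Aeps n k ε) (Pi.single (Sum.inl r) 1) i (Sum.inl j) =
        if j.1 = i + r then 1 else 0 := by
      intro i
      have := Aeps_mulVec_x hk ε (Pi.single (Sum.inl j) 1) i r
      rw [Matrix.mulVec_single_one, Pi.single_apply] at this
      refine Eq.trans this (if_congr ?_ rfl rfl)
      rw [Sum.inl.injEq, Fin.ext_iff, eq_comm]
    rw [h1, coefficients_of_mulVec_Aeps_eq_zero hn hk h0 hker₀ r j]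
    simp only [h2]
    split_ifs with h3
    · rw [Finset.sum_eq_single (⟨j - r, h3.2⟩ : Fin k)]
      · rw [if_pos (by simp only; omega), mul_one]
        exact add_neg_cancel _
      · intro i _ hi
        rw [if_neg fun h => hi (Fin.ext (by simp only; omega)), mul_zero]
      · simp
    · rw [zero_add]
      refine Finset.sum_eq_zero fun i _ => ?_
      rw [if_neg (by omega), mul_zero]
  have h4 := hw'.symm
  rw [key] at h4
  exact sub_eq_zero.1 h4

end Kernel

/-! ### The extra syzygies of 't Hooft matrices. -/

section THooft

theorem exists_common_zero {σ : Type} [Fintype σ] (hσ : 2 < Fintype.card σ) (l l' : LinForm σ) :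
    ∃ p : σ → ℂ, p ≠ 0 ∧ eval p l.1 = 0 ∧ eval p l'.1 = 0 := by
  have h := LinearMap.ker_ne_bot_of_finrank_lt (f := (linEval l).prod (linEval l')) (by
    simpa using hσ)
  obtain ⟨p, hp, hp0⟩ := (Submodule.ne_bot_iff _).1 h
  have := LinearMap.mem_ker.1 hp
  rw [LinearMap.prod_apply, Prod.mk_eq_zero] at this
  exact ⟨p, hp0, this.1, this.2⟩

variable {n k : ℕ}

theorem JAt_inl {k N : ℕ} {σ : Type} (A : LinMat k N σ) (j : Fin N) (i : Fin k) :
    JAt A (Sum.inl j) i = A i (Sum.inr j) := by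
  simp only [JAt, symJ, Fintype.sum_sum_type, Matrix.fromBlocks_apply₁₁, Matrix.fromBlocks_apply₁₂,
    Matrix.zero_apply, zero_smul, Finset.sum_const_zero, zero_add]
  rw [Finset.sum_eq_single j (fun l _ hl => by rw [Matrix.one_apply_ne' hl, zero_smul])
    (by simp), Matrix.one_apply_eq]
  exact one_smul ℂ (A i (Sum.inr j))

/-- For 't Hooft matrices the kernel of the monad is larger than its image. -/
theorem not_kerEqIm_of_isTHooftMatrix (hk : 0 < k) (hn : 0 < n)
    {T : LinMat k (n + k) (Coords n)} (hT : FullRank T) (h : IsTHooftMatrix n k T) :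
    ¬ KerEqIm T := by
  obtain ⟨a, l, l', hT'⟩ := h
  have hl : ∀ i j, (T i (Sum.inl j)).1 = C (a i j) * (l j).1 := by
    intro i j
    refine (congrFun (congrFun hT' i) (Sum.inl j)).trans ?_
    change ∑ c, C (a i c) * Matrix.diagonal (fun j => (l j).1) c j = _
    rw [Finset.sum_eq_single j (fun c _ hc => by rw [Matrix.diagonal_apply_ne _ hc, mul_zero])
      (by simp), Matrix.diagonal_apply_eq]
  have hr : ∀ i j, (T i (Sum.inr j)).1 = C (a i j) * (l' j).1 := by
    intro i j
    refine (congrFun (congrFun hT' i) (Sum.inr j)).trans ?_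
    change ∑ c, C (a i c) * Matrix.diagonal (fun j => (l' j).1) c j = _
    rw [Finset.sum_eq_single j (fun c _ hc => by rw [Matrix.diagonal_apply_ne _ hc, mul_zero])
      (by simp), Matrix.diagonal_apply_eq]
  intro hK
  -- Suppose the syzygy $l'_je_j-l_je_{N+j}$ equals $JT^t\gamma$. At a common zero $p\neq0$ of $l_j$
  -- and $l'_j$ this gives $\gamma^tT(p)=0$, so $\gamma=0$ by full rank and the syzygy itself is
  -- zero. For all $j$ together this makes $T=0$, contradicting full rank.
  have hzero : ∀ j, l j = 0 ∧ l' j = 0 := by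
    intro j
    obtain ⟨p, hp, hpl, hpl'⟩ := exists_common_zero (by simp; omega) (l j) (l' j)
    obtain ⟨γ, hγ⟩ := hK (Sum.elim (Pi.single j (l' j).1) (Pi.single j (-(l j).1))) (by
      rintro (c | c) <;> by_cases hc : c = j
      · subst hc
        rw [Sum.elim_inl, Pi.single_eq_same]
        exact (l' c).2
      · simpa [hc] using isHomogeneous_zero _ _ _
      · subst hc
        rw [Sum.elim_inr, Pi.single_eq_same]
        exact (-(l c)).2
      · simpa [hc] using isHomogeneous_zero _ _ _) (by
      funext i
      simp only [Matrix.mulVec, dotProduct, Fintype.sum_sum_type, Sum.elim_inl, Sum.elim_inr, polys,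
        Matrix.map_apply, hl, hr, Pi.zero_apply]
      rw [Finset.sum_eq_single j (by simp +contextual) (by simp),
        Finset.sum_eq_single j (by simp +contextual) (by simp), Pi.single_eq_same,
        Pi.single_eq_same]
      ring)
    have hγl : ∀ c, ∑ i, (T i (Sum.inr c)).1 * C (γ i) = (Pi.single j (l' j).1 : _ → _) c := by
      intro c
      have := congrFun hγ (Sum.inl c)
      simp only [Sum.elim_inl, Matrix.mulVec, dotProduct, polys, Matrix.map_apply, JAt_inl] at this
      exact this.symm
    have hγr : ∀ c, ∑ i, (T i (Sum.inl c)).1 * C (γ i) = (Pi.single j (l j).1 : _ → _) c := by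
      intro c
      have := congrFun hγ (Sum.inr c)
      simp only [Sum.elim_inr, Matrix.mulVec, dotProduct, polys, Matrix.map_apply, JAt_inr,
        NegMemClass.coe_neg, neg_mul, Finset.sum_neg_distrib, Pi.single_neg, Pi.neg_apply] at this
      exact (neg_injective this).symm
    have hγT : Matrix.vecMul γ (evalMat T p) = 0 := by
      have h1 : ∀ (m : Fin (n + k) → LinForm (Coords n)) (c : Fin (n + k)), eval p (m j).1 = 0 →
          eval p ((Pi.single j (m j).1 : Fin (n + k) → MvPolynomial (Coords n) ℂ) c) = 0 := by
        intro m c hm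
        by_cases hc : c = j
        · subst hc
          simpa using hm
        · simp [hc]
      funext c
      rcases c with c | c
      · have := h1 l c hpl
        rw [← hγr, map_sum] at this
        simp only [map_mul, eval_C] at this
        rw [Pi.zero_apply, ← this]
        change ∑ i, γ i * eval p (T i (Sum.inl c)).1 = _
        exact Finset.sum_congr rfl fun i _ => mul_comm _ _
      · have := h1 l' c hpl'
        rw [← hγl, map_sum] at this
        simp only [map_mul, eval_C] at this
        rw [Pi.zero_apply, ← this]
        change ∑ i, γ i * eval p (T i (Sum.inr c)).1 = _
        exact Finset.sum_congr rfl fun i _ => mul_comm _ _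
    have hγ0 : γ = 0 := by
      obtain ⟨D, hD⟩ := exists_mul_eq_one_of_rank _ (hT p hp)
      rw [← Matrix.vecMul_one γ, ← hD, ← Matrix.vecMul_vecMul, hγT, Matrix.zero_vecMul]
    have h1 := hγl j
    have h2 := hγr j
    simp only [hγ0, Pi.zero_apply, C_0, mul_zero, Finset.sum_const_zero, Pi.single_eq_same] at h1 h2
    exact ⟨Subtype.ext h2.symm, Subtype.ext h1.symm⟩
  have hT0 : evalMat T (fun _ => 1) = 0 := by
    ext i (j | j)
    · change eval _ (T i (Sum.inl j)).1 = 0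
      rw [hl, (hzero j).1]
      simp
    · change eval _ (T i (Sum.inr j)).1 = 0
      rw [hr, (hzero j).2]
      simp
  have := hT (fun _ => 1) (fun h => one_ne_zero (congrFun h (Sum.inl 0)))
  rw [hT0, Matrix.rank_zero] at this
  omega

end THooft

/-! ### Semicontinuity of the rank. -/

section Semicontinuity

/-- Replaces the choice of a nonvanishing minor: for fixed `P` and `Q`, the determinant of `P * M' *
Q` is a polynomial in the entries of `M'`, and where it is nonzero the rank of `M'` is at least that
of `M`. -/
theorem exists_mul_mul_eq_one {ι κ : Type} [Fintype ι] [DecidableEq ι] [Fintype κ] [DecidableEq κ]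
    (M : Matrix ι κ ℂ) : ∃ (P : Matrix (Fin M.rank) ι ℂ) (Q : Matrix κ (Fin M.rank) ℂ),
      P * M * Q = 1 := by
  obtain ⟨φ⟩ : Nonempty ((Fin M.rank → ℂ) ≃ₗ[ℂ] LinearMap.range M.mulVecLin) :=
    ⟨LinearEquiv.ofFinrankEq _ _ (by rw [Module.finrank_fin_fun]; rfl)⟩
  obtain ⟨q, hq⟩ := M.mulVecLin.rangeRestrict.exists_rightInverse_of_surjective
    (LinearMap.range_rangeRestrict _)
  have hinj : LinearMap.ker ((LinearMap.range M.mulVecLin).subtype ∘ₗ φ.toLinearMap) = ⊥ :=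
    LinearMap.ker_eq_bot.2 (Subtype.val_injective.comp φ.injective)
  obtain ⟨g, hg⟩ := LinearMap.exists_leftInverse_of_injective _ hinj
  have hM : M.mulVecLin ∘ₗ (q ∘ₗ φ.toLinearMap) =
      (LinearMap.range M.mulVecLin).subtype ∘ₗ φ.toLinearMap := by
    ext1 x
    refine LinearMap.ext fun c => ?_
    exact congrArg Subtype.val (LinearMap.congr_fun hq (φ (Pi.single x c)))
  refine ⟨LinearMap.toMatrix' g, LinearMap.toMatrix' (q ∘ₗ φ.toLinearMap), ?_⟩
  have hM' : LinearMap.toMatrix' M.mulVecLin = M := by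
    rw [← Matrix.toLin'_apply', LinearMap.toMatrix'_toLin']
  have h := congrArg LinearMap.toMatrix' (show g ∘ₗ (M.mulVecLin ∘ₗ (q ∘ₗ φ.toLinearMap)) =
    LinearMap.id by rw [hM, hg])
  rwa [LinearMap.toMatrix'_comp, LinearMap.toMatrix'_comp, hM', LinearMap.toMatrix'_id,
    ← Matrix.mul_assoc] at h

/-- Lower semicontinuity of the rank in the Zariski topology. -/
theorem exists_rank_le_of_mem_zariskiClosure {ι κ σ : Type} [Fintype ι] [DecidableEq ι] [Fintype κ]
    [DecidableEq κ] {k N : ℕ}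
    (M : Matrix ι κ (MvPolynomial (Fin k × (Fin N ⊕ Fin N) × σ) ℂ)) {S : Set (LinMat k N σ)}
    {B : LinMat k N σ} (hB : B ∈ zariskiClosure S) :
    ∃ A ∈ S, (M.map (eval (coeffs B))).rank ≤ (M.map (eval (coeffs A))).rank := by
  obtain ⟨P, Q, hPQ⟩ := exists_mul_mul_eq_one (M.map (eval (coeffs B)))
  by_contra! h
  let R := MvPolynomial (Fin k × (Fin N ⊕ Fin N) × σ) ℂ
  have hev : ∀ A : LinMat k N σ,
      eval (coeffs A) (P.map (C : ℂ → R) * M * Q.map (C : ℂ → R)).det =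
      (P * M.map (eval (coeffs A)) * Q).det := by
    intro A
    rw [RingHom.map_det]
    congr 1
    change (P.map (C : ℂ → R) * M * Q.map (C : ℂ → R)).map (eval (coeffs A)) = _
    rw [Matrix.map_mul, Matrix.map_mul]
    congr 2
    · ext
      simp
    · ext
      simp
  have h1 := hB (P.map (C : ℂ → R) * M * Q.map (C : ℂ → R)).det fun A hA => by
    rw [hev]
    by_contra hne
    refine (h A hA).not_ge ?_
    have h2 := rank_eq_of_det_mul_ne_zero _ _ hne
    exact h2.symm.le.trans (Matrix.rank_mul_le_right _ _)
  rw [hev, hPQ, Matrix.det_one] at h1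
  exact one_ne_zero h1

end Semicontinuity

/-! ### `KerEqIm` as a rank condition. -/

section SymmetricProduct

variable {k N : ℕ} {σ : Type}

/-- The matrix of the linear map taking a vector `w` of linear forms to the coefficients of `A w`;
the arguments are the coefficients of `A`. -/
def productMatrix [DecidableEq σ] {R : Type} [CommRing R] (a : Fin k × (Fin N ⊕ Fin N) × σ → R) :
    Matrix (Fin k × σ × σ) ((Fin N ⊕ Fin N) × σ) R :=
  fun z t => (if z.2.2 = t.2 then a (z.1, t.1, z.2.1) else 0) +
    if z.2.1 = t.2 then a (z.1, t.1, z.2.2) else 0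

theorem productMatrix_mulVec [Fintype σ] [DecidableEq σ] (a : Fin k × (Fin N ⊕ Fin N) × σ → ℂ)
    (w : (Fin N ⊕ Fin N) × σ → ℂ) (i : Fin k) (u v : σ) :
    (productMatrix a).mulVec w (i, u, v) =
      ∑ c, a (i, c, u) * w (c, v) + ∑ c, a (i, c, v) * w (c, u) := by
  simp only [Matrix.mulVec, dotProduct, productMatrix, Fintype.sum_prod_type, add_mul,
    Finset.sum_add_distrib, ite_mul, zero_mul, Finset.sum_ite_eq, Finset.mem_univ, if_true]

theorem productMatrix_map [DecidableEq σ] (a : Fin k × (Fin N ⊕ Fin N) × σ → ℂ) :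
    (productMatrix fun t => (X t : MvPolynomial (Fin k × (Fin N ⊕ Fin N) × σ) ℂ)).map (eval a) =
      productMatrix a := by
  ext z t
  simp only [productMatrix, Matrix.map_apply, map_add]
  split_ifs <;> simp

variable [Fintype σ]

/-- The vector of linear forms with given coefficients. -/
def linVec {ι : Type} (w : ι × σ → ℂ) (c : ι) : LinForm σ := ∑ v, w (c, v) • coord v

theorem linEval_linVec {ι : Type} (w : ι × σ → ℂ) (c : ι) (p : σ → ℂ) :
    linEval (linVec w c) p = ∑ v, w (c, v) * p v := by
  change eval p (linVec w c).1 = _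
  simp [linVec, coord, smul_eval]

variable [DecidableEq σ]

theorem coeff_linVec {ι : Type} (w : ι × σ → ℂ) (c : ι) (v : σ) :
    linEval (linVec w c) (Pi.single v 1) = w (c, v) := by
  rw [linEval_linVec, Finset.sum_eq_single v (fun u _ hu => by simp [hu]) (by simp)]
  simp

theorem linVec_coeff {ι : Type} (f : ι → LinForm σ) (c : ι) :
    linVec (fun t => linEval (f t.1) (Pi.single t.2 1)) c = f c := by
  refine Subtype.ext ?_
  rw [LinForm.eq_sum (f c).2]
  simp only [linVec, AddSubmonoidClass.coe_finsetSum, SetLike.val_smul, coord,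
    MvPolynomial.smul_eq_C_mul]
  refine Finset.sum_congr rfl fun v _ => ?_
  rw [← eval_single (f c).2]
  rfl

/-- The rows of the product matrix are the polarised coefficients of $Aw$. The diagonal ones are
doubled, which is harmless in characteristic zero. -/
theorem productMatrix_mulVec_eq_zero_iff (A : LinMat k N σ) (w : (Fin N ⊕ Fin N) × σ → ℂ) :
    (productMatrix (coeffs A)).mulVec w = 0 ↔
      (polys A).mulVec (fun c => (linVec w c).1) = 0 := by
  have hcoeff : ∀ i c u, coeffs A (i, c, u) = evalMat A (Pi.single u 1) i c := fun i c u =>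
    (eval_single (A i c).2 u).symm
  constructor
  · intro h
    funext i
    refine MvPolynomial.funext fun p => ?_
    have h1 : eval p ((polys A).mulVec (fun c => (linVec w c).1) i) =
        ∑ u, ∑ v, p u * p v * ∑ c, coeffs A (i, c, u) * w (c, v) := by
      have hA : ∀ c, eval p (A i c).1 = ∑ u, coeffs A (i, c, u) * p u := by
        intro c
        rw [LinForm.eq_sum (A i c).2]
        simp [coeffs]
      have hw : ∀ c, eval p (linVec w c).1 = ∑ v, w (c, v) * p v := fun c => linEval_linVec w c p
      simp only [Matrix.mulVec, dotProduct, map_sum, map_mul, polys, Matrix.map_apply, hA, hw,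
        Finset.sum_mul_sum]
      simp only [Finset.mul_sum]
      rw [Finset.sum_comm]
      refine Finset.sum_congr rfl fun u _ => ?_
      rw [Finset.sum_comm]
      refine Finset.sum_congr rfl fun v _ => Finset.sum_congr rfl fun c _ => ?_
      ring
    have h2 : ∑ u, ∑ v, p u * p v * ∑ c, coeffs A (i, c, u) * w (c, v) =
        ∑ u, ∑ v, p u * p v * ∑ c, coeffs A (i, c, v) * w (c, u) := by
      rw [Finset.sum_comm]
      refine Finset.sum_congr rfl fun u _ => Finset.sum_congr rfl fun v _ => ?_
      rw [mul_comm (p v)]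
    rw [h1, Pi.zero_apply, map_zero, ← add_self_eq_zero]
    nth_rewrite 2 [h2]
    simp only [← Finset.sum_add_distrib, ← mul_add]
    refine Finset.sum_eq_zero fun u _ => Finset.sum_eq_zero fun v _ => ?_
    have h3 := congrFun h (i, u, v)
    rw [productMatrix_mulVec, Pi.zero_apply, ← Finset.sum_add_distrib] at h3
    rw [h3, mul_zero]
  · intro h
    funext ⟨i, u, v⟩
    have := congrFun (polarize h (Pi.single u 1) (Pi.single v 1)) i
    simp only [coeff_linVec] at this
    rw [productMatrix_mulVec]
    simp only [hcoeff]
    exact this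

/-- The coefficients of a constant combination of the columns of `J Aᵗ`. -/
def columnCombination (A : LinMat k N σ) : (Fin k → ℂ) →ₗ[ℂ] (Fin N ⊕ Fin N) × σ → ℂ :=
  Matrix.mulVecLin (Matrix.of fun (t : (Fin N ⊕ Fin N) × σ) (i : Fin k) =>
     linEval (JAt A t.1 i) (Pi.single t.2 1))

theorem linVec_columnCombination (A : LinMat k N σ) (γ : Fin k → ℂ) :
    (fun c => (linVec (columnCombination A γ) c).1) =
      (polys (JAt A)).mulVec fun j => C (γ j) := by
  have : columnCombination A γ = fun t : (Fin N ⊕ Fin N) × σ =>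
      linEval (∑ i, γ i • JAt A t.1 i) (Pi.single t.2 1) := by
    funext t
    change ∑ i, linEval (JAt A t.1 i) (Pi.single t.2 1) * γ i =
      eval (Pi.single t.2 1) (∑ i, γ i • JAt A t.1 i : LinForm σ).1
    simp only [AddSubmonoidClass.coe_finsetSum, SetLike.val_smul, map_sum, smul_eval]
    exact Finset.sum_congr rfl fun i _ => mul_comm _ _
  rw [this]
  funext c
  rw [linVec_coeff (fun c => ∑ i, γ i • JAt A c i) c]
  simp only [AddSubmonoidClass.coe_finsetSum, SetLike.val_smul, Matrix.mulVec, dotProduct, polys,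
    Matrix.map_apply, MvPolynomial.smul_eq_C_mul, mul_comm]

/-- The kernel of the product matrix is contained in the span of the $k$ columns of $JA^t$, so it
has dimension at most $k$. -/
theorem KerEqIm.le_rank {A : LinMat k N σ} (h : KerEqIm A) :
    Fintype.card ((Fin N ⊕ Fin N) × σ) ≤ (productMatrix (coeffs A)).rank + k := by
  have h1 := LinearMap.finrank_range_add_finrank_ker (productMatrix (coeffs A)).mulVecLin
  rw [Module.finrank_fintype_fun_eq_card] at h1
  have h2 : LinearMap.ker (productMatrix (coeffs A)).mulVecLin ≤
      LinearMap.range (columnCombination A) := by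
    intro w hw
    obtain ⟨γ, hγ⟩ := h _ (fun c => (linVec w c).2) ((productMatrix_mulVec_eq_zero_iff A w).1 hw)
    refine ⟨γ, ?_⟩
    rw [← linVec_columnCombination] at hγ
    funext ⟨c, v⟩
    exact (coeff_linVec (columnCombination A γ) c v).symm.trans
      ((congrArg (fun f => linEval f (Pi.single v 1)) (Subtype.ext (congrFun hγ c).symm)).trans
        (coeff_linVec w c v))
  have h3 := Submodule.finrank_mono h2
  have h4 := LinearMap.finrank_range_le (columnCombination A)
  rw [Module.finrank_fin_fun] at h4
  change _ ≤ Module.finrank ℂ (LinearMap.range (productMatrix (coeffs A)).mulVecLin) + k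
  omega

/-- By self-duality the columns of $JA^t$ lie in the kernel, and by full rank they are independent.
A kernel of dimension at most $k$ is therefore their span. -/
theorem kerEqIm_of_le_rank [Nonempty σ] {A : LinMat k N σ} (hA : FullRank A) (hdual : SelfDual A)
    (h : Fintype.card ((Fin N ⊕ Fin N) × σ) ≤ (productMatrix (coeffs A)).rank + k) :
    KerEqIm A := by
  have h1 := LinearMap.finrank_range_add_finrank_ker (productMatrix (coeffs A)).mulVecLin
  rw [Module.finrank_fintype_fun_eq_card] at h1
  change _ ≤ Module.finrank ℂ (LinearMap.range (productMatrix (coeffs A)).mulVecLin) + k at h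
  have h2 : LinearMap.range (columnCombination A) ≤
      LinearMap.ker (productMatrix (coeffs A)).mulVecLin := by
    rintro _ ⟨γ, rfl⟩
    refine (productMatrix_mulVec_eq_zero_iff A _).2 ?_
    rw [linVec_columnCombination, hdual.mulVec_eq_zero]
  have hinj : Function.Injective (columnCombination A) := by
    refine (injective_iff_map_eq_zero _).2 fun γ hγ => ?_
    have h3 := linVec_columnCombination A γ
    rw [hγ] at h3
    have h4 : (polys (JAt A)).mulVec (fun j => C (γ j)) = 0 := by
      rw [← h3]
      funext c
      simp [linVec]
    have h5 := mulVec_JAt_injective hA h4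
    exact funext fun j => C_eq_zero.1 (congrFun h5 j)
  have h3 : LinearMap.range (columnCombination A) =
      LinearMap.ker (productMatrix (coeffs A)).mulVecLin := by
    refine Submodule.eq_of_le_of_finrank_le h2 ?_
    rw [LinearMap.finrank_range_of_inj hinj, Module.finrank_fin_fun]
    omega
  intro w hw hAw
  have h4 : (fun t : (Fin N ⊕ Fin N) × σ => linEval ⟨w t.1, hw t.1⟩ (Pi.single t.2 1)) ∈
      LinearMap.ker (productMatrix (coeffs A)).mulVecLin := by
    refine (productMatrix_mulVec_eq_zero_iff A _).2 ?_
    simp only [linVec_coeff (fun c => (⟨w c, hw c⟩ : LinForm σ))]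
    exact hAw
  rw [← h3] at h4
  obtain ⟨γ, hγ⟩ := h4
  refine ⟨γ, ?_⟩
  rw [← linVec_columnCombination, hγ]
  simp only [linVec_coeff (fun c => (⟨w c, hw c⟩ : LinForm σ))]

theorem KerEqIm.exists_of_mem_zariskiClosure [Nonempty σ] {B : LinMat k N σ} (h : KerEqIm B)
    {S : Set (LinMat k N σ)} (hB : B ∈ zariskiClosure S)
    (hS : ∀ A ∈ S, FullRank A ∧ SelfDual A) : ∃ A ∈ S, KerEqIm A := by
  obtain ⟨A, hAS, hA⟩ := exists_rank_le_of_mem_zariskiClosure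
    (productMatrix fun t => (X t : MvPolynomial (Fin k × (Fin N ⊕ Fin N) × σ) ℂ)) hB
  rw [productMatrix_map, productMatrix_map] at hA
  exact ⟨A, hAS, kerEqIm_of_le_rank (hS A hAS).1 (hS A hAS).2 (h.le_rank.trans (by omega))⟩

end SymmetricProduct

/-! ### Isomorphic bundles have isomorphic twists. -/

section TwistFunctoriality

/-- The tensor product of an isomorphism with a presheaf of modules. -/
def tensorObjIso {X : Scheme.{0}}
    {M M' : PresheafOfModules.{0} (X.presheaf ⋙ forget₂ CommRingCat.{0} RingCat.{0})} (e : M ≅ M')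
    (N : PresheafOfModules.{0} (X.presheaf ⋙ forget₂ CommRingCat.{0} RingCat.{0})) :
    PresheafOfModules.Monoidal.tensorObj (R := X.presheaf) M N ≅
      PresheafOfModules.Monoidal.tensorObj (R := X.presheaf) M' N :=
  MonoidalCategory.whiskerRightIso e N

/-- The tensor product of an isomorphism with a sheaf of modules. -/
def tensorIso {X : Scheme.{0}} {M M' : X.Modules} (e : M ≅ M') (N : X.Modules) :
    tensor M N ≅ tensor M' N :=
  (PresheafOfModules.sheafification (𝟙 X.ringCatSheaf.obj)).mapIso
    (tensorObjIso ((Scheme.Modules.toPresheafOfModules X).mapIso e) N.val)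

theorem subsingleton_H0_twist_of_iso {σ : Type} {M M' : (PP σ).Modules} (e : M ≅ M') (d : ℤ)
    (h : Subsingleton (H0 (twist M d))) : Subsingleton (H0 (twist M' d)) := by
  let f : twist M d ≅ twist M' d := tensorIso e (O σ d)
  refine ⟨fun s t => ?_⟩
  have key : ∀ s : H0 (twist M' d), f.hom.app ⊤ (f.inv.app ⊤ s) = s := fun s =>
    ConcreteCategory.congr_hom (congrArg (fun φ => Scheme.Modules.Hom.app φ ⊤) f.inv_hom_id) s
  rw [← key s, ← key t, Subsingleton.elim (f.inv.app ⊤ s) (f.inv.app ⊤ t)]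

end TwistFunctoriality

/-! ### Exclusion of limits of 't Hooft bundles. -/

section Limits

variable {n k : ℕ}

theorem coords_exists_ne (n : ℕ) (hn : 2 ≤ n) (u : Coords n) :
    ∃ v t : Coords n, u ≠ v ∧ u ≠ t ∧ v ≠ t := by
  obtain ⟨v, hv⟩ := Finset.exists_mem_notMem_of_card_lt_card (s := {u})
    (t := (Finset.univ : Finset (Coords n))) (by simp; omega)
  obtain ⟨t, ht⟩ := Finset.exists_mem_notMem_of_card_lt_card (s := {u, v})
    (t := (Finset.univ : Finset (Coords n)))
    (lt_of_le_of_lt Finset.card_le_two (by simp; omega))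
  simp only [Finset.mem_insert, Finset.mem_singleton, not_or] at hv ht
  exact ⟨v, t, fun h => hv.2 h.symm, fun h => ht.2.1 h.symm, fun h => ht.2.2 h.symm⟩

/-- The condition `KerEqIm` depends only on the cohomology bundle. -/
theorem KerEqIm.of_iso (hn : 2 ≤ n) {A B : LinMat k (n + k) (Coords n)} (hA : FullRank A)
    (hA' : SelfDual A) (hB : FullRank B) (hB' : SelfDual B) (e : bundle A hA' ≅ bundle B hB')
    (h : KerEqIm A) : KerEqIm B :=
  kerEqIm_of_subsingleton_H0 hB hB' (by
      obtain ⟨v, _, hv, -⟩ := coords_exists_ne n hn (Sum.inl 0)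
      exact ⟨_, v, hv⟩)
    (subsingleton_H0_twist_of_iso e 1
      (subsingleton_H0_of_kerEqIm hA hA' h (coords_exists_ne n hn)))

/-- `KerEqIm` passes from `A` to `B` by isomorphism of bundles, from `B` to some `A'` in the set by
semicontinuity, and from `A'` to a 't Hooft matrix `T` by isomorphism again, where it fails. -/
theorem not_isLimitOfTHooft_of_kerEqIm (hn : 2 ≤ n) (hk : 0 < k)
    {A : LinMat k (n + k) (Coords n)} (hA : FullRank A) (hA' : SelfDual A) (h : KerEqIm A) :
    ¬ IsLimitOfTHooft n k (bundle A hA') := by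
  rintro ⟨B, hB, ⟨e⟩, hcl⟩
  have hKB := h.of_iso hn hA hA' hB.full_rank hB.selfDual e
  obtain ⟨A', ⟨hA'', T, hT, hTH, ⟨e'⟩⟩, hK⟩ := hKB.exists_of_mem_zariskiClosure hcl
    fun A' hA' => ⟨hA'.1.full_rank, hA'.1.selfDual⟩
  exact not_kerEqIm_of_isTHooftMatrix hk (by omega) hT.full_rank hTH
    (hK.of_iso hn hA''.full_rank hA''.selfDual hT.full_rank hT.selfDual e')

end Limits

end RSInstanton

end

theorem mainTheorem12 (n k : ℕ) (hn : 2 ≤ n) (hk : 3 ≤ k) :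
    ∃ δ : ℝ, 0 < δ ∧ ∀ ε : ℂ, ε ≠ 0 → ‖ε‖ < δ →
      ∃ h : RSInstanton.IsSymplecticInstanton n k (RSInstanton.Aeps n k ε),
        RSInstanton.IsRSMatrix n k (RSInstanton.Aeps n k ε) ∧
        Subsingleton
          (RSInstanton.H0 (RSInstanton.twist (RSInstanton.bundle (RSInstanton.Aeps n k ε) h.selfDual) 1)) ∧
        ¬ RSInstanton.IsLimitOfTHooft n k (RSInstanton.bundle (RSInstanton.Aeps n k ε) h.selfDual) := by
  -- The radius comes from two open conditions that hold at $\varepsilon=0$: full rank of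
  -- $H_\varepsilon$ off $y=0$, and injectivity of the perturbed skew system. The condition
  -- $\varepsilon\neq0$ enters only through `kerEqIm_Aeps`.
  obtain ⟨δ, hδ, h⟩ := Metric.eventually_nhds_iff.1
    ((RSInstanton.eventually_vecMul_Heps_ne_zero (n := n) hk).and
      (RSInstanton.eventually_skew_eq_zero n hk))
  refine ⟨δ, hδ, fun ε h0 hε => ?_⟩
  obtain ⟨hrank, hskew⟩ := h (by rwa [dist_zero_right])
  have hfull := RSInstanton.fullRank_Aeps hrank
  have hdual := RSInstanton.selfDual_Aeps n k ε
  have hker := RSInstanton.kerEqIm_Aeps hn hk h0 hskew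
  exact ⟨⟨hdual, hfull, RSInstanton.trivialSplittingType_Aeps hn hk ε⟩,
    RSInstanton.isRSMatrix_Aeps hrank,
    RSInstanton.subsingleton_H0_of_kerEqIm hfull hdual hker (RSInstanton.coords_exists_ne n hn),
    RSInstanton.not_isLimitOfTHooft_of_kerEqIm hn (by omega) hfull hdual hker⟩
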